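/- Consider the class of equations $$f(x)u_t=(g(x)e^{nu}u_x)_x+h(x)e^{mu},\qquad fgn\ne0,$$ with arbitrary elements $\theta=(f,g,h,n,m)$, where $f,g,h$ are smooth real functions of $x$ on a nonempty open interval $I$ and $n,m$ are real constants. A point transformation is a smooth map $\tilde t=T(t,x,u)$, $\tilde x=X(t,x,u)$, $\tilde u=U(t,x,u)$ with $|\partial(T,X,U)/\partial(t,x,u)|\ne0$ on a product of three nonempty open intervals (the $x$-interval, $J$, lying in $I$). It maps the equation of $\theta$ to that of $\tilde\theta$ if the latter, rewritten in the old variables by the second prolongation, holds identically on the manifold defined by the former in the second-order jet space. A generalized extended equivalence transformation of the class over $I$ is a rule that assigns to every $\theta$ a point transformation and a tuple $\tilde\theta$ of arbitrary elements of the same class over the set of values of $\tilde x$, such that the point transformation maps the equation of $\theta$ to that of $\tilde\theta$, both depend continuously on $\theta$ (along smooth one-parameter families of tuples; the dependence may be nonlocal), and $\theta\mapsto\tilde\theta$ is injective (equal values $\tilde\theta$ over the same set imply equal $x$-intervals $J$ and equal $\theta$ on them). These rules form the generalized extended equivalence group $\hat G^\sim$. A usual equivalence transformation is such a rule for which moreover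 $(T,X,U)$ is the same for all $\theta$ and the values of $\tilde\theta$ are functions of $t,x,u$ and of the values of $\theta$ at $x$; these rules form the usual equivalence group $G^\sim$. **Theorem.** The transformations by which the elements of $\hat G^\sim$ act on the equations of the class are exactly $$\tilde t=\delta_1t+\delta_2,\quad \tilde x=\varphi(x),\quad \tilde u=\delta_3u+\psi(x),$$ $$\tilde f=\frac{\delta_0\delta_1}{\varphi_x}|\Psi|f,\quad \tilde g=\delta_0\varphi_x\Psi^2g,\quad \tilde h=\frac{\delta_0\delta_3}{\varphi_x}e^{-\frac m{\delta_3}\psi}|\Psi|h,\quad \tilde n=\frac n{\delta_3},\quad \tilde m=\frac m{\delta_3},$$ where $\tilde f,\tilde g,\tilde h$ are taken at $\tilde x=\varphi(x)$, $\varphi$ is an arbitrary smooth function of $x$ with $\varphi_x\ne0$, $$\psi(x)=-\frac{\delta_3}n\ln|\Psi(x)|,\qquad \Psi(x)=\delta_4\int\frac{dx}{g(x)}+\delta_5,$$ $\Psi\ne0$ on the $x$-interval considered, and $\delta_0,\dots,\delta_5$ are arbitrary constants with $\delta_0\delta_1\delta_3\ne0$, $(\delta_4,\delta_5)\ne(0,0)$.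 More precisely: 1. every element of $\hat G^\sim$ acts on every equation of the class by these formulas, for some $\varphi$ and constants $\delta_j$ (which may vary with $\theta$); 2. for every $\theta$ and every choice of $\varphi$, of $\delta_0,\dots,\delta_5$ and of the domain, there is an element of $\hat G^\sim$ that acts on the equation of $\theta$ by the chosen transformation, and on every equation of the class by the formulas with the same $\varphi$ and the same $\delta_j$; 3. the usual equivalence group $G^\sim$ is singled out by the condition $\delta_4=0$: its elements act on every equation of the class by the above formulas with $\delta_4=0$, and every transformation of the above form with $\delta_4=0$ is induced by an element of $G^\sim$ that acts on all equations of the class with the same $\varphi,\delta_0,\dots,\delta_4$ (and with $\delta_5$ depending on $n$); 4. the set of transformations of the above form, and its subset given by $\delta_4=0$, are closed under composition and inversion, wherever these are defined. -/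

import Mathlib

open scoped ContDiff
open Set Filter Topology

/-- A tuple `(f, g, h, n, m)` of arbitrary elements of the class
`f(x) u_t = (g(x) e^{n u} u_x)_x + h(x) e^{m u}`. -/
structure Coeffs where
  f : ℝ → ℝ
  g : ℝ → ℝ
  h : ℝ → ℝ
  n : ℝ
  m : ℝ

/-- The tuple defines an equation of the class for `x ∈ I`: `f`, `g`, `h` are smooth on `I`
and `n f g ≠ 0` there. -/
structure Coeffs.InClass (θ : Coeffs) (I : Set ℝ) : Prop where
  smooth_f : ContDiffOn ℝ ∞ θ.f I
  smooth_g : ContDiffOn ℝ ∞ θ.g I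
  smooth_h : ContDiffOn ℝ ∞ θ.h I
  f_ne : ∀ x ∈ I, θ.f x ≠ 0
  g_ne : ∀ x ∈ I, θ.g x ≠ 0
  n_ne : θ.n ≠ 0

/-- Two tuples of arbitrary elements coincide over the set `S`. -/
def Coeffs.AgreeOn (S : Set ℝ) (θ θ' : Coeffs) : Prop :=
  EqOn θ.f θ'.f S ∧ EqOn θ.g θ'.g S ∧ EqOn θ.h θ'.h S ∧ θ.n = θ'.n ∧ θ.m = θ'.m

/-- Data of a local transformation `t̃ = T(t,x,u)`, `x̃ = X(t,x,u)`, `ũ = U(t,x,u)`,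
considered on the box `domT × domX × domU`. -/
structure PointTransf where
  domT : Set ℝ
  domX : Set ℝ
  domU : Set ℝ
  T : ℝ → ℝ → ℝ → ℝ
  X : ℝ → ℝ → ℝ → ℝ
  U : ℝ → ℝ → ℝ → ℝ

namespace PointTransf

/-- The domain box is a product of nonempty open intervals, the `x`-interval lying in `I`. -/
structure HasDomainIn (Φ : PointTransf) (I : Set ℝ) : Prop where
  openT : IsOpen Φ.domT
  openX : IsOpen Φ.domX
  openU : IsOpen Φ.domU
  connT : Φ.domT.OrdConnected
  connX : Φ.domX.OrdConnected
  connU : Φ.domU.OrdConnected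
  nonemptyT : Φ.domT.Nonempty
  nonemptyX : Φ.domX.Nonempty
  nonemptyU : Φ.domU.Nonempty
  subset : Φ.domX ⊆ I

/-- The point `(t, x, u)` belongs to the domain box. -/
def Mem (Φ : PointTransf) (t x u : ℝ) : Prop :=
  t ∈ Φ.domT ∧ x ∈ Φ.domX ∧ u ∈ Φ.domU

/-- The set of values of the new independent variable `x̃`. -/
def imageX (Φ : PointTransf) : Set ℝ :=
  {y | ∃ t x u, Φ.Mem t x u ∧ Φ.X t x u = y}

/-- The Jacobi matrix `∂(T,X,U)/∂(t,x,u)`. -/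
noncomputable def jacobian (Φ : PointTransf) (t x u : ℝ) : Matrix (Fin 3) (Fin 3) ℝ :=
  !![deriv (fun s => Φ.T s x u) t, deriv (fun y => Φ.T t y u) x, deriv (fun w => Φ.T t x w) u;
     deriv (fun s => Φ.X s x u) t, deriv (fun y => Φ.X t y u) x, deriv (fun w => Φ.X t x w) u;
     deriv (fun s => Φ.U s x u) t, deriv (fun y => Φ.U t y u) x, deriv (fun w => Φ.U t x w) u]

/-- `Φ` is a nondegenerate smooth point transformation on its domain box. -/
structure IsPointTransf (Φ : PointTransf) (I : Set ℝ) : Prop where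
  domain : Φ.HasDomainIn I
  smooth_T : ContDiffOn ℝ ∞ (fun p : ℝ × ℝ × ℝ => Φ.T p.1 p.2.1 p.2.2)
    (Φ.domT ×ˢ Φ.domX ×ˢ Φ.domU)
  smooth_X : ContDiffOn ℝ ∞ (fun p : ℝ × ℝ × ℝ => Φ.X p.1 p.2.1 p.2.2)
    (Φ.domT ×ˢ Φ.domX ×ˢ Φ.domU)
  smooth_U : ContDiffOn ℝ ∞ (fun p : ℝ × ℝ × ℝ => Φ.U p.1 p.2.1 p.2.2)
    (Φ.domT ×ˢ Φ.domX ×ˢ Φ.domU)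
  nondegenerate : ∀ t x u, Φ.Mem t x u → (Φ.jacobian t x u).det ≠ 0

/-- `Φ₀` is the restriction of `Φ` to a smaller box. -/
def IsRestrictionOf (Φ₀ Φ : PointTransf) : Prop :=
  ∀ t x u, Φ₀.Mem t x u →
    Φ.Mem t x u ∧ Φ.T t x u = Φ₀.T t x u ∧ Φ.X t x u = Φ₀.X t x u ∧ Φ.U t x u = Φ₀.U t x u

end PointTransf

/-- The derivative with respect to `t` of a function of `(t, x)`. -/
noncomputable def Dt (F : ℝ → ℝ → ℝ) : ℝ → ℝ → ℝ := fun t x => deriv (fun s => F s x) t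

/-- The derivative with respect to `x` of a function of `(t, x)`. -/
noncomputable def Dx (F : ℝ → ℝ → ℝ) : ℝ → ℝ → ℝ := fun t x => deriv (fun y => F t y) x

/-- The determinant `∂(T,X)/∂(t,x)` of a change of the independent variables. -/
noncomputable def jacTX (T X : ℝ → ℝ → ℝ) : ℝ → ℝ → ℝ := fun t x =>
  Dt T t x * Dx X t x - Dx T t x * Dt X t x

/-- The derivative with respect to the new variable `t̃ = T(t,x)`, expressed in `(t,x)`:
`∂_t̃ = (X_x ∂_t - X_t ∂_x) / (T_t X_x - T_x X_t)`. -/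
noncomputable def newDt (T X F : ℝ → ℝ → ℝ) : ℝ → ℝ → ℝ := fun t x =>
  (Dt F t x * Dx X t x - Dx F t x * Dt X t x) / jacTX T X t x

/-- The derivative with respect to the new variable `x̃ = X(t,x)`, expressed in `(t,x)`:
`∂_x̃ = (T_t ∂_x - T_x ∂_t) / (T_t X_x - T_x X_t)`. -/
noncomputable def newDx (T X F : ℝ → ℝ → ℝ) : ℝ → ℝ → ℝ := fun t x =>
  (Dt T t x * Dx F t x - Dx T t x * Dt F t x) / jacTX T X t x

namespace Coeffs

/-- Left minus right hand side of the equation with arbitrary elements `θ`, evaluated at `(t,x)`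
for the function `u = v(t,x)`. -/
noncomputable def residual (θ : Coeffs) (v : ℝ → ℝ → ℝ) (t x : ℝ) : ℝ :=
  θ.f x * Dt v t x
    - (Dx (fun s y => θ.g y * Real.exp (θ.n * v s y) * Dx v s y) t x
      + θ.h x * Real.exp (θ.m * v t x))

/-- Left minus right hand side of the equation with arbitrary elements `θ` in the new variables
`t̃ = T`, `x̃ = X`, `ũ = U`, which are given as functions of the parameters `(t,x)`. -/
noncomputable def newResidual (θ : Coeffs) (T X U : ℝ → ℝ → ℝ) (t x : ℝ) : ℝ :=
  θ.f (X t x) * newDt T X U t x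
    - (newDx T X (fun s y => θ.g (X s y) * Real.exp (θ.n * U s y) * newDx T X U s y) t x
      + θ.h (X t x) * Real.exp (θ.m * U t x))

end Coeffs

/-- The point transformation `Φ` maps the equation with arbitrary elements `θ` to the equation with
arbitrary elements `θ'`: the second equation, rewritten in the old variables by means of the second
prolongation of `Φ`, is an identity on the manifold determined by the first equation in the
second-order jet space. A jet is represented by a smooth function `v` having it at `(t,x)`
(`v` need not be a solution: only its jet at `(t,x)` has to satisfy the equation); the prolongation
is defined at the jets at which the transformed graph is transversal to the `ũ`-direction. -/
def MapsEquation (θ : Coeffs) (Φ : PointTransf) (θ' : Coeffs) : Prop :=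
  ∀ v : ℝ → ℝ → ℝ, ContDiff ℝ ∞ (fun p : ℝ × ℝ => v p.1 p.2) →
    ∀ t x, Φ.Mem t x (v t x) →
      jacTX (fun s y => Φ.T s y (v s y)) (fun s y => Φ.X s y (v s y)) t x ≠ 0 →
      θ.residual v t x = 0 →
      θ'.newResidual (fun s y => Φ.T s y (v s y)) (fun s y => Φ.X s y (v s y))
        (fun s y => Φ.U s y (v s y)) t x = 0

/-- A rule assigning to every tuple `θ` of arbitrary elements a transformation `pt θ` of the
variables `(t,x,u)` and a tuple `coeffs θ` of new arbitrary elements. Any (also nonlocal)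
dependence on `θ` is possible. -/
structure TransfRule where
  pt : Coeffs → PointTransf
  coeffs : Coeffs → Coeffs

/-- A smooth one-parameter family of equations of the class over `I`. -/
structure IsSmoothCurve (I : Set ℝ) (c : ℝ → Coeffs) : Prop where
  inClass : ∀ ε, (c ε).InClass I
  smooth_f : ContDiffOn ℝ ∞ (fun p : ℝ × ℝ => (c p.1).f p.2) (univ ×ˢ I)
  smooth_g : ContDiffOn ℝ ∞ (fun p : ℝ × ℝ => (c p.1).g p.2) (univ ×ˢ I)
  smooth_h : ContDiffOn ℝ ∞ (fun p : ℝ × ℝ => (c p.1).h p.2) (univ ×ˢ I)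
  smooth_n : ContDiff ℝ ∞ (fun ε => (c ε).n)
  smooth_m : ContDiff ℝ ∞ (fun ε => (c ε).m)

/-- Generalized extended equivalence transformations of the class over the interval `I`. -/
structure IsGeneralizedExtendedEquiv (I : Set ℝ) (τ : TransfRule) : Prop where
  /-- The variables are changed by a nondegenerate point transformation ... -/
  isPointTransf : ∀ θ : Coeffs, θ.InClass I → (τ.pt θ).IsPointTransf I
  /-- ... and the new arbitrary elements belong to the class ... -/
  inClass : ∀ θ : Coeffs, θ.InClass I → (τ.coeffs θ).InClass (τ.pt θ).imageX
  /-- ... so that each equation of the class is mapped to an equation of the class. -/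
  mapsEquation : ∀ θ : Coeffs, θ.InClass I → MapsEquation θ (τ.pt θ) (τ.coeffs θ)
  /-- The transformation of the arbitrary elements is nondegenerate. -/
  nondegenerate : ∀ θ₁ θ₂ : Coeffs, θ₁.InClass I → θ₂.InClass I →
    (τ.pt θ₁).imageX = (τ.pt θ₂).imageX →
    Coeffs.AgreeOn (τ.pt θ₁).imageX (τ.coeffs θ₁) (τ.coeffs θ₂) →
    (τ.pt θ₁).domX = (τ.pt θ₂).domX ∧ Coeffs.AgreeOn (τ.pt θ₁).domX θ₁ θ₂
  /-- The transformation of the variables depends continuously on the arbitrary elements. -/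
  continuous_pt : ∀ c : ℝ → Coeffs, IsSmoothCurve I c → ∀ t x u, (τ.pt (c 0)).Mem t x u →
    (∀ᶠ ε in 𝓝 0, (τ.pt (c ε)).Mem t x u) ∧
    Tendsto (fun ε => (τ.pt (c ε)).T t x u) (𝓝 0) (𝓝 ((τ.pt (c 0)).T t x u)) ∧
    Tendsto (fun ε => (τ.pt (c ε)).X t x u) (𝓝 0) (𝓝 ((τ.pt (c 0)).X t x u)) ∧
    Tendsto (fun ε => (τ.pt (c ε)).U t x u) (𝓝 0) (𝓝 ((τ.pt (c 0)).U t x u))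
  /-- The new arbitrary elements depend continuously on the old ones. -/
  continuous_coeffs : ∀ c : ℝ → Coeffs, IsSmoothCurve I c →
    (∀ y ∈ (τ.pt (c 0)).imageX,
      (∀ᶠ ε in 𝓝 0, y ∈ (τ.pt (c ε)).imageX) ∧
      Tendsto (fun ε => (τ.coeffs (c ε)).f y) (𝓝 0) (𝓝 ((τ.coeffs (c 0)).f y)) ∧
      Tendsto (fun ε => (τ.coeffs (c ε)).g y) (𝓝 0) (𝓝 ((τ.coeffs (c 0)).g y)) ∧
      Tendsto (fun ε => (τ.coeffs (c ε)).h y) (𝓝 0) (𝓝 ((τ.coeffs (c 0)).h y))) ∧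
    Tendsto (fun ε => (τ.coeffs (c ε)).n) (𝓝 0) (𝓝 (τ.coeffs (c 0)).n) ∧
    Tendsto (fun ε => (τ.coeffs (c ε)).m) (𝓝 0) (𝓝 (τ.coeffs (c 0)).m)

/-- Usual equivalence transformations of the class over the interval `I`. -/
structure IsUsualEquiv (I : Set ℝ) (τ : TransfRule) : Prop
    extends IsGeneralizedExtendedEquiv I τ where
  /-- The transformation of the variables does not depend on the arbitrary elements. -/
  pt_indep : ∀ θ₁ θ₂ : Coeffs, θ₁.InClass I → θ₂.InClass I →
    (τ.pt θ₁).IsRestrictionOf (τ.pt θ₂)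
  /-- The values of the new arbitrary elements are functions of the variables and of the values
  of the old arbitrary elements. -/
  pointwise : ∃ F G H N M : ℝ → ℝ → ℝ → ℝ → ℝ → ℝ → ℝ → ℝ → ℝ,
    ∀ θ : Coeffs, θ.InClass I → ∀ t x u, (τ.pt θ).Mem t x u →
      (τ.coeffs θ).f ((τ.pt θ).X t x u) = F t x u (θ.f x) (θ.g x) (θ.h x) θ.n θ.m ∧
      (τ.coeffs θ).g ((τ.pt θ).X t x u) = G t x u (θ.f x) (θ.g x) (θ.h x) θ.n θ.m ∧
      (τ.coeffs θ).h ((τ.pt θ).X t x u) = H t x u (θ.f x) (θ.g x) (θ.h x) θ.n θ.m ∧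
      (τ.coeffs θ).n = N t x u (θ.f x) (θ.g x) (θ.h x) θ.n θ.m ∧
      (τ.coeffs θ).m = M t x u (θ.f x) (θ.g x) (θ.h x) θ.n θ.m

/-- On the equation with arbitrary elements `θ`, the rule `τ` acts (on the domain of `Φ`) as the
transformation `Φ` to the equation with arbitrary elements `θ'`. -/
def TransfRule.Induces (τ : TransfRule) (θ : Coeffs) (Φ : PointTransf) (θ' : Coeffs) : Prop :=
  Φ.IsRestrictionOf (τ.pt θ) ∧ Coeffs.AgreeOn Φ.imageX (τ.coeffs θ) θ'

/-- The function `ψ = -(δ₃/n) ln |Ψ|`, where `Ψ = δ₄ P + δ₅`. -/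
noncomputable def psi (δ : Fin 6 → ℝ) (n : ℝ) (P : ℝ → ℝ) (x : ℝ) : ℝ :=
  -(δ 3 / n) * Real.log |δ 4 * P x + δ 5|

/-- The explicit formulas
`t̃ = δ₁ t + δ₂`, `x̃ = φ(x)`, `ũ = δ₃ u + ψ(x)`,
`f̃ = (δ₀ δ₁ / φ_x) |Ψ| f`, `g̃ = δ₀ φ_x Ψ² g`, `h̃ = (δ₀ δ₃ / φ_x) e^{-(m/δ₃) ψ} |Ψ| h`,
`ñ = n / δ₃`, `m̃ = m / δ₃`,
where `Ψ = δ₄ ∫ dx/g + δ₅` and `P` stands for the antiderivative `∫ dx/g`. -/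
structure HasForm (δ : Fin 6 → ℝ) (φ : ℝ → ℝ) (θ : Coeffs) (Φ : PointTransf) (θ' : Coeffs) :
    Prop where
  const_ne : δ 0 * δ 1 * δ 3 ≠ 0
  pair_ne : (δ 4, δ 5) ≠ (0, 0)
  smooth_phi : ContDiffOn ℝ ∞ φ Φ.domX
  deriv_phi_ne : ∀ x ∈ Φ.domX, deriv φ x ≠ 0
  formulas : ∃ P : ℝ → ℝ,
    (∀ x ∈ Φ.domX, HasDerivAt P (1 / θ.g x) x) ∧
    (∀ x ∈ Φ.domX, δ 4 * P x + δ 5 ≠ 0) ∧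
    (∀ t x u, Φ.Mem t x u →
      Φ.T t x u = δ 1 * t + δ 2 ∧ Φ.X t x u = φ x ∧ Φ.U t x u = δ 3 * u + psi δ θ.n P x) ∧
    (∀ x ∈ Φ.domX,
      θ'.f (φ x) = δ 0 * δ 1 / deriv φ x * |δ 4 * P x + δ 5| * θ.f x ∧
      θ'.g (φ x) = δ 0 * deriv φ x * (δ 4 * P x + δ 5) ^ 2 * θ.g x ∧
      θ'.h (φ x) = δ 0 * δ 3 / deriv φ x * Real.exp (-(θ.m / δ 3) * psi δ θ.n P x)
        * |δ 4 * P x + δ 5| * θ.h x)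
  n_eq : θ'.n = θ.n / δ 3
  m_eq : θ'.m = θ.m / δ 3

/-! The necessity part solves the determining equations of the class. The transformed equation is
tested on quadratic jets with `u_tx = 0`, whose remaining derivatives are free up to the single
relation imposed by the source equation. The coefficient of `u_tt` is proportional to `(D_x T)²`
times the Jacobian, so `T = T(t)` (`total_T_x_eq_zero`, `pd_T_eq_zero`). The coefficient of `u_xx`
gives `f̃ g e^{nu} (D_x X)² = g̃ e^{ñU} f T_t` (`second_order_relation`). Its independence of `u_x`
forces `X_u = 0`, and its dependence on `u` makes `U` affine in `u` with slope `n/ñ`. The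
coefficient of `u_x`, split with respect to `u`, gives `X_t = 0` and the constancy in `x` of `g̃
e^{2ñU}/(g X_x)`.

What is left is a linear relation between `e^{mu}`, `1`, `e^{nu}` and `e^{m̃(n/ñ)u}`. In the generic
case `m ≠ 0, n`, `h ≢ 0` it separates: `m̃ n/ñ = m`, `U_t = 0`, and the flux `g̃ e^{ñU} U_x/X_x` is
constant in `x`. The last fact says that `Ψ = e^{nu - ñU}` is an affine function of `P = ∫ dx/g`;
moreover `T` is affine in `t`.

For the remaining equations the splitting gives less, and continuity of the rule is used instead: `h
+ ε`, `m + ε` is generic for small `ε ≠ 0` and has the same `f`, `g`, `n`, hence the same `P`. The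
conclusions are stated as identities between values at three points (`AffineRelations`), without
derivatives, so they survive the pointwise limit `ε → 0`. They yield the formulas by
`hasForm_of_affineRelations`.

Conversely, the formulas do map equations to equations (`HasForm.mapsEquation`), because `g Ψ_x =
δ₄` makes the additional terms in the flux cancel. A rule on the whole class is obtained by
normalising `Ψ` at a base point `x₀`; it is injective since `g̃` determines `Ψ² g`, hence `(1/Ψ)_x`,
hence `Ψ`. A usual transformation cannot have `δ₄ ≠ 0`, as is seen by comparing the equations with
`g = 1` and `g = e^x`. -/

/-! ### Partial derivatives of smooth functions of three variables. -/

/-- Partial derivative with respect to the first of three variables. -/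
noncomputable def pd1 (F : ℝ → ℝ → ℝ → ℝ) : ℝ → ℝ → ℝ → ℝ :=
  fun t x u => deriv (fun s => F s x u) t

/-- Partial derivative with respect to the second of three variables. -/
noncomputable def pd2 (F : ℝ → ℝ → ℝ → ℝ) : ℝ → ℝ → ℝ → ℝ :=
  fun t x u => deriv (fun y => F t y u) x

/-- Partial derivative with respect to the third of three variables. -/
noncomputable def pd3 (F : ℝ → ℝ → ℝ → ℝ) : ℝ → ℝ → ℝ → ℝ :=
  fun t x u => deriv (fun w => F t x w) u

/-- Smoothness of a function of three variables on a set. -/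
def SmoothOn (F : ℝ → ℝ → ℝ → ℝ) (B : Set (ℝ × ℝ × ℝ)) : Prop :=
  ContDiffOn ℝ ∞ (fun p : ℝ × ℝ × ℝ => F p.1 p.2.1 p.2.2) B

/-- The partial derivatives are the values of the Fréchet derivative on the coordinate vectors, so
the chain rule is linearity of that derivative. -/
theorem SmoothOn.hasDerivAt_comp {F : ℝ → ℝ → ℝ → ℝ} {B : Set (ℝ × ℝ × ℝ)}
    (hF : SmoothOn F B) (hB : IsOpen B) {a b c : ℝ → ℝ} {a' b' c' s : ℝ}
    (hm : (a s, b s, c s) ∈ B) (ha : HasDerivAt a a' s) (hb : HasDerivAt b b' s)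
    (hc : HasDerivAt c c' s) :
    HasDerivAt (fun r => F (a r) (b r) (c r))
      (pd1 F (a s) (b s) (c s) * a' + pd2 F (a s) (b s) (c s) * b'
        + pd3 F (a s) (b s) (c s) * c') s := by
  have hd : HasFDerivAt (fun p : ℝ × ℝ × ℝ => F p.1 p.2.1 p.2.2)
      (fderiv ℝ (fun p : ℝ × ℝ × ℝ => F p.1 p.2.1 p.2.2) (a s, b s, c s)) (a s, b s, c s) :=
    ((hF.contDiffAt (hB.mem_nhds hm)).differentiableAt (by simp)).hasFDerivAt
  set L := fderiv ℝ (fun p : ℝ × ℝ × ℝ => F p.1 p.2.1 p.2.2) (a s, b s, c s) with hL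
  have key : ∀ {α β γ : ℝ → ℝ} {α' β' γ' r : ℝ}, α r = a s → β r = b s → γ r = c s →
      HasDerivAt α α' r → HasDerivAt β β' r → HasDerivAt γ γ' r →
      HasDerivAt (fun r => F (α r) (β r) (γ r)) (L (α', β', γ')) r := by
    intro α β γ α' β' γ' r h1 h2 h3 hα hβ hγ
    have h := hα.prodMk (hβ.prodMk hγ)
    have hd' : HasFDerivAt (fun p : ℝ × ℝ × ℝ => F p.1 p.2.1 p.2.2) L (α r, β r, γ r) := by
      rw [h1, h2, h3]; exact hd
    exact hd'.comp_hasDerivAt r h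
  have e1 : pd1 F (a s) (b s) (c s) = L (1, 0, 0) :=
    (key (α := fun r => r) (β := fun _ => b s) (γ := fun _ => c s) rfl rfl rfl
      (hasDerivAt_id' _) (hasDerivAt_const _ _) (hasDerivAt_const _ _)).deriv
  have e2 : pd2 F (a s) (b s) (c s) = L (0, 1, 0) :=
    (key (α := fun _ => a s) (β := fun r => r) (γ := fun _ => c s) rfl rfl rfl
      (hasDerivAt_const _ _) (hasDerivAt_id' _) (hasDerivAt_const _ _)).deriv
  have e3 : pd3 F (a s) (b s) (c s) = L (0, 0, 1) :=
    (key (α := fun _ => a s) (β := fun _ => b s) (γ := fun r => r) rfl rfl rfl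
      (hasDerivAt_const _ _) (hasDerivAt_const _ _) (hasDerivAt_id' _)).deriv
  have h := key rfl rfl rfl ha hb hc
  have e : ((a', b', c') : ℝ × ℝ × ℝ)
      = a' • ((1, 0, 0) : ℝ × ℝ × ℝ) + b' • ((0, 1, 0) : ℝ × ℝ × ℝ)
        + c' • ((0, 0, 1) : ℝ × ℝ × ℝ) := by
    ext <;> simp
  rw [e, map_add, map_add, map_smul, map_smul, map_smul] at h
  rw [e1, e2, e3]
  convert h using 1
  simp only [smul_eq_mul]; ring

theorem SmoothOn.smooth_pd1 {F : ℝ → ℝ → ℝ → ℝ} {B : Set (ℝ × ℝ × ℝ)}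
    (hF : SmoothOn F B) (hB : IsOpen B) : SmoothOn (pd1 F) B := by
  have h : ContDiffOn ℝ ∞
      (fun p => fderiv ℝ (fun p : ℝ × ℝ × ℝ => F p.1 p.2.1 p.2.2) p (1, 0, 0)) B :=
    (hF.fderiv_of_isOpen hB (by simp)).clm_apply contDiffOn_const
  refine h.congr fun p hp => ?_
  have hd := ((hF.contDiffAt (hB.mem_nhds hp)).differentiableAt (by simp)).hasFDerivAt
  exact (hd.comp_hasDerivAt (f := fun s => (s, p.2.1, p.2.2)) p.1
    ((hasDerivAt_id' p.1).prodMk ((hasDerivAt_const _ _).prodMk (hasDerivAt_const _ _)))).deriv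

theorem SmoothOn.smooth_pd2 {F : ℝ → ℝ → ℝ → ℝ} {B : Set (ℝ × ℝ × ℝ)}
    (hF : SmoothOn F B) (hB : IsOpen B) : SmoothOn (pd2 F) B := by
  have h : ContDiffOn ℝ ∞
      (fun p => fderiv ℝ (fun p : ℝ × ℝ × ℝ => F p.1 p.2.1 p.2.2) p (0, 1, 0)) B :=
    (hF.fderiv_of_isOpen hB (by simp)).clm_apply contDiffOn_const
  refine h.congr fun p hp => ?_
  have hd := ((hF.contDiffAt (hB.mem_nhds hp)).differentiableAt (by simp)).hasFDerivAt
  exact (hd.comp_hasDerivAt (f := fun s => (p.1, s, p.2.2)) p.2.1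
    ((hasDerivAt_const _ _).prodMk ((hasDerivAt_id' p.2.1).prodMk (hasDerivAt_const _ _)))).deriv

theorem SmoothOn.smooth_pd3 {F : ℝ → ℝ → ℝ → ℝ} {B : Set (ℝ × ℝ × ℝ)}
    (hF : SmoothOn F B) (hB : IsOpen B) : SmoothOn (pd3 F) B := by
  have h : ContDiffOn ℝ ∞
      (fun p => fderiv ℝ (fun p : ℝ × ℝ × ℝ => F p.1 p.2.1 p.2.2) p (0, 0, 1)) B :=
    (hF.fderiv_of_isOpen hB (by simp)).clm_apply contDiffOn_const
  refine h.congr fun p hp => ?_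
  have hd := ((hF.contDiffAt (hB.mem_nhds hp)).differentiableAt (by simp)).hasFDerivAt
  exact (hd.comp_hasDerivAt (f := fun s => (p.1, p.2.1, s)) p.2.2
    ((hasDerivAt_const _ _).prodMk ((hasDerivAt_const _ _).prodMk (hasDerivAt_id' p.2.2)))).deriv

/-! ### Constancy on intervals, independence of exponentials, affine interpolation. -/

/-- A function with zero derivative on an open interval is constant there. -/
theorem eq_of_hasDerivAt_zero {S : Set ℝ} (hS : IsOpen S) (hc : S.OrdConnected) {F : ℝ → ℝ}
    (hF : ∀ x ∈ S, HasDerivAt F 0 x) {x y : ℝ} (hx : x ∈ S) (hy : y ∈ S) : F x = F y :=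
  hS.is_const_of_deriv_eq_zero hc.isPreconnected
    (fun z hz => (hF z hz).differentiableAt.differentiableWithinAt)
    (fun z hz => (hF z hz).deriv) hx hy

/-- Functions with equal derivatives on an open interval differ by a constant. -/
theorem sub_eq_sub_of_hasDerivAt {S : Set ℝ} (hS : IsOpen S) (hc : S.OrdConnected)
    {F G F' : ℝ → ℝ} (hF : ∀ x ∈ S, HasDerivAt F (F' x) x) (hG : ∀ x ∈ S, HasDerivAt G (F' x) x)
    {x y : ℝ} (hx : x ∈ S) (hy : y ∈ S) : F x - G x = F y - G y :=
  eq_of_hasDerivAt_zero hS hc (F := fun z => F z - G z)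
    (fun z hz => ((hF z hz).fun_sub (hG z hz)).congr_deriv (sub_self _)) hx hy

/-- Exponentials with distinct exponents are linearly independent on an open set. -/
theorem coeff_eq_zero_of_sum_exp {S : Set ℝ} (hS : IsOpen S) (hne : S.Nonempty)
    (s : Finset ℝ) : ∀ a : ℝ → ℝ,
    (∀ u ∈ S, ∑ i ∈ s, a i * Real.exp (i * u) = 0) → ∀ i ∈ s, a i = 0 := by
  induction s using Finset.induction_on with
  | empty => simp
  | insert j s hj ih =>
    intro a h
    have h2 : ∀ i ∈ s, a i = 0 := by
      -- The operator `d/du - j` annihilates `e^{ju}` and multiplies the coefficient of every other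
      -- `e^{iu}` by `i - j ≠ 0`.
      have := ih (fun i => a i * (i - j)) (fun u hu => by
        have hd : HasDerivAt (fun u => ∑ i ∈ insert j s, a i * Real.exp (i * u))
            (∑ i ∈ insert j s, a i * (Real.exp (i * u) * (i * 1))) u :=
          HasDerivAt.fun_sum fun i _ =>
            (((hasDerivAt_id' u).const_mul i).exp).const_mul (a i)
        have h0 : ∑ i ∈ insert j s, a i * (Real.exp (i * u) * (i * 1)) = 0 := by
          rw [← hd.deriv]
          have : (fun u => ∑ i ∈ insert j s, a i * Real.exp (i * u)) =ᶠ[𝓝 u] fun _ => 0 :=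
            (hS.eventually_mem hu).mono fun w hw => h w hw
          rw [this.deriv_eq]; simp
        have h1 := h u hu
        have : ∑ i ∈ insert j s, a i * (i - j) * Real.exp (i * u)
            = ∑ i ∈ insert j s, a i * (Real.exp (i * u) * (i * 1))
              - j * ∑ i ∈ insert j s, a i * Real.exp (i * u) := by
          rw [Finset.mul_sum, ← Finset.sum_sub_distrib]
          exact Finset.sum_congr rfl fun i _ => by ring
        rw [h0, h1, Finset.sum_insert hj] at this
        simpa using this)
      intro i hi
      have := this i hi
      rcases mul_eq_zero.1 this with h | h
      · exact h
      · exact absurd (sub_eq_zero.1 h ▸ hi) hj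
    intro i hi
    rcases Finset.mem_insert.1 hi with rfl | hi
    · obtain ⟨u, hu⟩ := hne
      have := h u hu
      rw [Finset.sum_insert hj, Finset.sum_eq_zero (fun k hk => by rw [h2 k hk, zero_mul])] at this
      simpa [Real.exp_ne_zero] using this
    · exact h2 i hi

/-- Functions satisfying the three-point relation are affine functions of `P`. -/
theorem exists_affine_of_three_point {ι : Type*} {S : Set ι} {w P : ι → ℝ}
    (h : ∀ x ∈ S, ∀ y ∈ S, ∀ z ∈ S, w x * (P y - P z) + w y * (P z - P x) + w z * (P x - P y) = 0)
    {x y : ι} (hx : x ∈ S) (hy : y ∈ S) (hxy : P x ≠ P y) :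
    ∃ a b : ℝ, ∀ z ∈ S, w z = a * P z + b := by
  have hne := sub_ne_zero.2 hxy
  refine ⟨(w x - w y) / (P x - P y), w x - (w x - w y) / (P x - P y) * P x, fun z hz => ?_⟩
  have := h x hx y hy z hz
  field_simp
  linear_combination this

namespace PointTransf

/-- The domain box of a transformation. -/
def box (Φ : PointTransf) : Set (ℝ × ℝ × ℝ) := Φ.domT ×ˢ Φ.domX ×ˢ Φ.domU

theorem mem_box {Φ : PointTransf} {t x u : ℝ} : (t, x, u) ∈ Φ.box ↔ Φ.Mem t x u := Iff.rfl

theorem HasDomainIn.isOpen_box {Φ : PointTransf} {I : Set ℝ} (h : Φ.HasDomainIn I) :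
    IsOpen Φ.box :=
  h.openT.prod (h.openX.prod h.openU)

theorem det_jacobian (Φ : PointTransf) (t x u : ℝ) :
    (Φ.jacobian t x u).det =
      pd1 Φ.T t x u * pd2 Φ.X t x u * pd3 Φ.U t x u
      - pd1 Φ.T t x u * pd3 Φ.X t x u * pd2 Φ.U t x u
      - pd2 Φ.T t x u * pd1 Φ.X t x u * pd3 Φ.U t x u
      + pd2 Φ.T t x u * pd3 Φ.X t x u * pd1 Φ.U t x u
      + pd3 Φ.T t x u * pd1 Φ.X t x u * pd2 Φ.U t x u
      - pd3 Φ.T t x u * pd2 Φ.X t x u * pd1 Φ.U t x u := by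
  simp [jacobian, Matrix.det_fin_three, pd1, pd2, pd3]

end PointTransf

/-! ### Test jets. -/

/-- The quadratic polynomial with prescribed values of `u`, `u_t`, `u_x`, `u_xx`, `u_tt` at a
point, the mixed derivative being zero. -/
noncomputable def jet (t₀ x₀ u₀ q p r l : ℝ) : ℝ → ℝ → ℝ := fun s y =>
  u₀ + q * (s - t₀) + p * (y - x₀) + r / 2 * (y - x₀) ^ 2 + l / 2 * (s - t₀) ^ 2

section jet

variable {t₀ x₀ u₀ q p r l : ℝ}

theorem jet_self : jet t₀ x₀ u₀ q p r l t₀ x₀ = u₀ := by simp [jet]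

theorem contDiff_jet : ContDiff ℝ ∞ (fun z : ℝ × ℝ => jet t₀ x₀ u₀ q p r l z.1 z.2) := by
  unfold jet; fun_prop

theorem hasDerivAt_jet_left (s y : ℝ) :
    HasDerivAt (fun s => jet t₀ x₀ u₀ q p r l s y) (q + l * (s - t₀)) s := by
  unfold jet
  have h := (hasDerivAt_id' s).sub_const t₀
  refine ((((((h.const_mul q).const_add u₀).add_const (p * (y - x₀))).add_const
    (r / 2 * (y - x₀) ^ 2))).add ((h.pow 2).const_mul (l / 2))).congr_deriv ?_
  simp; ring

theorem hasDerivAt_jet_right (s y : ℝ) :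
    HasDerivAt (fun y => jet t₀ x₀ u₀ q p r l s y) (p + r * (y - x₀)) y := by
  unfold jet
  have h := (hasDerivAt_id' y).sub_const x₀
  refine ((((h.const_mul p).const_add (u₀ + q * (s - t₀))).add
    ((h.pow 2).const_mul (r / 2))).add_const (l / 2 * (s - t₀) ^ 2)).congr_deriv ?_
  simp; ring

theorem continuous_jet : Continuous (fun z : ℝ × ℝ => jet t₀ x₀ u₀ q p r l z.1 z.2) :=
  contDiff_jet.continuous

variable {F : ℝ → ℝ → ℝ → ℝ} {B : Set (ℝ × ℝ × ℝ)}

theorem SmoothOn.hasDerivAt_jet_left (hF : SmoothOn F B) (hB : IsOpen B) {s y : ℝ}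
    (hm : (s, y, jet t₀ x₀ u₀ q p r l s y) ∈ B) :
    HasDerivAt (fun s => F s y (jet t₀ x₀ u₀ q p r l s y))
      (pd1 F s y (jet t₀ x₀ u₀ q p r l s y)
        + pd3 F s y (jet t₀ x₀ u₀ q p r l s y) * (q + l * (s - t₀))) s :=
  (hF.hasDerivAt_comp hB (b := fun _ => y) hm (hasDerivAt_id' s) (hasDerivAt_const _ _)
    (_root_.hasDerivAt_jet_left s y)).congr_deriv (by simp)

theorem SmoothOn.hasDerivAt_jet_right (hF : SmoothOn F B) (hB : IsOpen B) {s y : ℝ}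
    (hm : (s, y, jet t₀ x₀ u₀ q p r l s y) ∈ B) :
    HasDerivAt (fun y => F s y (jet t₀ x₀ u₀ q p r l s y))
      (pd2 F s y (jet t₀ x₀ u₀ q p r l s y)
        + pd3 F s y (jet t₀ x₀ u₀ q p r l s y) * (p + r * (y - x₀))) y :=
  (hF.hasDerivAt_comp hB (a := fun _ => s) hm (hasDerivAt_const _ _) (hasDerivAt_id' y)
    (_root_.hasDerivAt_jet_right s y)).congr_deriv (by simp)

theorem SmoothOn.Dt_jet (hF : SmoothOn F B) (hB : IsOpen B) {s y : ℝ}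
    (hm : (s, y, jet t₀ x₀ u₀ q p r l s y) ∈ B) :
    Dt (fun s y => F s y (jet t₀ x₀ u₀ q p r l s y)) s y =
      pd1 F s y (jet t₀ x₀ u₀ q p r l s y)
        + pd3 F s y (jet t₀ x₀ u₀ q p r l s y) * (q + l * (s - t₀)) :=
  (hF.hasDerivAt_jet_left hB hm).deriv

theorem SmoothOn.Dx_jet (hF : SmoothOn F B) (hB : IsOpen B) {s y : ℝ}
    (hm : (s, y, jet t₀ x₀ u₀ q p r l s y) ∈ B) :
    Dx (fun s y => F s y (jet t₀ x₀ u₀ q p r l s y)) s y =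
      pd2 F s y (jet t₀ x₀ u₀ q p r l s y)
        + pd3 F s y (jet t₀ x₀ u₀ q p r l s y) * (p + r * (y - x₀)) :=
  (hF.hasDerivAt_jet_right hB hm).deriv

theorem eventually_jet_mem_left (hB : IsOpen B) (hm : (t₀, x₀, u₀) ∈ B) :
    ∀ᶠ s in 𝓝 t₀, (s, x₀, jet t₀ x₀ u₀ q p r l s x₀) ∈ B := by
  have hc : Continuous (fun s => (s, x₀, jet t₀ x₀ u₀ q p r l s x₀)) :=
    continuous_id.prodMk (continuous_const.prodMk
      (continuous_jet.comp (continuous_id.prodMk continuous_const)))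
  exact hc.continuousAt.eventually_mem (hB.mem_nhds (by simpa [jet_self] using hm))

theorem eventually_jet_mem_right (hB : IsOpen B) (hm : (t₀, x₀, u₀) ∈ B) :
    ∀ᶠ y in 𝓝 x₀, (t₀, y, jet t₀ x₀ u₀ q p r l t₀ y) ∈ B := by
  have hc : Continuous (fun y => (t₀, y, jet t₀ x₀ u₀ q p r l t₀ y)) :=
    continuous_const.prodMk (continuous_id.prodMk
      (continuous_jet.comp (continuous_const.prodMk continuous_id)))
  exact hc.continuousAt.eventually_mem (hB.mem_nhds (by simpa [jet_self] using hm))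

theorem residual_jet {θ : Coeffs} (hg : DifferentiableAt ℝ θ.g x₀) :
    θ.residual (jet t₀ x₀ u₀ q p r l) t₀ x₀ =
      θ.f x₀ * q - (Real.exp (θ.n * u₀) * (θ.g x₀ * (r + θ.n * p ^ 2) + deriv θ.g x₀ * p)
        + θ.h x₀ * Real.exp (θ.m * u₀)) := by
  have h1 : Dt (jet t₀ x₀ u₀ q p r l) t₀ x₀ = q :=
    (hasDerivAt_jet_left t₀ x₀).deriv.trans (by simp)
  have h2 : Dx (fun s y => θ.g y * Real.exp (θ.n * jet t₀ x₀ u₀ q p r l s y)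
      * Dx (jet t₀ x₀ u₀ q p r l) s y) t₀ x₀
      = Real.exp (θ.n * u₀) * (θ.g x₀ * (r + θ.n * p ^ 2) + deriv θ.g x₀ * p) := by
    have e : (fun y => θ.g y * Real.exp (θ.n * jet t₀ x₀ u₀ q p r l t₀ y)
        * Dx (jet t₀ x₀ u₀ q p r l) t₀ y) = fun y =>
        θ.g y * Real.exp (θ.n * jet t₀ x₀ u₀ q p r l t₀ y) * (p + r * (y - x₀)) := by
      ext y; rw [show Dx (jet t₀ x₀ u₀ q p r l) t₀ y = _ from (hasDerivAt_jet_right t₀ y).deriv]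
    have h3 : HasDerivAt (fun y : ℝ => p + r * (y - x₀)) r x₀ :=
      ((((hasDerivAt_id' x₀).sub_const x₀).const_mul r).const_add p).congr_deriv (by simp)
    have h4 := ((hg.hasDerivAt.mul
      (((hasDerivAt_jet_right (t₀ := t₀) (x₀ := x₀) (u₀ := u₀) (q := q) (p := p) (r := r) (l := l)
        t₀ x₀).const_mul θ.n).exp)).mul h3).deriv
    have h5 : Dx (fun s y => θ.g y * Real.exp (θ.n * jet t₀ x₀ u₀ q p r l s y)
      * Dx (jet t₀ x₀ u₀ q p r l) s y) t₀ x₀ = deriv (fun y =>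
        θ.g y * Real.exp (θ.n * jet t₀ x₀ u₀ q p r l t₀ y) * (p + r * (y - x₀))) x₀ := by
      rw [← e]; rfl
    rw [h5]
    refine h4.trans ?_
    simp only [Pi.mul_apply, jet_self]
    ring
  rw [Coeffs.residual, h1, h2, jet_self]

end jet

/-! ### The transformed equation on test jets. -/

section determining

variable {I : Set ℝ} {θ θ' : Coeffs} {Φ : PointTransf}

theorem smoothOn_comp_imageX (hΦ : Φ.IsPointTransf I) {k : ℝ → ℝ}
    (hk : ContDiffOn ℝ ∞ k Φ.imageX) : SmoothOn (fun t x u => k (Φ.X t x u)) Φ.box :=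
  hk.comp hΦ.smooth_X fun p hp => ⟨p.1, p.2.1, p.2.2, hp, rfl⟩

/-- The coefficient `g̃ e^{ñ ũ}` in the old variables. -/
noncomputable def newCoeff (θ' : Coeffs) (Φ : PointTransf) : ℝ → ℝ → ℝ → ℝ := fun t x u =>
  θ'.g (Φ.X t x u) * Real.exp (θ'.n * Φ.U t x u)

theorem smoothOn_newCoeff (hΦ : Φ.IsPointTransf I) (h' : θ'.InClass Φ.imageX) :
    SmoothOn (newCoeff θ' Φ) Φ.box :=
  (smoothOn_comp_imageX hΦ h'.smooth_g).mul (contDiffOn_const.mul hΦ.smooth_U).exp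

theorem newCoeff_ne_zero (h' : θ'.InClass Φ.imageX) {t x u : ℝ} (hm : Φ.Mem t x u) :
    newCoeff θ' Φ t x u ≠ 0 :=
  mul_ne_zero (h'.g_ne _ ⟨t, x, u, hm, rfl⟩) (Real.exp_ne_zero _)

/-- The flux `g̃ e^{ñ ũ} ũ_x̃` in terms of the old jet variables, `a = u_t` and `b = u_x`. -/
noncomputable def newFlux (θ' : Coeffs) (Φ : PointTransf) (t x u a b : ℝ) : ℝ :=
  newCoeff θ' Φ t x u *
    (((pd1 Φ.T t x u + pd3 Φ.T t x u * a) * (pd2 Φ.U t x u + pd3 Φ.U t x u * b)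
      - (pd2 Φ.T t x u + pd3 Φ.T t x u * b) * (pd1 Φ.U t x u + pd3 Φ.U t x u * a))
    / ((pd1 Φ.T t x u + pd3 Φ.T t x u * a) * (pd2 Φ.X t x u + pd3 Φ.X t x u * b)
      - (pd2 Φ.T t x u + pd3 Φ.T t x u * b) * (pd1 Φ.X t x u + pd3 Φ.X t x u * a)))

variable {t₀ x₀ u₀ q p r l : ℝ}

theorem newFlux_jet (hΦ : Φ.IsPointTransf I) {s y : ℝ}
    (hm : (s, y, jet t₀ x₀ u₀ q p r l s y) ∈ Φ.box) :
    θ'.g (Φ.X s y (jet t₀ x₀ u₀ q p r l s y))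
      * Real.exp (θ'.n * Φ.U s y (jet t₀ x₀ u₀ q p r l s y))
      * newDx (fun s y => Φ.T s y (jet t₀ x₀ u₀ q p r l s y))
          (fun s y => Φ.X s y (jet t₀ x₀ u₀ q p r l s y))
          (fun s y => Φ.U s y (jet t₀ x₀ u₀ q p r l s y)) s y
    = newFlux θ' Φ s y (jet t₀ x₀ u₀ q p r l s y) (q + l * (s - t₀)) (p + r * (y - x₀)) := by
  have hB := hΦ.domain.isOpen_box
  rw [newDx, jacTX, SmoothOn.Dt_jet hΦ.smooth_T hB hm, SmoothOn.Dx_jet hΦ.smooth_T hB hm,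
    SmoothOn.Dt_jet hΦ.smooth_X hB hm, SmoothOn.Dx_jet hΦ.smooth_X hB hm,
    SmoothOn.Dt_jet hΦ.smooth_U hB hm, SmoothOn.Dx_jet hΦ.smooth_U hB hm]
  rfl

theorem jacTX_jet (hΦ : Φ.IsPointTransf I) (hm : Φ.Mem t₀ x₀ u₀) :
    jacTX (fun s y => Φ.T s y (jet t₀ x₀ u₀ q p r l s y))
      (fun s y => Φ.X s y (jet t₀ x₀ u₀ q p r l s y)) t₀ x₀ =
    (pd1 Φ.T t₀ x₀ u₀ + pd3 Φ.T t₀ x₀ u₀ * q) * (pd2 Φ.X t₀ x₀ u₀ + pd3 Φ.X t₀ x₀ u₀ * p)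
      - (pd2 Φ.T t₀ x₀ u₀ + pd3 Φ.T t₀ x₀ u₀ * p) * (pd1 Φ.X t₀ x₀ u₀ + pd3 Φ.X t₀ x₀ u₀ * q) := by
  have hB := hΦ.domain.isOpen_box
  have hm' : (t₀, x₀, jet t₀ x₀ u₀ q p r l t₀ x₀) ∈ Φ.box := by rw [jet_self]; exact hm
  rw [jacTX, SmoothOn.Dt_jet hΦ.smooth_T hB hm', SmoothOn.Dx_jet hΦ.smooth_T hB hm',
    SmoothOn.Dt_jet hΦ.smooth_X hB hm', SmoothOn.Dx_jet hΦ.smooth_X hB hm', jet_self]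
  simp only [sub_self, mul_zero, add_zero]

/-- The transformed equation on the jets `u_t = q`, `u_x = p`, `u_xx = r`, `u_tt = l`,
`u_tx = 0`. -/
theorem newResidual_jet (hΦ : Φ.IsPointTransf I) (hm : Φ.Mem t₀ x₀ u₀) {T1 T2 X1 X2 U1 U2 J : ℝ}
    (hT1 : T1 = pd1 Φ.T t₀ x₀ u₀ + pd3 Φ.T t₀ x₀ u₀ * q)
    (hT2 : T2 = pd2 Φ.T t₀ x₀ u₀ + pd3 Φ.T t₀ x₀ u₀ * p)
    (hX1 : X1 = pd1 Φ.X t₀ x₀ u₀ + pd3 Φ.X t₀ x₀ u₀ * q)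
    (hX2 : X2 = pd2 Φ.X t₀ x₀ u₀ + pd3 Φ.X t₀ x₀ u₀ * p)
    (hU1 : U1 = pd1 Φ.U t₀ x₀ u₀ + pd3 Φ.U t₀ x₀ u₀ * q)
    (hU2 : U2 = pd2 Φ.U t₀ x₀ u₀ + pd3 Φ.U t₀ x₀ u₀ * p)
    (hJ : J = T1 * X2 - T2 * X1) :
    θ'.newResidual (fun s y => Φ.T s y (jet t₀ x₀ u₀ q p r l s y))
      (fun s y => Φ.X s y (jet t₀ x₀ u₀ q p r l s y))
      (fun s y => Φ.U s y (jet t₀ x₀ u₀ q p r l s y)) t₀ x₀ =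
    θ'.f (Φ.X t₀ x₀ u₀) * ((U1 * X2 - U2 * X1) / J)
      - ((T1 * deriv (fun y => newFlux θ' Φ t₀ y (u₀ + p * (y - x₀) + r / 2 * (y - x₀) ^ 2)
            q (p + r * (y - x₀))) x₀
          - T2 * deriv (fun s => newFlux θ' Φ s x₀ (u₀ + q * (s - t₀) + l / 2 * (s - t₀) ^ 2)
            (q + l * (s - t₀)) p) t₀) / J
        + θ'.h (Φ.X t₀ x₀ u₀) * Real.exp (θ'.m * Φ.U t₀ x₀ u₀)) := by
  have hB := hΦ.domain.isOpen_box
  have hm' : (t₀, x₀, jet t₀ x₀ u₀ q p r l t₀ x₀) ∈ Φ.box := by rw [jet_self]; exact hm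
  have eJ := jacTX_jet (q := q) (p := p) (r := r) (l := l) hΦ hm
  rw [← hT1, ← hT2, ← hX1, ← hX2, ← hJ] at eJ
  have eT1 := SmoothOn.Dt_jet hΦ.smooth_T hB hm'
  have eT2 := SmoothOn.Dx_jet hΦ.smooth_T hB hm'
  have eX1 := SmoothOn.Dt_jet hΦ.smooth_X hB hm'
  have eX2 := SmoothOn.Dx_jet hΦ.smooth_X hB hm'
  have eU1 := SmoothOn.Dt_jet hΦ.smooth_U hB hm'
  have eU2 := SmoothOn.Dx_jet hΦ.smooth_U hB hm'
  simp only [jet_self, sub_self, mul_zero, add_zero] at eT1 eT2 eX1 eX2 eU1 eU2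
  rw [← hT1] at eT1; rw [← hT2] at eT2; rw [← hX1] at eX1
  rw [← hX2] at eX2; rw [← hU1] at eU1; rw [← hU2] at eU2
  set That := fun s y => Φ.T s y (jet t₀ x₀ u₀ q p r l s y) with hThat
  set Xhat := fun s y => Φ.X s y (jet t₀ x₀ u₀ q p r l s y) with hXhat
  set Uhat := fun s y => Φ.U s y (jet t₀ x₀ u₀ q p r l s y) with hUhat
  have e1 : Dx (fun s y => θ'.g (Xhat s y) * Real.exp (θ'.n * Uhat s y)
      * newDx That Xhat Uhat s y) t₀ x₀ =
      deriv (fun y => newFlux θ' Φ t₀ y (u₀ + p * (y - x₀) + r / 2 * (y - x₀) ^ 2)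
            q (p + r * (y - x₀))) x₀ := by
    refine Filter.EventuallyEq.deriv_eq ?_
    filter_upwards [eventually_jet_mem_right (q := q) (p := p) (r := r) (l := l) hB hm] with y hy
    refine (newFlux_jet hΦ hy).trans ?_
    simp [jet]
  have e2 : Dt (fun s y => θ'.g (Xhat s y) * Real.exp (θ'.n * Uhat s y)
      * newDx That Xhat Uhat s y) t₀ x₀ =
      deriv (fun s => newFlux θ' Φ s x₀ (u₀ + q * (s - t₀) + l / 2 * (s - t₀) ^ 2)
            (q + l * (s - t₀)) p) t₀ := by
    refine Filter.EventuallyEq.deriv_eq ?_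
    filter_upwards [eventually_jet_mem_left (q := q) (p := p) (r := r) (l := l) hB hm] with s hs
    refine (newFlux_jet hΦ hs).trans ?_
    simp [jet]
  rw [Coeffs.newResidual, newDt, newDx, e1, e2, eJ, eT1, eT2, eX1, eX2, eU1, eU2]
  simp only [hXhat, hUhat, jet_self]

theorem newResidual_jet_eq_zero (hθ : θ.InClass I) (hI : IsOpen I) (hΦ : Φ.IsPointTransf I)
    (hmap : MapsEquation θ Φ θ') (hm : Φ.Mem t₀ x₀ u₀)
    (hJ : (pd1 Φ.T t₀ x₀ u₀ + pd3 Φ.T t₀ x₀ u₀ * q) * (pd2 Φ.X t₀ x₀ u₀ + pd3 Φ.X t₀ x₀ u₀ * p)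
      - (pd2 Φ.T t₀ x₀ u₀ + pd3 Φ.T t₀ x₀ u₀ * p)
        * (pd1 Φ.X t₀ x₀ u₀ + pd3 Φ.X t₀ x₀ u₀ * q) ≠ 0)
    (hr : θ.f x₀ * q = Real.exp (θ.n * u₀) * (θ.g x₀ * (r + θ.n * p ^ 2) + deriv θ.g x₀ * p)
        + θ.h x₀ * Real.exp (θ.m * u₀)) :
    θ'.newResidual (fun s y => Φ.T s y (jet t₀ x₀ u₀ q p r l s y))
      (fun s y => Φ.X s y (jet t₀ x₀ u₀ q p r l s y))
      (fun s y => Φ.U s y (jet t₀ x₀ u₀ q p r l s y)) t₀ x₀ = 0 := by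
  have hx : x₀ ∈ I := hΦ.domain.subset hm.2.1
  refine hmap _ contDiff_jet t₀ x₀ (by rwa [jet_self]) (by rwa [jacTX_jet hΦ hm]) ?_
  rw [residual_jet ((hθ.smooth_g.contDiffAt (hI.mem_nhds hx)).differentiableAt (by simp)), hr,
    sub_self]

/-- Derivative of a total `t`-derivative along the jet. -/
theorem SmoothOn.hasDerivAt_total_left {F : ℝ → ℝ → ℝ → ℝ} {B : Set (ℝ × ℝ × ℝ)}
    (hF : SmoothOn F B) (hB : IsOpen B) (hm : (t₀, x₀, u₀) ∈ B) (q l : ℝ) :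
    HasDerivAt (fun s => pd1 F s x₀ (u₀ + q * (s - t₀) + l / 2 * (s - t₀) ^ 2)
        + pd3 F s x₀ (u₀ + q * (s - t₀) + l / 2 * (s - t₀) ^ 2) * (q + l * (s - t₀)))
      (pd1 (pd1 F) t₀ x₀ u₀ + pd3 (pd1 F) t₀ x₀ u₀ * q
        + (pd1 (pd3 F) t₀ x₀ u₀ + pd3 (pd3 F) t₀ x₀ u₀ * q) * q
        + pd3 F t₀ x₀ u₀ * l) t₀ := by
  have hm' : (t₀, x₀, jet t₀ x₀ u₀ q 0 0 l t₀ x₀) ∈ B := by rwa [jet_self]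
  have h1 := (hF.smooth_pd1 hB).hasDerivAt_jet_left hB hm'
  have h3 := (hF.smooth_pd3 hB).hasDerivAt_jet_left hB hm'
  have h : HasDerivAt (fun s : ℝ => q + l * (s - t₀)) l t₀ :=
    ((((hasDerivAt_id' t₀).sub_const t₀).const_mul l).const_add q).congr_deriv (by simp)
  have := h1.add (h3.mul h)
  simp only [jet_self] at this
  simp only [jet, sub_self, mul_zero, add_zero, zero_div, zero_mul] at this
  refine this.congr_deriv ?_
  ring

end determining

/-! ### Terms with `u_tt`: the new time depends on `t` only. -/

section determining

variable {I : Set ℝ} {θ θ' : Coeffs} {Φ : PointTransf} {t₀ x₀ u₀ : ℝ}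

/-- The total derivative of the new `t` with respect to `x` vanishes at every nondegenerate jet. -/
theorem total_T_x_eq_zero (hθ : θ.InClass I) (hI : IsOpen I) (hΦ : Φ.IsPointTransf I)
    (h' : θ'.InClass Φ.imageX) (hmap : MapsEquation θ Φ θ') (hm : Φ.Mem t₀ x₀ u₀) (q p : ℝ)
    (hJ : (pd1 Φ.T t₀ x₀ u₀ + pd3 Φ.T t₀ x₀ u₀ * q) * (pd2 Φ.X t₀ x₀ u₀ + pd3 Φ.X t₀ x₀ u₀ * p)
      - (pd2 Φ.T t₀ x₀ u₀ + pd3 Φ.T t₀ x₀ u₀ * p)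
        * (pd1 Φ.X t₀ x₀ u₀ + pd3 Φ.X t₀ x₀ u₀ * q) ≠ 0) :
    pd2 Φ.T t₀ x₀ u₀ + pd3 Φ.T t₀ x₀ u₀ * p = 0 := by
  have hB := hΦ.domain.isOpen_box
  have hx : x₀ ∈ I := hΦ.domain.subset hm.2.1
  have hg := hθ.g_ne x₀ hx
  -- Since `g ≠ 0`, the equation can be solved for `u_xx`; thus `u_t`, `u_x` and `u_tt` remain free.
  obtain ⟨r, hr⟩ : ∃ r, θ.f x₀ * q = Real.exp (θ.n * u₀) * (θ.g x₀ * (r + θ.n * p ^ 2)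
      + deriv θ.g x₀ * p) + θ.h x₀ * Real.exp (θ.m * u₀) := by
    refine ⟨((θ.f x₀ * q - θ.h x₀ * Real.exp (θ.m * u₀)) / Real.exp (θ.n * u₀)
      - deriv θ.g x₀ * p) / θ.g x₀ - θ.n * p ^ 2, ?_⟩
    have := Real.exp_ne_zero (θ.n * u₀)
    field_simp
    ring
  have hΓ := newCoeff_ne_zero h' hm
  have hM := hΦ.nondegenerate t₀ x₀ u₀ hm
  rw [Φ.det_jacobian] at hM
  have hbox : (t₀, x₀, u₀) ∈ Φ.box := hm
  have hD : ∀ l : ℝ, _ := fun l => by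
    have hT := SmoothOn.hasDerivAt_total_left hΦ.smooth_T hB hbox q l
    have hX := SmoothOn.hasDerivAt_total_left hΦ.smooth_X hB hbox q l
    have hU := SmoothOn.hasDerivAt_total_left hΦ.smooth_U hB hbox q l
    have hm' : (t₀, x₀, jet t₀ x₀ u₀ q 0 0 l t₀ x₀) ∈ Φ.box := by rwa [jet_self]
    have hd : ∀ {F : ℝ → ℝ → ℝ → ℝ}, SmoothOn F Φ.box →
        HasDerivAt (fun s => F s x₀ (u₀ + q * (s - t₀) + l / 2 * (s - t₀) ^ 2))
          (pd1 F t₀ x₀ u₀ + pd3 F t₀ x₀ u₀ * q) t₀ := by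
      intro F hF
      have h := hF.hasDerivAt_jet_left hB hm'
      simp only [jet_self] at h
      simpa [jet] using h
    have hG := hd (smoothOn_newCoeff hΦ h')
    have hT2 := (hd (SmoothOn.smooth_pd2 hΦ.smooth_T hB)).add
      ((hd (SmoothOn.smooth_pd3 hΦ.smooth_T hB)).mul_const p)
    have hX2 := (hd (SmoothOn.smooth_pd2 hΦ.smooth_X hB)).add
      ((hd (SmoothOn.smooth_pd3 hΦ.smooth_X hB)).mul_const p)
    have hU2 := (hd (SmoothOn.smooth_pd2 hΦ.smooth_U hB)).add
      ((hd (SmoothOn.smooth_pd3 hΦ.smooth_U hB)).mul_const p)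
    have hN := (hT.mul hU2).sub (hT2.mul hU)
    have hDen := (hT.mul hX2).sub (hT2.mul hX)
    have hQ := hG.mul (hN.div hDen (by simpa using hJ))
    have h1 := newResidual_jet (θ' := θ') (q := q) (p := p) (r := r) (l := l) hΦ hm rfl rfl rfl rfl
      rfl rfl rfl
    rw [newResidual_jet_eq_zero hθ hI hΦ hmap hm hJ hr] at h1
    have h2 : deriv (fun s => newFlux θ' Φ s x₀ (u₀ + q * (s - t₀) + l / 2 * (s - t₀) ^ 2)
            (q + l * (s - t₀)) p) t₀ = _ := hQ.deriv
    rw [h2] at h1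
    simp only [Pi.mul_apply, Pi.sub_apply, Pi.add_apply, Pi.div_apply, sub_self, mul_zero, add_zero,
      ne_eq, OfNat.ofNat_ne_zero, not_false_eq_true, zero_pow] at h1
    exact h1
  -- The jets with `u_tt = 0` and `u_tt = 1` differ in nothing else, so subtraction isolates the
  -- coefficient of `u_tt`.
  have h0 := hD 0
  have h1 := hD 1
  generalize newCoeff θ' Φ t₀ x₀ u₀ = Γ at *
  generalize pd1 Φ.T t₀ x₀ u₀ = Tt at *
  generalize pd2 Φ.T t₀ x₀ u₀ = Tx at *
  generalize pd3 Φ.T t₀ x₀ u₀ = Tu at *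
  generalize pd1 Φ.X t₀ x₀ u₀ = Xt at *
  generalize pd2 Φ.X t₀ x₀ u₀ = Xx at *
  generalize pd3 Φ.X t₀ x₀ u₀ = Xu at *
  generalize pd1 Φ.U t₀ x₀ u₀ = Ut at *
  generalize pd2 Φ.U t₀ x₀ u₀ = Ux at *
  generalize pd3 Φ.U t₀ x₀ u₀ = Uu at *
  by_contra hne
  have hfin : (Tx + Tu * p) ^ 2 * Γ * (Tt * Xx * Uu - Tt * Xu * Ux - Tx * Xt * Uu + Tx * Xu * Ut
      + Tu * Xt * Ux - Tu * Xx * Ut) = 0 := by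
    generalize hJJ : (Tt + Tu * q) * (Xx + Xu * p) - (Tx + Tu * p) * (Xt + Xu * q) = J at *
    have h3 : (Tx + Tu * p) * (Γ * (((Tu * (Ux + Uu * p) - (Tx + Tu * p) * Uu) * J
        - ((Tt + Tu * q) * (Ux + Uu * p) - (Tx + Tu * p) * (Ut + Uu * q))
          * (Tu * (Xx + Xu * p) - (Tx + Tu * p) * Xu)) / J ^ 2)) / J = 0 := by
      linear_combination h0 - h1
    have h4 : (Tx + Tu * p) * (Γ * ((Tu * (Ux + Uu * p) - (Tx + Tu * p) * Uu) * J
        - ((Tt + Tu * q) * (Ux + Uu * p) - (Tx + Tu * p) * (Ut + Uu * q))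
          * (Tu * (Xx + Xu * p) - (Tx + Tu * p) * Xu))) = 0 := by
      field_simp at h3
      linear_combination h3
    rw [← hJJ] at h4
    linear_combination -h4
  simp [hne, hΓ, hM] at hfin

/-- The new time depends neither on `x` nor on `u`, infinitesimally. -/
theorem pd_T_eq_zero (hθ : θ.InClass I) (hI : IsOpen I) (hΦ : Φ.IsPointTransf I)
    (h' : θ'.InClass Φ.imageX) (hmap : MapsEquation θ Φ θ') (hm : Φ.Mem t₀ x₀ u₀) :
    pd2 Φ.T t₀ x₀ u₀ = 0 ∧ pd3 Φ.T t₀ x₀ u₀ = 0 := by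
  have hM := hΦ.nondegenerate t₀ x₀ u₀ hm
  rw [Φ.det_jacobian] at hM
  -- Multiplying by the determinant `J` of the change of independent variables includes the
  -- degenerate jets, so this is a polynomial identity in `q` and `p` without exceptions.
  have key : ∀ q p : ℝ, (pd2 Φ.T t₀ x₀ u₀ + pd3 Φ.T t₀ x₀ u₀ * p) *
      ((pd1 Φ.T t₀ x₀ u₀ + pd3 Φ.T t₀ x₀ u₀ * q) * (pd2 Φ.X t₀ x₀ u₀ + pd3 Φ.X t₀ x₀ u₀ * p)
      - (pd2 Φ.T t₀ x₀ u₀ + pd3 Φ.T t₀ x₀ u₀ * p)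
        * (pd1 Φ.X t₀ x₀ u₀ + pd3 Φ.X t₀ x₀ u₀ * q)) = 0 := by
    intro q p
    by_cases hJ : (pd1 Φ.T t₀ x₀ u₀ + pd3 Φ.T t₀ x₀ u₀ * q)
        * (pd2 Φ.X t₀ x₀ u₀ + pd3 Φ.X t₀ x₀ u₀ * p)
      - (pd2 Φ.T t₀ x₀ u₀ + pd3 Φ.T t₀ x₀ u₀ * p)
        * (pd1 Φ.X t₀ x₀ u₀ + pd3 Φ.X t₀ x₀ u₀ * q) = 0
    · rw [hJ, mul_zero]
    · rw [total_T_x_eq_zero hθ hI hΦ h' hmap hm q p hJ, zero_mul]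
  generalize pd1 Φ.T t₀ x₀ u₀ = Tt at *
  generalize pd2 Φ.T t₀ x₀ u₀ = Tx at *
  generalize pd3 Φ.T t₀ x₀ u₀ = Tu at *
  generalize pd1 Φ.X t₀ x₀ u₀ = Xt at *
  generalize pd2 Φ.X t₀ x₀ u₀ = Xx at *
  generalize pd3 Φ.X t₀ x₀ u₀ = Xu at *
  -- The terms with `qp` in `J` cancel, so five values suffice to read off the coefficients of `1`,
  -- `q`, `p`, `qp`, `p²` of the product.
  have k00 := key 0 0
  have k01 := key 0 1
  have k02 := key 0 (-1)
  have k10 := key 1 0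
  have k11 := key 1 1
  have hb : Tx * (Tu * Xx - Tx * Xu) = 0 := by linear_combination k10 - k00
  have hb' : Tu * (Tu * Xx - Tx * Xu) = 0 := by linear_combination k11 - k01 - hb
  have ha : Tx * (Tt * Xx - Tx * Xt) = 0 := by linear_combination k00
  have hc : Tx * (Tt * Xu - Tu * Xt) + Tu * (Tt * Xx - Tx * Xt) = 0 := by
    linear_combination (k01 - k02) / 2
  have hc' : Tu * (Tt * Xu - Tu * Xt) = 0 := by linear_combination (k01 + k02) / 2 - k00
  -- Otherwise all `2 × 2` minors of the rows of `T` and `X` vanish, and expansion along the row of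
  -- `U` makes the Jacobian zero.
  have hx : Tx = 0 := by
    by_contra h
    have e1 := (mul_eq_zero.1 ha).resolve_left h
    have e2 := (mul_eq_zero.1 hb).resolve_left h
    rw [e1, mul_zero, add_zero] at hc
    have e3 := (mul_eq_zero.1 hc).resolve_left h
    apply hM
    linear_combination pd3 Φ.U t₀ x₀ u₀ * e1 - pd1 Φ.U t₀ x₀ u₀ * e2 - pd2 Φ.U t₀ x₀ u₀ * e3
  refine ⟨hx, ?_⟩
  by_contra h
  have e2 := (mul_eq_zero.1 hb').resolve_left h
  have e3 := (mul_eq_zero.1 hc').resolve_left h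
  rw [hx, zero_mul, zero_add] at hc
  have e1 := (mul_eq_zero.1 hc).resolve_left h
  apply hM
  rw [hx] at *
  linear_combination pd3 Φ.U t₀ x₀ u₀ * e1 - pd1 Φ.U t₀ x₀ u₀ * e2 - pd2 Φ.U t₀ x₀ u₀ * e3

end determining

/-! ### Terms with `u_xx`: the new `x` does not depend on `u`. -/

section determining

variable {I : Set ℝ} {θ θ' : Coeffs} {Φ : PointTransf} {t₀ x₀ u₀ : ℝ}

/-- Derivative of a total `x`-derivative along the jet. -/
theorem SmoothOn.hasDerivAt_total_right {F : ℝ → ℝ → ℝ → ℝ} {B : Set (ℝ × ℝ × ℝ)}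
    (hF : SmoothOn F B) (hB : IsOpen B) (hm : (t₀, x₀, u₀) ∈ B) (p r : ℝ) :
    HasDerivAt (fun y => pd2 F t₀ y (u₀ + p * (y - x₀) + r / 2 * (y - x₀) ^ 2)
        + pd3 F t₀ y (u₀ + p * (y - x₀) + r / 2 * (y - x₀) ^ 2) * (p + r * (y - x₀)))
      (pd2 (pd2 F) t₀ x₀ u₀ + pd3 (pd2 F) t₀ x₀ u₀ * p
        + (pd2 (pd3 F) t₀ x₀ u₀ + pd3 (pd3 F) t₀ x₀ u₀ * p) * p
        + pd3 F t₀ x₀ u₀ * r) x₀ := by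
  have hm' : (t₀, x₀, jet t₀ x₀ u₀ 0 p r 0 t₀ x₀) ∈ B := by rwa [jet_self]
  have h1 := (hF.smooth_pd2 hB).hasDerivAt_jet_right hB hm'
  have h3 := (hF.smooth_pd3 hB).hasDerivAt_jet_right hB hm'
  have h : HasDerivAt (fun y : ℝ => p + r * (y - x₀)) r x₀ :=
    ((((hasDerivAt_id' x₀).sub_const x₀).const_mul r).const_add p).congr_deriv (by simp)
  have := h1.add (h3.mul h)
  simp only [jet_self] at this
  simp only [jet, sub_self, mul_zero, add_zero, zero_div, zero_mul] at this
  refine this.congr_deriv ?_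
  ring

/-- With `T_x = T_u = 0` the Jacobian factors as `T_t (U_u X_x - U_x X_u)`. -/
theorem pd1_T_ne_zero (hθ : θ.InClass I) (hI : IsOpen I) (hΦ : Φ.IsPointTransf I)
    (h' : θ'.InClass Φ.imageX) (hmap : MapsEquation θ Φ θ') (hm : Φ.Mem t₀ x₀ u₀) :
    pd1 Φ.T t₀ x₀ u₀ ≠ 0 ∧
    pd3 Φ.U t₀ x₀ u₀ * pd2 Φ.X t₀ x₀ u₀ - pd2 Φ.U t₀ x₀ u₀ * pd3 Φ.X t₀ x₀ u₀ ≠ 0 := by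
  obtain ⟨h2, h3⟩ := pd_T_eq_zero hθ hI hΦ h' hmap hm
  have hM := hΦ.nondegenerate t₀ x₀ u₀ hm
  rw [Φ.det_jacobian, h2, h3] at hM
  constructor <;> intro h <;> apply hM
  · rw [h]; ring
  · linear_combination pd1 Φ.T t₀ x₀ u₀ * h

/-- The transformed equation on jets of solutions, once the new time is known to depend on `t`
only. -/
theorem reduced_equation (hθ : θ.InClass I) (hI : IsOpen I) (hΦ : Φ.IsPointTransf I)
    (h' : θ'.InClass Φ.imageX) (hmap : MapsEquation θ Φ θ') (hm : Φ.Mem t₀ x₀ u₀) {q p r : ℝ}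
    (hX : pd2 Φ.X t₀ x₀ u₀ + pd3 Φ.X t₀ x₀ u₀ * p ≠ 0)
    (hr : θ.f x₀ * q = Real.exp (θ.n * u₀) * (θ.g x₀ * (r + θ.n * p ^ 2) + deriv θ.g x₀ * p)
        + θ.h x₀ * Real.exp (θ.m * u₀)) :
    θ'.f (Φ.X t₀ x₀ u₀) *
      ((pd1 Φ.U t₀ x₀ u₀ + pd3 Φ.U t₀ x₀ u₀ * q) * (pd2 Φ.X t₀ x₀ u₀ + pd3 Φ.X t₀ x₀ u₀ * p)
        - (pd2 Φ.U t₀ x₀ u₀ + pd3 Φ.U t₀ x₀ u₀ * p) * (pd1 Φ.X t₀ x₀ u₀ + pd3 Φ.X t₀ x₀ u₀ * q))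
      / pd1 Φ.T t₀ x₀ u₀
      = deriv (fun y => newCoeff θ' Φ t₀ y (u₀ + p * (y - x₀) + r / 2 * (y - x₀) ^ 2) *
          ((pd2 Φ.U t₀ y (u₀ + p * (y - x₀) + r / 2 * (y - x₀) ^ 2)
            + pd3 Φ.U t₀ y (u₀ + p * (y - x₀) + r / 2 * (y - x₀) ^ 2) * (p + r * (y - x₀)))
          / (pd2 Φ.X t₀ y (u₀ + p * (y - x₀) + r / 2 * (y - x₀) ^ 2)
            + pd3 Φ.X t₀ y (u₀ + p * (y - x₀) + r / 2 * (y - x₀) ^ 2) * (p + r * (y - x₀))))) x₀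
        + θ'.h (Φ.X t₀ x₀ u₀) * Real.exp (θ'.m * Φ.U t₀ x₀ u₀)
          * (pd2 Φ.X t₀ x₀ u₀ + pd3 Φ.X t₀ x₀ u₀ * p) := by
  have hB := hΦ.domain.isOpen_box
  obtain ⟨hTx, hTu⟩ := pd_T_eq_zero hθ hI hΦ h' hmap hm
  obtain ⟨hTt, -⟩ := pd1_T_ne_zero hθ hI hΦ h' hmap hm
  have h1 := newResidual_jet (θ' := θ') (q := q) (p := p) (r := r) (l := 0) hΦ hm rfl rfl rfl rfl
    rfl rfl rfl
  rw [newResidual_jet_eq_zero hθ hI hΦ hmap hm _ hr, hTx, hTu] at h1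
  · have e : (fun y => newFlux θ' Φ t₀ y (u₀ + p * (y - x₀) + r / 2 * (y - x₀) ^ 2) q
        (p + r * (y - x₀))) =ᶠ[𝓝 x₀] fun y =>
        newCoeff θ' Φ t₀ y (u₀ + p * (y - x₀) + r / 2 * (y - x₀) ^ 2) *
          ((pd2 Φ.U t₀ y (u₀ + p * (y - x₀) + r / 2 * (y - x₀) ^ 2)
            + pd3 Φ.U t₀ y (u₀ + p * (y - x₀) + r / 2 * (y - x₀) ^ 2) * (p + r * (y - x₀)))
          / (pd2 Φ.X t₀ y (u₀ + p * (y - x₀) + r / 2 * (y - x₀) ^ 2)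
            + pd3 Φ.X t₀ y (u₀ + p * (y - x₀) + r / 2 * (y - x₀) ^ 2) * (p + r * (y - x₀)))) := by
      -- The flux is about to be differentiated in `x`, so `T_t` has to be cancelled on a whole
      -- neighbourhood of `x₀`.
      filter_upwards [eventually_jet_mem_right (q := 0) (p := p) (r := r) (l := 0) hB hm] with y hy
      have hy' : Φ.Mem t₀ y (u₀ + p * (y - x₀) + r / 2 * (y - x₀) ^ 2) := by
        simpa [jet, PointTransf.mem_box] using hy
      obtain ⟨hTx, hTu⟩ := pd_T_eq_zero hθ hI hΦ h' hmap hy'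
      obtain ⟨hTt, -⟩ := pd1_T_ne_zero hθ hI hΦ h' hmap hy'
      rw [newFlux, hTx, hTu]
      simp only [zero_mul, add_zero, sub_zero]
      rw [mul_div_mul_left _ _ hTt]
    rw [e.deriv_eq] at h1
    simp only [zero_mul, add_zero, sub_zero] at h1
    generalize deriv (_ : ℝ → ℝ) x₀ = D at h1 ⊢
    field_simp at h1 ⊢
    linear_combination -h1
  · rw [hTx, hTu]
    simpa using ⟨hTt, hX⟩

/-- On the equation with `u_x = p` fixed, raising `u_xx` by `r` raises `u_t` by `(g e^{nu}/f) r`.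
Comparison of `r = 0` and `r = 1` gives the relation multiplied by `U_u D_x X - X_u D_x U`. This
factor equals `U_u X_x - U_x X_u` and is nonzero. -/
theorem second_order_relation (hθ : θ.InClass I) (hI : IsOpen I) (hΦ : Φ.IsPointTransf I)
    (h' : θ'.InClass Φ.imageX) (hmap : MapsEquation θ Φ θ') (hm : Φ.Mem t₀ x₀ u₀) {p : ℝ}
    (hX : pd2 Φ.X t₀ x₀ u₀ + pd3 Φ.X t₀ x₀ u₀ * p ≠ 0) :
    θ'.f (Φ.X t₀ x₀ u₀) * (θ.g x₀ * Real.exp (θ.n * u₀))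
      * (pd2 Φ.X t₀ x₀ u₀ + pd3 Φ.X t₀ x₀ u₀ * p) ^ 2
      = newCoeff θ' Φ t₀ x₀ u₀ * θ.f x₀ * pd1 Φ.T t₀ x₀ u₀ := by
  have hB := hΦ.domain.isOpen_box
  have hbox : (t₀, x₀, u₀) ∈ Φ.box := hm
  have hf := hθ.f_ne x₀ (hΦ.domain.subset hm.2.1)
  obtain ⟨hTt, hM⟩ := pd1_T_ne_zero hθ hI hΦ h' hmap hm
  set κ := θ.g x₀ * Real.exp (θ.n * u₀) with hκ
  obtain ⟨q₀, hq₀⟩ : ∃ q₀, θ.f x₀ * q₀ = Real.exp (θ.n * u₀) * (θ.g x₀ * (0 + θ.n * p ^ 2)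
      + deriv θ.g x₀ * p) + θ.h x₀ * Real.exp (θ.m * u₀) := ⟨_ / θ.f x₀, mul_div_cancel₀ _ hf⟩
  have key : ∀ r : ℝ, _ := fun r => by
    have h1 := reduced_equation hθ hI hΦ h' hmap hm (q := q₀ + κ / θ.f x₀ * r) (r := r) hX
      (by rw [mul_add, hq₀, hκ]; field_simp; ring)
    have hm' : (t₀, x₀, jet t₀ x₀ u₀ 0 p r 0 t₀ x₀) ∈ Φ.box := by rwa [jet_self]
    have hG := (smoothOn_newCoeff hΦ h').hasDerivAt_jet_right hB hm'
    simp only [jet_self] at hG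
    simp only [jet, sub_self, mul_zero, add_zero, zero_div, zero_mul] at hG
    have hU := SmoothOn.hasDerivAt_total_right hΦ.smooth_U hB hbox p r
    have hXX := SmoothOn.hasDerivAt_total_right hΦ.smooth_X hB hbox p r
    have h2 := (hG.fun_mul (hU.fun_div hXX (by simpa using hX))).deriv
    rw [h2] at h1
    simp only [sub_self, mul_zero, add_zero, ne_eq, OfNat.ofNat_ne_zero, not_false_eq_true,
      zero_pow] at h1
    exact h1
  have h0 := key 0
  have h1 := key 1
  clear key hκ hq₀
  generalize newCoeff θ' Φ t₀ x₀ u₀ = Γ at *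
  generalize pd1 Φ.T t₀ x₀ u₀ = Tt at *
  generalize pd1 Φ.X t₀ x₀ u₀ = Xt at *
  generalize pd1 Φ.U t₀ x₀ u₀ = Ut at *
  have hM' : pd3 Φ.U t₀ x₀ u₀ * (pd2 Φ.X t₀ x₀ u₀ + pd3 Φ.X t₀ x₀ u₀ * p)
      - (pd2 Φ.U t₀ x₀ u₀ + pd3 Φ.U t₀ x₀ u₀ * p) * pd3 Φ.X t₀ x₀ u₀ ≠ 0 := by
    intro h; apply hM; linear_combination h
  generalize pd2 Φ.X t₀ x₀ u₀ + pd3 Φ.X t₀ x₀ u₀ * p = X2 at *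
  generalize pd2 Φ.U t₀ x₀ u₀ + pd3 Φ.U t₀ x₀ u₀ * p = U2 at *
  generalize pd3 Φ.X t₀ x₀ u₀ = Xu at *
  generalize pd3 Φ.U t₀ x₀ u₀ = Uu at *
  generalize θ'.f (Φ.X t₀ x₀ u₀) = F at *
  have h3 : (F * κ / θ.f x₀ / Tt - Γ / X2 ^ 2) * (Uu * X2 - U2 * Xu) = 0 := by
    linear_combination h1 - h0
  have h4 := sub_eq_zero.1 ((mul_eq_zero.1 h3).resolve_right hM')
  field_simp at h4
  linear_combination h4

/-- If `X_u ≠ 0`, then `D_x X = X_x + X_u p` takes both values `1` and `2` for suitable `p`, while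
`second_order_relation` prescribes its square independently of `p`. -/
theorem pd_X_u_eq_zero (hθ : θ.InClass I) (hI : IsOpen I) (hΦ : Φ.IsPointTransf I)
    (h' : θ'.InClass Φ.imageX) (hmap : MapsEquation θ Φ θ') (hm : Φ.Mem t₀ x₀ u₀) :
    pd3 Φ.X t₀ x₀ u₀ = 0 := by
  by_contra h
  have key : ∀ s : ℝ, s ≠ 0 → _ := fun s hs => by
    have := second_order_relation hθ hI hΦ h' hmap hm
      (p := (s - pd2 Φ.X t₀ x₀ u₀) / pd3 Φ.X t₀ x₀ u₀) (by
        rw [mul_div_cancel₀ _ h]; simpa using hs)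
    rw [mul_div_cancel₀ _ h] at this
    exact this
  have h1 := key 1 one_ne_zero
  have h2 := key 2 two_ne_zero
  have hne : θ'.f (Φ.X t₀ x₀ u₀) * (θ.g x₀ * Real.exp (θ.n * u₀)) ≠ 0 :=
    mul_ne_zero (h'.f_ne _ ⟨_, _, _, hm, rfl⟩)
      (mul_ne_zero (hθ.g_ne x₀ (hΦ.domain.subset hm.2.1)) (Real.exp_ne_zero _))
  apply hne
  linear_combination (h2 - h1) / 3

end determining

/-! ### Dependence of `U` on `u` and splitting with respect to `u_x`. -/

section determining

variable {I : Set ℝ} {θ θ' : Coeffs} {Φ : PointTransf}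

theorem SmoothOn.hasDerivAt_pd1 {F : ℝ → ℝ → ℝ → ℝ} {B : Set (ℝ × ℝ × ℝ)} (hF : SmoothOn F B)
    (hB : IsOpen B) {t x u : ℝ} (hm : (t, x, u) ∈ B) :
    HasDerivAt (fun s => F s x u) (pd1 F t x u) t :=
  (hF.hasDerivAt_comp hB (b := fun _ => x) (c := fun _ => u) hm (hasDerivAt_id' t)
    (hasDerivAt_const _ _) (hasDerivAt_const _ _)).congr_deriv (by simp)

theorem SmoothOn.hasDerivAt_pd2 {F : ℝ → ℝ → ℝ → ℝ} {B : Set (ℝ × ℝ × ℝ)} (hF : SmoothOn F B)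
    (hB : IsOpen B) {t x u : ℝ} (hm : (t, x, u) ∈ B) :
    HasDerivAt (fun y => F t y u) (pd2 F t x u) x :=
  (hF.hasDerivAt_comp hB (a := fun _ => t) (c := fun _ => u) hm (hasDerivAt_const _ _)
    (hasDerivAt_id' x) (hasDerivAt_const _ _)).congr_deriv (by simp)

theorem SmoothOn.hasDerivAt_pd3 {F : ℝ → ℝ → ℝ → ℝ} {B : Set (ℝ × ℝ × ℝ)} (hF : SmoothOn F B)
    (hB : IsOpen B) {t x u : ℝ} (hm : (t, x, u) ∈ B) :
    HasDerivAt (fun w => F t x w) (pd3 F t x u) u :=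
  (hF.hasDerivAt_comp hB (a := fun _ => t) (b := fun _ => x) hm (hasDerivAt_const _ _)
    (hasDerivAt_const _ _) (hasDerivAt_id' u)).congr_deriv (by simp)

/-- If `F` does not depend on `u`, up to a constant factor and a constant summand that do not
depend on `x`, the same is true for its `x`-derivative. -/
theorem pd2_eq_of_forall {D : PointTransf} {I : Set ℝ} (hD : D.HasDomainIn I)
    {F : ℝ → ℝ → ℝ → ℝ} {t x u w a b : ℝ} (hx : x ∈ D.domX)
    (h : ∀ y ∈ D.domX, F t y w = a * F t y u + b) : pd2 F t x w = a * pd2 F t x u := by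
  have e : (fun y => F t y w) =ᶠ[𝓝 x] fun y => a * F t y u + b :=
    (hD.openX.eventually_mem hx).mono h
  rw [pd2, e.deriv_eq]
  simp [pd2]

theorem pd1_eq_of_forall {D : PointTransf} {I : Set ℝ} (hD : D.HasDomainIn I)
    {F : ℝ → ℝ → ℝ → ℝ} {t x y u w b : ℝ} (ht : t ∈ D.domT)
    (h : ∀ s ∈ D.domT, F s y w = F s x u + b) : pd1 F t y w = pd1 F t x u := by
  have e : (fun s => F s y w) =ᶠ[𝓝 t] fun s => F s x u + b :=
    (hD.openT.eventually_mem ht).mono h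
  rw [pd1, e.deriv_eq]
  simp [pd1]

theorem T_eq_T (hθ : θ.InClass I) (hI : IsOpen I) (hΦ : Φ.IsPointTransf I)
    (h' : θ'.InClass Φ.imageX) (hmap : MapsEquation θ Φ θ') {t x u y w : ℝ}
    (hm : Φ.Mem t x u) (hm' : Φ.Mem t y w) : Φ.T t x u = Φ.T t y w := by
  have hB := hΦ.domain.isOpen_box
  have h1 : Φ.T t x u = Φ.T t y u :=
    eq_of_hasDerivAt_zero hΦ.domain.openX hΦ.domain.connX (F := fun y => Φ.T t y u)
      (fun z hz => by
        have hz' : Φ.Mem t z u := ⟨hm.1, hz, hm.2.2⟩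
        have := SmoothOn.hasDerivAt_pd2 hΦ.smooth_T hB hz'
        rwa [(pd_T_eq_zero hθ hI hΦ h' hmap hz').1] at this) hm.2.1 hm'.2.1
  have h2 : Φ.T t y u = Φ.T t y w :=
    eq_of_hasDerivAt_zero hΦ.domain.openU hΦ.domain.connU (F := fun w => Φ.T t y w)
      (fun z hz => by
        have hz' : Φ.Mem t y z := ⟨hm.1, hm'.2.1, hz⟩
        have := SmoothOn.hasDerivAt_pd3 hΦ.smooth_T hB hz'
        rwa [(pd_T_eq_zero hθ hI hΦ h' hmap hz').2] at this) hm.2.2 hm'.2.2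
  exact h1.trans h2

theorem X_eq_X_of_u (hθ : θ.InClass I) (hI : IsOpen I) (hΦ : Φ.IsPointTransf I)
    (h' : θ'.InClass Φ.imageX) (hmap : MapsEquation θ Φ θ') {t x u w : ℝ}
    (hm : Φ.Mem t x u) (hw : w ∈ Φ.domU) : Φ.X t x u = Φ.X t x w :=
  eq_of_hasDerivAt_zero hΦ.domain.openU hΦ.domain.connU (F := fun w => Φ.X t x w)
    (fun z hz => by
      have hz' : Φ.Mem t x z := ⟨hm.1, hm.2.1, hz⟩
      have := SmoothOn.hasDerivAt_pd3 hΦ.smooth_X hΦ.domain.isOpen_box hz'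
      rwa [pd_X_u_eq_zero hθ hI hΦ h' hmap hz'] at this) hm.2.2 hw

theorem pd2_X_ne_zero (hθ : θ.InClass I) (hI : IsOpen I) (hΦ : Φ.IsPointTransf I)
    (h' : θ'.InClass Φ.imageX) (hmap : MapsEquation θ Φ θ') {t x u : ℝ}
    (hm : Φ.Mem t x u) : pd2 Φ.X t x u ≠ 0 := by
  have h := (pd1_T_ne_zero hθ hI hΦ h' hmap hm).2
  rw [pd_X_u_eq_zero hθ hI hΦ h' hmap hm, mul_zero, sub_zero] at h
  exact right_ne_zero_of_mul h

theorem leading_relation (hθ : θ.InClass I) (hI : IsOpen I) (hΦ : Φ.IsPointTransf I)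
    (h' : θ'.InClass Φ.imageX) (hmap : MapsEquation θ Φ θ') {t x u : ℝ} (hm : Φ.Mem t x u) :
    θ'.f (Φ.X t x u) * (θ.g x * Real.exp (θ.n * u)) * pd2 Φ.X t x u ^ 2
      = newCoeff θ' Φ t x u * θ.f x * pd1 Φ.T t x u := by
  have := second_order_relation hθ hI hΦ h' hmap hm (p := 0)
    (by simpa using pd2_X_ne_zero hθ hI hΦ h' hmap hm)
  simpa using this

/-- In `leading_relation` everything except `e^{nu}` and `e^{ñU}` is independent of `u`, so `nu -
ñU` is independent of `u` as well. -/
theorem n_mul_sub (hθ : θ.InClass I) (hI : IsOpen I) (hΦ : Φ.IsPointTransf I)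
    (h' : θ'.InClass Φ.imageX) (hmap : MapsEquation θ Φ θ') {t x u w : ℝ}
    (hm : Φ.Mem t x u) (hw : w ∈ Φ.domU) :
    θ'.n * (Φ.U t x w - Φ.U t x u) = θ.n * (w - u) := by
  have hm' : Φ.Mem t x w := ⟨hm.1, hm.2.1, hw⟩
  have r1 := leading_relation hθ hI hΦ h' hmap hm
  have r2 := leading_relation hθ hI hΦ h' hmap hm'
  have e2 : pd2 Φ.X t x w = 1 * pd2 Φ.X t x u := pd2_eq_of_forall (b := 0) hΦ.domain hm.2.1
    fun y hy => by rw [X_eq_X_of_u hθ hI hΦ h' hmap ⟨hm.1, hy, hw⟩ hm.2.2]; ring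
  have e1 : pd1 Φ.T t x w = pd1 Φ.T t x u := pd1_eq_of_forall (b := 0) hΦ.domain hm.1
    fun s hs => by rw [T_eq_T hθ hI hΦ h' hmap ⟨hs, hm.2.1, hw⟩ ⟨hs, hm.2.1, hm.2.2⟩, add_zero]
  have hX := X_eq_X_of_u hθ hI hΦ h' hmap hm hw
  rw [e2, e1, one_mul, newCoeff, ← hX] at r2
  rw [newCoeff] at r1
  have hT := (pd1_T_ne_zero hθ hI hΦ h' hmap hm).1
  have hXx := pd2_X_ne_zero hθ hI hΦ h' hmap hm
  have hf' := h'.f_ne _ ⟨t, x, u, hm, rfl⟩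
  have hg' := h'.g_ne _ ⟨t, x, u, hm, rfl⟩
  have hf := hθ.f_ne x (hΦ.domain.subset hm.2.1)
  have hg := hθ.g_ne x (hΦ.domain.subset hm.2.1)
  generalize θ'.f (Φ.X t x u) = f' at *
  generalize θ'.g (Φ.X t x u) = g' at *
  generalize pd2 Φ.X t x u = Xx at *
  generalize pd1 Φ.T t x u = Tt at *
  have key : Real.exp (θ.n * u + θ'.n * Φ.U t x w) = Real.exp (θ.n * w + θ'.n * Φ.U t x u) := by
    rw [Real.exp_add, Real.exp_add]
    have hne : f' * θ.g x * Xx ^ 2 * (g' * θ.f x * Tt) ≠ 0 := by simp [*]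
    apply mul_left_cancel₀ hne
    linear_combination g' * Real.exp (θ'.n * Φ.U t x w) * θ.f x * Tt * r1
      - g' * Real.exp (θ'.n * Φ.U t x u) * θ.f x * Tt * r2
  linear_combination Real.exp_injective key

theorem U_eq (hθ : θ.InClass I) (hI : IsOpen I) (hΦ : Φ.IsPointTransf I)
    (h' : θ'.InClass Φ.imageX) (hmap : MapsEquation θ Φ θ') {t x u w : ℝ}
    (hm : Φ.Mem t x u) (hw : w ∈ Φ.domU) :
    Φ.U t x w = Φ.U t x u + θ.n / θ'.n * (w - u) := by
  have := n_mul_sub hθ hI hΦ h' hmap hm hw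
  have hn := h'.n_ne
  field_simp
  linear_combination this

theorem pd3_U (hθ : θ.InClass I) (hI : IsOpen I) (hΦ : Φ.IsPointTransf I)
    (h' : θ'.InClass Φ.imageX) (hmap : MapsEquation θ Φ θ') {t x u : ℝ}
    (hm : Φ.Mem t x u) : pd3 Φ.U t x u = θ.n / θ'.n := by
  have e : (fun w => Φ.U t x w) =ᶠ[𝓝 u] fun w => Φ.U t x u + θ.n / θ'.n * (w - u) :=
    (hΦ.domain.openU.eventually_mem hm.2.2).mono fun w hw => U_eq hθ hI hΦ h' hmap hm hw
  rw [pd3, e.deriv_eq]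
  simp

theorem pd2_U_eq (hθ : θ.InClass I) (hI : IsOpen I) (hΦ : Φ.IsPointTransf I)
    (h' : θ'.InClass Φ.imageX) (hmap : MapsEquation θ Φ θ') {t x u w : ℝ}
    (hm : Φ.Mem t x u) (hw : w ∈ Φ.domU) : pd2 Φ.U t x w = pd2 Φ.U t x u :=
  (pd2_eq_of_forall (a := 1) (b := θ.n / θ'.n * (w - u)) hΦ.domain hm.2.1 fun y hy => by
    rw [U_eq hθ hI hΦ h' hmap ⟨hm.1, hy, hm.2.2⟩ hw, one_mul]).trans (one_mul _)

theorem pd2_X_eq (hθ : θ.InClass I) (hI : IsOpen I) (hΦ : Φ.IsPointTransf I)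
    (h' : θ'.InClass Φ.imageX) (hmap : MapsEquation θ Φ θ') {t x u w : ℝ}
    (hm : Φ.Mem t x u) (hw : w ∈ Φ.domU) : pd2 Φ.X t x w = pd2 Φ.X t x u :=
  (pd2_eq_of_forall (a := 1) (b := 0) hΦ.domain hm.2.1 fun y hy => by
    rw [X_eq_X_of_u hθ hI hΦ h' hmap ⟨hm.1, hy, hw⟩ hm.2.2]; ring).trans (one_mul _)

theorem newCoeff_eq (hθ : θ.InClass I) (hI : IsOpen I) (hΦ : Φ.IsPointTransf I)
    (h' : θ'.InClass Φ.imageX) (hmap : MapsEquation θ Φ θ') {t x u w : ℝ}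
    (hm : Φ.Mem t x u) (hw : w ∈ Φ.domU) :
    newCoeff θ' Φ t x w = Real.exp (θ.n * (w - u)) * newCoeff θ' Φ t x u := by
  rw [newCoeff, newCoeff, ← X_eq_X_of_u hθ hI hΦ h' hmap hm hw,
    ← n_mul_sub hθ hI hΦ h' hmap hm hw, mul_left_comm, ← Real.exp_add]
  congr 3; ring

theorem pd2_newCoeff_eq (hθ : θ.InClass I) (hI : IsOpen I) (hΦ : Φ.IsPointTransf I)
    (h' : θ'.InClass Φ.imageX) (hmap : MapsEquation θ Φ θ') {t x u w : ℝ}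
    (hm : Φ.Mem t x u) (hw : w ∈ Φ.domU) :
    pd2 (newCoeff θ' Φ) t x w = Real.exp (θ.n * (w - u)) * pd2 (newCoeff θ' Φ) t x u :=
  pd2_eq_of_forall (b := 0) hΦ.domain hm.2.1 fun y hy => by
    rw [newCoeff_eq hθ hI hΦ h' hmap ⟨hm.1, hy, hm.2.2⟩ hw, add_zero]

theorem pd3_eq_zero_of_forall (hΦ : Φ.IsPointTransf I) {F : ℝ → ℝ → ℝ → ℝ} {t x u : ℝ}
    (hm : Φ.Mem t x u) (h : ∀ w ∈ Φ.domU, F t x w = F t x u) : pd3 F t x u = 0 := by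
  have e : (fun w => F t x w) =ᶠ[𝓝 u] fun w => F t x u :=
    (hΦ.domain.openU.eventually_mem hm.2.2).mono h
  rw [pd3, e.deriv_eq, deriv_const]

/-- The determining equations left after the second-order terms. -/
theorem split_equation (hθ : θ.InClass I) (hI : IsOpen I) (hΦ : Φ.IsPointTransf I)
    (h' : θ'.InClass Φ.imageX) (hmap : MapsEquation θ Φ θ') {t x u : ℝ}
    (hm : Φ.Mem t x u) :
    (θ'.f (Φ.X t x u) * (θ.n / θ'.n) * (Real.exp (θ.n * u) * deriv θ.g x / θ.f x * pd2 Φ.X t x u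
        - pd1 Φ.X t x u) / pd1 Φ.T t x u
      = (pd2 (newCoeff θ' Φ) t x u * (θ.n / θ'.n) + θ.n * newCoeff θ' Φ t x u * pd2 Φ.U t x u)
          / pd2 Φ.X t x u
        - newCoeff θ' Φ t x u * (θ.n / θ'.n) * pd2 (pd2 Φ.X) t x u / pd2 Φ.X t x u ^ 2) ∧
    (θ'.f (Φ.X t x u) * ((pd1 Φ.U t x u + θ.n / θ'.n * θ.h x / θ.f x * Real.exp (θ.m * u))
        * pd2 Φ.X t x u - pd2 Φ.U t x u * pd1 Φ.X t x u) / pd1 Φ.T t x u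
      = (pd2 (newCoeff θ' Φ) t x u * pd2 Φ.U t x u + newCoeff θ' Φ t x u * pd2 (pd2 Φ.U) t x u)
          / pd2 Φ.X t x u
        - newCoeff θ' Φ t x u * pd2 Φ.U t x u * pd2 (pd2 Φ.X) t x u / pd2 Φ.X t x u ^ 2
        + θ'.h (Φ.X t x u) * Real.exp (θ'.m * Φ.U t x u) * pd2 Φ.X t x u) := by
  have hB := hΦ.domain.isOpen_box
  have hbox : (t, x, u) ∈ Φ.box := hm
  have hf := hθ.f_ne x (hΦ.domain.subset hm.2.1)
  have hT := (pd1_T_ne_zero hθ hI hΦ h' hmap hm).1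
  have hX := pd2_X_ne_zero hθ hI hΦ h' hmap hm
  have hlead := leading_relation hθ hI hΦ h' hmap hm
  have hXu := pd_X_u_eq_zero hθ hI hΦ h' hmap hm
  have hUu := pd3_U hθ hI hΦ h' hmap hm
  -- The second derivatives `U_xu`, `U_uu`, `X_xu`, `X_uu` vanish and the coefficient `g̃ e^{ñU}` is
  -- multiplied by `n` under `∂_u`. After substitution the equation is a polynomial in `p` of degree
  -- at most two.
  have z1 : pd3 (pd2 Φ.U) t x u = 0 :=
    pd3_eq_zero_of_forall hΦ hm fun w hw => pd2_U_eq hθ hI hΦ h' hmap hm hw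
  have z2 : pd3 (pd3 Φ.U) t x u = 0 :=
    pd3_eq_zero_of_forall hΦ hm fun w hw => by
      rw [hUu, pd3_U hθ hI hΦ h' hmap ⟨hm.1, hm.2.1, hw⟩]
  have z3 : pd2 (pd3 Φ.U) t x u = 0 := by
    have e : (fun y => pd3 Φ.U t y u) =ᶠ[𝓝 x] fun y => θ.n / θ'.n :=
      (hΦ.domain.openX.eventually_mem hm.2.1).mono fun y hy =>
        pd3_U hθ hI hΦ h' hmap ⟨hm.1, hy, hm.2.2⟩
    rw [pd2, e.deriv_eq, deriv_const]
  have z4 : pd3 (pd2 Φ.X) t x u = 0 :=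
    pd3_eq_zero_of_forall hΦ hm fun w hw => pd2_X_eq hθ hI hΦ h' hmap hm hw
  have z5 : pd3 (pd3 Φ.X) t x u = 0 :=
    pd3_eq_zero_of_forall hΦ hm fun w hw => by
      rw [hXu, pd_X_u_eq_zero hθ hI hΦ h' hmap ⟨hm.1, hm.2.1, hw⟩]
  have z6 : pd2 (pd3 Φ.X) t x u = 0 := by
    have e : (fun y => pd3 Φ.X t y u) =ᶠ[𝓝 x] fun y => 0 :=
      (hΦ.domain.openX.eventually_mem hm.2.1).mono fun y hy =>
        pd_X_u_eq_zero hθ hI hΦ h' hmap ⟨hm.1, hy, hm.2.2⟩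
    rw [pd2, e.deriv_eq, deriv_const]
  have z7 : pd3 (newCoeff θ' Φ) t x u = θ.n * newCoeff θ' Φ t x u := by
    have e : (fun w => newCoeff θ' Φ t x w) =ᶠ[𝓝 u] fun w =>
        Real.exp (θ.n * (w - u)) * newCoeff θ' Φ t x u :=
      (hΦ.domain.openU.eventually_mem hm.2.2).mono fun w hw =>
        newCoeff_eq hθ hI hΦ h' hmap hm hw
    have hd := (((((hasDerivAt_id' u).sub_const u).const_mul θ.n).exp).mul_const
      (newCoeff θ' Φ t x u)).deriv
    rw [pd3, e.deriv_eq, hd]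
    simp
  have key : ∀ p : ℝ, _ := fun p => by
    have h1 := reduced_equation hθ hI hΦ h' hmap hm (p := p) (r := 0)
      (q := (Real.exp (θ.n * u) * (θ.g x * (0 + θ.n * p ^ 2) + deriv θ.g x * p)
        + θ.h x * Real.exp (θ.m * u)) / θ.f x) (by simpa [hXu] using hX) (mul_div_cancel₀ _ hf)
    have hm' : (t, x, jet t x u 0 p 0 0 t x) ∈ Φ.box := by rwa [jet_self]
    have hG := (smoothOn_newCoeff hΦ h').hasDerivAt_jet_right hB hm'
    simp only [jet_self] at hG
    simp only [jet, sub_self, mul_zero, add_zero, zero_div, zero_mul] at hG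
    have hU := SmoothOn.hasDerivAt_total_right hΦ.smooth_U hB hbox p 0
    have hXX := SmoothOn.hasDerivAt_total_right hΦ.smooth_X hB hbox p 0
    simp only [zero_div, zero_mul, add_zero, mul_zero] at hU hXX
    simp only [zero_div, zero_mul, add_zero] at h1
    have h2 := (hG.fun_mul (hU.fun_div hXX (by simpa [hXu] using hX))).deriv
    rw [h2] at h1
    simp only [sub_self, mul_zero, add_zero, z1, z2, z3, z4, z5, z6, z7, hXu, hUu, zero_mul, zero_add] at h1
    exact h1
  -- The value at `p = 0` is the free term; half the difference of the values at `p = ±1` is the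
  -- coefficient of `p`.
  have k0 := key 0
  have k1 := key 1
  have k2 := key (-1)
  clear key z1 z2 z3 z4 z5 z6 z7 hUu hXu
  generalize newCoeff θ' Φ t x u = Γ at *
  generalize pd2 (newCoeff θ' Φ) t x u = Γx at *
  generalize pd1 Φ.T t x u = Tt at *
  generalize pd1 Φ.X t x u = Xt at *
  generalize pd2 Φ.X t x u = Xx at *
  generalize pd2 (pd2 Φ.X) t x u = Xxx at *
  generalize pd1 Φ.U t x u = Ut at *
  generalize pd2 Φ.U t x u = Ux at *
  generalize pd2 (pd2 Φ.U) t x u = Uxx at *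
  generalize θ'.f (Φ.X t x u) = F at *
  generalize θ'.h (Φ.X t x u) * Real.exp (θ'.m * Φ.U t x u) = H at *
  generalize Real.exp (θ.n * u) = E at *
  generalize Real.exp (θ.m * u) = E' at *
  generalize θ.n / θ'.n = δ at *
  constructor
  · have e : F * δ * (E * deriv θ.g x / θ.f x * Xx - Xt) / Tt
        - ((Γx * δ + θ.n * Γ * Ux) * Xx - Γ * δ * Xxx) / Xx ^ 2 = 0 := by
      field_simp at k1 k2 ⊢
      linear_combination (k1 - k2) / 2
    field_simp at e ⊢
    linear_combination e
  · field_simp at k0 ⊢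
    linear_combination k0

end determining

/-- The exponent `s` is unknown and may coincide with any of the other three, so coefficients of
equal exponents are first collected in `k`. For `m ≠ 0, n` only the term with `s` can compensate `a
e^{mu}`; once it does, `b` and `c` stand alone. -/
theorem coeff_of_four_exp {S : Set ℝ} (hS : IsOpen S) (hne : S.Nonempty) {a b c d m n s : ℝ}
    (hn : n ≠ 0)
    (h : ∀ u ∈ S, a * Real.exp (m * u) + b + c * Real.exp (n * u) + d * Real.exp (s * u) = 0) :
    (m ≠ 0 → m ≠ n → a ≠ 0 → s = m) ∧
    (m ≠ 0 → m ≠ n → s = m → b = 0 ∧ c = 0) := by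
  classical
  set k : ℝ → ℝ := fun i => (if i = m then a else 0) + (if i = 0 then b else 0)
    + (if i = n then c else 0) + (if i = s then d else 0) with hk
  have key := coeff_eq_zero_of_sum_exp hS hne {m, 0, n, s} k (fun u hu => by
    refine Eq.trans ?_ (h u hu)
    have e1 : m ∈ ({m, 0, n, s} : Finset ℝ) := by simp
    have e2 : (0 : ℝ) ∈ ({m, 0, n, s} : Finset ℝ) := by simp
    have e3 : n ∈ ({m, 0, n, s} : Finset ℝ) := by simp
    have e4 : s ∈ ({m, 0, n, s} : Finset ℝ) := by simp
    simp only [hk, add_mul, Finset.sum_add_distrib, ite_mul, zero_mul, Finset.sum_ite_eq', e1, e2,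
      e3, e4, if_true, Real.exp_zero, mul_one])
  have em := key m (by simp)
  have e0 := key 0 (by simp)
  have en := key n (by simp)
  simp only [hk] at em e0 en
  constructor
  · intro hm hmn ha
    by_contra hs
    simp [hm, hmn, Ne.symm hs] at em
    exact ha em
  · rintro hm hmn rfl
    simp only [hn.symm, hm.symm, if_true, if_false] at e0
    simp only [hn, hmn.symm, if_true, if_false] at en
    exact ⟨by linarith, by linarith⟩

/-- A nonempty open set of reals has a second point. -/
theorem exists_ne_mem {S : Set ℝ} (hS : IsOpen S) {x : ℝ} (hx : x ∈ S) : ∃ y ∈ S, y ≠ x := by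
  obtain ⟨ε, hε, h⟩ := Metric.isOpen_iff.1 hS x hx
  refine ⟨x + ε / 2, h ?_, fun e => by linarith⟩
  rw [Metric.mem_ball, Real.dist_eq, add_sub_cancel_left, abs_of_pos (half_pos hε)]
  exact half_lt_self hε

/-- A function with nonvanishing derivative on an interval is injective there. -/
theorem injOn_of_hasDerivAt_ne_zero {S : Set ℝ} (hc : S.OrdConnected) {F F' : ℝ → ℝ}
    (hF : ∀ x ∈ S, HasDerivAt F (F' x) x) (hne : ∀ x ∈ S, F' x ≠ 0) : InjOn F S := by
  have key : ∀ x ∈ S, ∀ y ∈ S, x < y → F x ≠ F y := by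
    intro x hx y hy hxy e
    have hsub := hc.out hx hy
    obtain ⟨z, hz, h⟩ := exists_hasDerivAt_eq_zero hxy
      (fun z hz => (hF z (hsub hz)).continuousAt.continuousWithinAt) e
      (fun z hz => hF z (hsub (Ioo_subset_Icc_self hz)))
    exact hne z (hsub (Ioo_subset_Icc_self hz)) h
  intro x hx y hy e
  rcases lt_trichotomy x y with h | h | h
  · exact absurd e (key x hx y hy h)
  · exact h
  · exact absurd e.symm (key y hy x hx h)

theorem intervalIntegrable_of_continuousOn {S : Set ℝ} (hc : S.OrdConnected) {k : ℝ → ℝ}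
    (hk : ContinuousOn k S) {x y : ℝ} (hx : x ∈ S) (hy : y ∈ S) :
    IntervalIntegrable k MeasureTheory.volume x y :=
  (hk.mono (hc.uIcc_subset hx hy)).intervalIntegrable

theorem hasDerivAt_integral {S : Set ℝ} (hS : IsOpen S) (hc : S.OrdConnected) {k : ℝ → ℝ}
    (hk : ContinuousOn k S) {x₀ x : ℝ} (hx₀ : x₀ ∈ S) (hx : x ∈ S) :
    HasDerivAt (fun y => ∫ z in x₀..y, k z) (k x) x :=
  intervalIntegral.integral_hasDerivAt_right
    (intervalIntegrable_of_continuousOn hc hk hx₀ hx)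
    (hk.stronglyMeasurableAtFilter hS x hx) (hk.continuousAt (hS.mem_nhds hx))

theorem Coeffs.InClass.continuousOn_inv_g {I : Set ℝ} {θ : Coeffs} (hθ : θ.InClass I) :
    ContinuousOn (fun x => 1 / θ.g x) I :=
  continuousOn_const.div hθ.smooth_g.continuousOn hθ.g_ne

/-! ### Time independence of `X` and the lower order terms. -/

section determining

variable {I : Set ℝ} {θ θ' : Coeffs} {Φ : PointTransf}

/-- As a function of `u`, the coefficient of `u_x` contains only the exponentials `1` and `e^{nu}`,
and `X_t` occurs, with a nonzero factor, as the coefficient of `1`. The summands of `key` with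
coefficient `0` play no role. -/
theorem pd1_X_eq_zero (hθ : θ.InClass I) (hI : IsOpen I) (hΦ : Φ.IsPointTransf I)
    (h' : θ'.InClass Φ.imageX) (hmap : MapsEquation θ Φ θ') {t x u : ℝ}
    (hm : Φ.Mem t x u) : pd1 Φ.X t x u = 0 := by
  have hf' := h'.f_ne _ ⟨t, x, u, hm, rfl⟩
  have hT := (pd1_T_ne_zero hθ hI hΦ h' hmap hm).1
  have hn' := h'.n_ne
  obtain ⟨R, hR⟩ : ∃ R, R = (pd2 (newCoeff θ' Φ) t x u * (θ.n / θ'.n)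
      + θ.n * newCoeff θ' Φ t x u * pd2 Φ.U t x u) / pd2 Φ.X t x u
        - newCoeff θ' Φ t x u * (θ.n / θ'.n) * pd2 (pd2 Φ.X) t x u / pd2 Φ.X t x u ^ 2 := ⟨_, rfl⟩
  have key : ∀ w ∈ Φ.domU, 0 * Real.exp (0 * w)
      + θ'.f (Φ.X t x u) * (θ.n / θ'.n) * pd1 Φ.X t x u / pd1 Φ.T t x u
      + (Real.exp (-(θ.n * u)) * R - θ'.f (Φ.X t x u) * (θ.n / θ'.n) *
        (deriv θ.g x / θ.f x * pd2 Φ.X t x u) / pd1 Φ.T t x u) * Real.exp (θ.n * w)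
      + 0 * Real.exp (θ.n * 2 * w) = 0 := by
    intro w hw
    have hmw : Φ.Mem t x w := ⟨hm.1, hm.2.1, hw⟩
    have h := (split_equation hθ hI hΦ h' hmap hmw).1
    have e1 : pd1 Φ.T t x w = pd1 Φ.T t x u := pd1_eq_of_forall (b := 0) hΦ.domain hm.1
      fun s hs => by
        rw [T_eq_T hθ hI hΦ h' hmap ⟨hs, hm.2.1, hw⟩ ⟨hs, hm.2.1, hm.2.2⟩, add_zero]
    have e2 : pd1 Φ.X t x w = pd1 Φ.X t x u := pd1_eq_of_forall (b := 0) hΦ.domain hm.1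
      fun s hs => by
        rw [X_eq_X_of_u hθ hI hΦ h' hmap ⟨hs, hm.2.1, hw⟩ hm.2.2, add_zero]
    have e3 : pd2 (pd2 Φ.X) t x w = pd2 (pd2 Φ.X) t x u :=
      (pd2_eq_of_forall (a := 1) (b := 0) hΦ.domain hm.2.1 fun y hy => by
        rw [pd2_X_eq hθ hI hΦ h' hmap ⟨hm.1, hy, hw⟩ hm.2.2]; ring).trans (one_mul _)
    have e4 : Real.exp (θ.n * (w - u)) = Real.exp (θ.n * w) * Real.exp (-(θ.n * u)) := by
      rw [← Real.exp_add]; congr 1; ring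
    rw [e1, e2, e3, pd2_X_eq hθ hI hΦ h' hmap hm hw, pd2_U_eq hθ hI hΦ h' hmap hm hw,
      newCoeff_eq hθ hI hΦ h' hmap hm hw, pd2_newCoeff_eq hθ hI hΦ h' hmap hm hw,
      ← X_eq_X_of_u hθ hI hΦ h' hmap hm hw, e4] at h
    rw [hR]
    linear_combination -h
  have hn := hθ.n_ne
  have := coeff_eq_zero_of_sum_exp hΦ.domain.openU hΦ.domain.nonemptyU {0, θ.n}
    (fun i => if i = 0 then θ'.f (Φ.X t x u) * (θ.n / θ'.n) * pd1 Φ.X t x u / pd1 Φ.T t x u else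
      (Real.exp (-(θ.n * u)) * R - θ'.f (Φ.X t x u) * (θ.n / θ'.n) *
        (deriv θ.g x / θ.f x * pd2 Φ.X t x u) / pd1 Φ.T t x u)) (fun w hw => by
      rw [Finset.sum_pair hn.symm]
      simp only [if_true, if_neg hn, zero_mul, Real.exp_zero, mul_one]
      linear_combination key w hw) 0 (by simp)
  simpa [hf', hn, hn', hT] using this

theorem X_eq_X (hθ : θ.InClass I) (hI : IsOpen I) (hΦ : Φ.IsPointTransf I)
    (h' : θ'.InClass Φ.imageX) (hmap : MapsEquation θ Φ θ') {t x u s w : ℝ}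
    (hm : Φ.Mem t x u) (hm' : Φ.Mem s x w) : Φ.X t x u = Φ.X s x w :=
  (X_eq_X_of_u hθ hI hΦ h' hmap hm hm'.2.2).trans <|
    eq_of_hasDerivAt_zero hΦ.domain.openT hΦ.domain.connT (F := fun s => Φ.X s x w)
    (fun z hz => by
      have hz' : Φ.Mem z x w := ⟨hz, hm'.2⟩
      have := SmoothOn.hasDerivAt_pd1 hΦ.smooth_X hΦ.domain.isOpen_box hz'
      rwa [pd1_X_eq_zero hθ hI hΦ h' hmap hz'] at this) hm.1 hm'.1

/-- The derivative of the flux `g̃ e^{ñ ũ} U_x / X_x` with respect to `x`. -/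
noncomputable def fluxDeriv (θ' : Coeffs) (Φ : PointTransf) (t x u : ℝ) : ℝ :=
  (pd2 (newCoeff θ' Φ) t x u * pd2 Φ.U t x u + newCoeff θ' Φ t x u * pd2 (pd2 Φ.U) t x u)
    / pd2 Φ.X t x u
  - newCoeff θ' Φ t x u * pd2 Φ.U t x u * pd2 (pd2 Φ.X) t x u / pd2 Φ.X t x u ^ 2

theorem hasDerivAt_flux (hθ : θ.InClass I) (hI : IsOpen I) (hΦ : Φ.IsPointTransf I)
    (h' : θ'.InClass Φ.imageX) (hmap : MapsEquation θ Φ θ') {t x u : ℝ} (hm : Φ.Mem t x u) :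
    HasDerivAt (fun y => newCoeff θ' Φ t y u * pd2 Φ.U t y u / pd2 Φ.X t y u)
      (fluxDeriv θ' Φ t x u) x := by
  have hB := hΦ.domain.isOpen_box
  have hX := pd2_X_ne_zero hθ hI hΦ h' hmap hm
  have h1 := (smoothOn_newCoeff hΦ h').hasDerivAt_pd2 hB hm
  have h2 := (SmoothOn.smooth_pd2 hΦ.smooth_U hB).hasDerivAt_pd2 hB hm
  have h3 := (SmoothOn.smooth_pd2 hΦ.smooth_X hB).hasDerivAt_pd2 hB hm
  refine ((h1.fun_mul h2).fun_div h3 hX).congr_deriv ?_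
  rw [fluxDeriv]
  field_simp

/-- The factor `g̃ e^{2 ñ ũ} / (g X_x)` does not depend on `x`. -/
theorem hasDerivAt_factor (hθ : θ.InClass I) (hI : IsOpen I) (hΦ : Φ.IsPointTransf I)
    (h' : θ'.InClass Φ.imageX) (hmap : MapsEquation θ Φ θ') {t x u : ℝ} (hm : Φ.Mem t x u) :
    HasDerivAt (fun y => newCoeff θ' Φ t y u * Real.exp (θ'.n * Φ.U t y u)
      / (θ.g y * pd2 Φ.X t y u)) 0 x := by
  have hB := hΦ.domain.isOpen_box
  have hx := hΦ.domain.subset hm.2.1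
  have hX := pd2_X_ne_zero hθ hI hΦ h' hmap hm
  have hg := hθ.g_ne x hx
  have h1 := (smoothOn_newCoeff hΦ h').hasDerivAt_pd2 hB hm
  have h2 := ((SmoothOn.hasDerivAt_pd2 hΦ.smooth_U hB hm).const_mul θ'.n).exp
  have h3 := (SmoothOn.smooth_pd2 hΦ.smooth_X hB).hasDerivAt_pd2 hB hm
  have h4 := ((hθ.smooth_g.contDiffAt (hI.mem_nhds hx)).differentiableAt (by simp)).hasDerivAt
  refine ((h1.fun_mul h2).fun_div (h4.fun_mul h3) (mul_ne_zero hg hX)).congr_deriv ?_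
  have hs := (split_equation hθ hI hΦ h' hmap hm).1
  have hl := leading_relation hθ hI hΦ h' hmap hm
  rw [pd1_X_eq_zero hθ hI hΦ h' hmap hm, sub_zero] at hs
  have hT := (pd1_T_ne_zero hθ hI hΦ h' hmap hm).1
  have hf := hθ.f_ne x hx
  have hn := hθ.n_ne
  have hn' := h'.n_ne
  generalize newCoeff θ' Φ t x u = Γ at *
  generalize pd2 (newCoeff θ' Φ) t x u = Γx at *
  generalize pd1 Φ.T t x u = Tt at *
  generalize pd2 Φ.X t x u = Xx at *
  generalize pd2 (pd2 Φ.X) t x u = Xxx at *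
  generalize pd2 Φ.U t x u = Ux at *
  generalize θ'.f (Φ.X t x u) = F at *
  generalize Real.exp (θ.n * u) = N at *
  generalize Real.exp (θ'.n * Φ.U t x u) = E at *
  -- Eliminating `f̃` by the leading relation turns the coefficient of `u_x` into the statement that
  -- the logarithmic derivatives of `Γ e^{ñU}/X_x` and of `g` agree.
  have hs2 : (Γx + θ'.n * Γ * Ux) / Xx - Γ * Xxx / Xx ^ 2 = deriv θ.g x * Γ / (θ.g x * Xx) := by
    have : F * (N * deriv θ.g x / θ.f x * Xx) / Tt = deriv θ.g x * Γ / (θ.g x * Xx) := by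
      field_simp
      linear_combination deriv θ.g x * hl
    rw [← this]
    field_simp at hs ⊢
    linear_combination -hs
  field_simp at hs2
  rw [div_eq_zero_iff]
  left
  linear_combination E * hs2

/-- Equation for the lower order terms. -/
theorem lower_order_relation (hθ : θ.InClass I) (hI : IsOpen I) (hΦ : Φ.IsPointTransf I)
    (h' : θ'.InClass Φ.imageX) (hmap : MapsEquation θ Φ θ') {t x u : ℝ} (hm : Φ.Mem t x u) :
    θ'.f (Φ.X t x u) * (pd1 Φ.U t x u + θ.n / θ'.n * θ.h x / θ.f x * Real.exp (θ.m * u))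
        * pd2 Φ.X t x u / pd1 Φ.T t x u
      = fluxDeriv θ' Φ t x u
        + θ'.h (Φ.X t x u) * Real.exp (θ'.m * Φ.U t x u) * pd2 Φ.X t x u := by
  have hs := (split_equation hθ hI hΦ h' hmap hm).2
  rw [pd1_X_eq_zero hθ hI hΦ h' hmap hm, mul_zero, sub_zero] at hs
  rw [fluxDeriv, ← hs, mul_assoc (θ'.f (Φ.X t x u))]

/-- `lower_order_relation` is a linear relation between `e^{mu}`, `1`, `e^{nu}` and `e^{m̃(n/ñ)u}`,
whose coefficients contain, respectively, `h`, `U_t`, the derivative of the flux and `h̃`;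
`coeff_of_four_exp` splits it. -/
theorem generic_lower_order (hθ : θ.InClass I) (hI : IsOpen I) (hΦ : Φ.IsPointTransf I)
    (h' : θ'.InClass Φ.imageX) (hmap : MapsEquation θ Φ θ') (hm0 : θ.m ≠ 0) (hmn : θ.m ≠ θ.n)
    (hh : ∃ x ∈ Φ.domX, θ.h x ≠ 0) :
    θ'.n * θ.m = θ.n * θ'.m ∧
    ∀ {t x u : ℝ}, Φ.Mem t x u → pd1 Φ.U t x u = 0 ∧ fluxDeriv θ' Φ t x u = 0 := by
  have hn := hθ.n_ne
  have hn' := h'.n_ne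
  have key : ∀ {t x u : ℝ}, Φ.Mem t x u → ∀ w ∈ Φ.domU,
      (θ'.f (Φ.X t x u) * (θ.n / θ'.n * θ.h x / θ.f x) * pd2 Φ.X t x u / pd1 Φ.T t x u)
        * Real.exp (θ.m * w)
      + θ'.f (Φ.X t x u) * pd1 Φ.U t x u * pd2 Φ.X t x u / pd1 Φ.T t x u
      + (-(Real.exp (-(θ.n * u)) * fluxDeriv θ' Φ t x u)) * Real.exp (θ.n * w)
      + (-(θ'.h (Φ.X t x u) * Real.exp (θ'.m * (Φ.U t x u - θ.n / θ'.n * u)) * pd2 Φ.X t x u))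
        * Real.exp (θ'.m * (θ.n / θ'.n) * w) = 0 := by
    intro t x u hm w hw
    have hmw : Φ.Mem t x w := ⟨hm.1, hm.2.1, hw⟩
    have h := lower_order_relation hθ hI hΦ h' hmap hmw
    have e1 : pd1 Φ.T t x w = pd1 Φ.T t x u := pd1_eq_of_forall (b := 0) hΦ.domain hm.1
      fun s hs => by
        rw [T_eq_T hθ hI hΦ h' hmap ⟨hs, hm.2.1, hw⟩ ⟨hs, hm.2.1, hm.2.2⟩, add_zero]
    have e2 : pd1 Φ.U t x w = pd1 Φ.U t x u :=
      pd1_eq_of_forall (b := θ.n / θ'.n * (w - u)) hΦ.domain hm.1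
      fun s hs => U_eq hθ hI hΦ h' hmap ⟨hs, hm.2.1, hm.2.2⟩ hw
    have e3 : pd2 (pd2 Φ.X) t x w = pd2 (pd2 Φ.X) t x u :=
      (pd2_eq_of_forall (a := 1) (b := 0) hΦ.domain hm.2.1 fun y hy => by
        rw [pd2_X_eq hθ hI hΦ h' hmap ⟨hm.1, hy, hw⟩ hm.2.2]; ring).trans (one_mul _)
    have e5 : pd2 (pd2 Φ.U) t x w = pd2 (pd2 Φ.U) t x u :=
      (pd2_eq_of_forall (a := 1) (b := 0) hΦ.domain hm.2.1 fun y hy => by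
        rw [pd2_U_eq hθ hI hΦ h' hmap ⟨hm.1, hy, hw⟩ hm.2.2]; ring).trans (one_mul _)
    have e4 : Real.exp (θ.n * (w - u)) = Real.exp (θ.n * w) * Real.exp (-(θ.n * u)) := by
      rw [← Real.exp_add]; congr 1; ring
    have e6 : Real.exp (θ'.m * Φ.U t x w) = Real.exp (θ'.m * (Φ.U t x u - θ.n / θ'.n * u))
        * Real.exp (θ'.m * (θ.n / θ'.n) * w) := by
      rw [← Real.exp_add, U_eq hθ hI hΦ h' hmap hm hw]; congr 1; ring
    rw [fluxDeriv, e1, e2, e3, e5, pd2_X_eq hθ hI hΦ h' hmap hm hw, pd2_U_eq hθ hI hΦ h' hmap hm hw,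
      newCoeff_eq hθ hI hΦ h' hmap hm hw, pd2_newCoeff_eq hθ hI hΦ h' hmap hm hw,
      ← X_eq_X_of_u hθ hI hΦ h' hmap hm hw, e4, e6] at h
    rw [fluxDeriv]
    linear_combination h
  -- One point with `h ≠ 0` identifies the fourth exponent. As the exponents do not depend on `x`,
  -- the splitting then applies also at the zeros of `h`.
  have hs : θ'.m * (θ.n / θ'.n) = θ.m := by
    obtain ⟨x, hx, hhx⟩ := hh
    obtain ⟨t, ht⟩ := hΦ.domain.nonemptyT
    obtain ⟨u, hu⟩ := hΦ.domain.nonemptyU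
    have hm : Φ.Mem t x u := ⟨ht, hx, hu⟩
    refine (coeff_of_four_exp hΦ.domain.openU hΦ.domain.nonemptyU hn (key hm)).1 hm0 hmn ?_
    have h1 := h'.f_ne _ ⟨t, x, u, hm, rfl⟩
    have h2 := (pd1_T_ne_zero hθ hI hΦ h' hmap hm).1
    have h3 := pd2_X_ne_zero hθ hI hΦ h' hmap hm
    have h4 := hθ.f_ne x (hΦ.domain.subset hx)
    simp [*]
  refine ⟨?_, fun {t x u} hm => ?_⟩
  · rw [← hs]; field_simp
  · have h := (coeff_of_four_exp hΦ.domain.openU hΦ.domain.nonemptyU hn (key hm)).2 hm0 hmn hs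
    have h1 := h'.f_ne _ ⟨t, x, u, hm, rfl⟩
    have h2 := (pd1_T_ne_zero hθ hI hΦ h' hmap hm).1
    have h3 := pd2_X_ne_zero hθ hI hΦ h' hmap hm
    simpa [h1, h2, h3] using h

end determining

/-! ### From generic equations to all equations by continuity. -/

/-- The function `e^{n u - ñ U}`. -/
noncomputable def expShift (θ θ' : Coeffs) (Φ : PointTransf) (p : ℝ × ℝ × ℝ) : ℝ :=
  Real.exp (θ.n * p.2.2 - θ'.n * Φ.U p.1 p.2.1 p.2.2)

/-- The new time is affine in `t`, the function `e^{n u - ñ U}` is affine in `P(x)`, and the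
exponents are proportional; all this in a form that is stable under pointwise limits. -/
structure AffineRelations (θ θ' : Coeffs) (P : ℝ → ℝ) (Φ : PointTransf) : Prop where
  time : ∀ p ∈ Φ.box, ∀ q ∈ Φ.box, ∀ r ∈ Φ.box,
    Φ.T p.1 p.2.1 p.2.2 * (q.1 - r.1) + Φ.T q.1 q.2.1 q.2.2 * (r.1 - p.1)
      + Φ.T r.1 r.2.1 r.2.2 * (p.1 - q.1) = 0
  shift : ∀ p ∈ Φ.box, ∀ q ∈ Φ.box, ∀ r ∈ Φ.box,
    expShift θ θ' Φ p * (P q.2.1 - P r.2.1) + expShift θ θ' Φ q * (P r.2.1 - P p.2.1)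
      + expShift θ θ' Φ r * (P p.2.1 - P q.2.1) = 0
  exponents : θ'.n * θ.m = θ.n * θ'.m

section generic

variable {I : Set ℝ} {θ θ' : Coeffs} {Φ : PointTransf} {P : ℝ → ℝ}

theorem factor_ne_zero (hθ : θ.InClass I) (hI : IsOpen I) (hΦ : Φ.IsPointTransf I)
    (h' : θ'.InClass Φ.imageX) (hmap : MapsEquation θ Φ θ') {t x u : ℝ} (hm : Φ.Mem t x u) :
    newCoeff θ' Φ t x u * Real.exp (θ'.n * Φ.U t x u) / (θ.g x * pd2 Φ.X t x u) ≠ 0 :=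
  div_ne_zero (mul_ne_zero (newCoeff_ne_zero h' hm) (Real.exp_ne_zero _))
    (mul_ne_zero (hθ.g_ne x (hΦ.domain.subset hm.2.1)) (pd2_X_ne_zero hθ hI hΦ h' hmap hm))

theorem factor_eq (hθ : θ.InClass I) (hI : IsOpen I) (hΦ : Φ.IsPointTransf I)
    (h' : θ'.InClass Φ.imageX) (hmap : MapsEquation θ Φ θ') {t x y u : ℝ} (hm : Φ.Mem t x u)
    (hy : y ∈ Φ.domX) :
    newCoeff θ' Φ t x u * Real.exp (θ'.n * Φ.U t x u) / (θ.g x * pd2 Φ.X t x u)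
      = newCoeff θ' Φ t y u * Real.exp (θ'.n * Φ.U t y u) / (θ.g y * pd2 Φ.X t y u) :=
  eq_of_hasDerivAt_zero hΦ.domain.openX hΦ.domain.connX
    (F := fun y => newCoeff θ' Φ t y u * Real.exp (θ'.n * Φ.U t y u) / (θ.g y * pd2 Φ.X t y u))
    (fun _ hz => hasDerivAt_factor hθ hI hΦ h' hmap ⟨hm.1, hz, hm.2.2⟩) hm.2.1 hy

/-- Constancy in `x` of the flux `g̃ e^{ñU} U_x/X_x` and of the factor `g̃ e^{2ñU}/(g X_x)` makes
their quotient `g U_x e^{-ñU}` constant; up to the factor `-ñ e^{nu}` this is `g` times the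
`x`-derivative of `e^{nu - ñU}`. -/
theorem affineRelations_of_generic (hθ : θ.InClass I) (hI : IsOpen I) (hΦ : Φ.IsPointTransf I)
    (h' : θ'.InClass Φ.imageX) (hmap : MapsEquation θ Φ θ')
    (hP : ∀ x ∈ I, HasDerivAt P (1 / θ.g x) x) (hm0 : θ.m ≠ 0)
    (hmn : θ.m ≠ θ.n) (hh : ∃ x ∈ Φ.domX, θ.h x ≠ 0) : AffineRelations θ θ' P Φ := by
  obtain ⟨hexp, hlow⟩ := generic_lower_order hθ hI hΦ h' hmap hm0 hmn hh
  have hB := hΦ.domain.isOpen_box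
  obtain ⟨t₀, ht₀⟩ := hΦ.domain.nonemptyT
  obtain ⟨x₀, hx₀⟩ := hΦ.domain.nonemptyX
  obtain ⟨u₀, hu₀⟩ := hΦ.domain.nonemptyU
  have hU : ∀ {t s x u : ℝ}, Φ.Mem t x u → s ∈ Φ.domT → Φ.U t x u = Φ.U s x u := by
    intro t s x u hm hs
    exact eq_of_hasDerivAt_zero hΦ.domain.openT hΦ.domain.connT (F := fun s => Φ.U s x u)
      (fun z hz => by
        have hz' : Φ.Mem z x u := ⟨hz, hm.2⟩
        have := SmoothOn.hasDerivAt_pd1 hΦ.smooth_U hB hz'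
        rwa [(hlow hz').1] at this) hm.1 hs
  -- All other quantities in the leading relation are independent of `t`, because `X_t = U_t = 0`.
  have hTt : ∀ t ∈ Φ.domT, pd1 Φ.T t x₀ u₀ = pd1 Φ.T t₀ x₀ u₀ := by
    intro t ht
    have hm : Φ.Mem t x₀ u₀ := ⟨ht, hx₀, hu₀⟩
    have hm₀ : Φ.Mem t₀ x₀ u₀ := ⟨ht₀, hx₀, hu₀⟩
    have l1 := leading_relation hθ hI hΦ h' hmap hm
    have l2 := leading_relation hθ hI hΦ h' hmap hm₀
    have e1 : Φ.X t x₀ u₀ = Φ.X t₀ x₀ u₀ := X_eq_X hθ hI hΦ h' hmap hm hm₀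
    have e2 : pd2 Φ.X t x₀ u₀ = pd2 Φ.X t₀ x₀ u₀ := by
      have : (fun y => Φ.X t y u₀) =ᶠ[𝓝 x₀] fun y => Φ.X t₀ y u₀ :=
        (hΦ.domain.openX.eventually_mem hx₀).mono fun y hy =>
          X_eq_X hθ hI hΦ h' hmap ⟨ht, hy, hu₀⟩ ⟨ht₀, hy, hu₀⟩
      exact this.deriv_eq
    have e3 : newCoeff θ' Φ t x₀ u₀ = newCoeff θ' Φ t₀ x₀ u₀ := by
      rw [newCoeff, newCoeff, e1, hU hm ht₀]
    rw [e1, e2, e3, l2] at l1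
    exact (mul_left_cancel₀ (mul_ne_zero (newCoeff_ne_zero h' hm₀)
      (hθ.f_ne _ (hΦ.domain.subset hx₀))) l1).symm
  have hT : ∀ p ∈ Φ.box, Φ.T p.1 p.2.1 p.2.2 = pd1 Φ.T t₀ x₀ u₀ * p.1
      + (Φ.T t₀ x₀ u₀ - pd1 Φ.T t₀ x₀ u₀ * t₀) := by
    rintro ⟨t, x, u⟩ hm
    have h1 := sub_eq_sub_of_hasDerivAt hΦ.domain.openT hΦ.domain.connT
      (F := fun s => Φ.T s x₀ u₀) (G := fun s => pd1 Φ.T t₀ x₀ u₀ * s)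
      (F' := fun _ => pd1 Φ.T t₀ x₀ u₀)
      (fun z hz => by
        have hz' : Φ.Mem z x₀ u₀ := ⟨hz, hx₀, hu₀⟩
        have := SmoothOn.hasDerivAt_pd1 hΦ.smooth_T hB hz'
        rwa [hTt z hz] at this)
      (fun z _ => by simpa using (hasDerivAt_id' z).const_mul (pd1 Φ.T t₀ x₀ u₀)) hm.1 ht₀
    have h2 := T_eq_T hθ hI hΦ h' hmap hm (y := x₀) (w := u₀) ⟨hm.1, hx₀, hu₀⟩
    simp only at h1 ⊢
    rw [h2]
    linear_combination h1
  have hm₀ : Φ.Mem t₀ x₀ u₀ := ⟨ht₀, hx₀, hu₀⟩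
  set a := -θ'.n * Real.exp (θ.n * u₀)
    * (newCoeff θ' Φ t₀ x₀ u₀ * pd2 Φ.U t₀ x₀ u₀ / pd2 Φ.X t₀ x₀ u₀)
    / (newCoeff θ' Φ t₀ x₀ u₀ * Real.exp (θ'.n * Φ.U t₀ x₀ u₀) / (θ.g x₀ * pd2 Φ.X t₀ x₀ u₀))
    with ha
  have hW : ∀ x ∈ Φ.domX, HasDerivAt (fun y => expShift θ θ' Φ (t₀, y, u₀)) (a * (1 / θ.g x)) x := by
    intro x hx
    have hm : Φ.Mem t₀ x u₀ := ⟨ht₀, hx, hu₀⟩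
    have hfl := eq_of_hasDerivAt_zero hΦ.domain.openX hΦ.domain.connX
      (F := fun y => newCoeff θ' Φ t₀ y u₀ * pd2 Φ.U t₀ y u₀ / pd2 Φ.X t₀ y u₀)
      (fun z hz => by
        have hz' : Φ.Mem t₀ z u₀ := ⟨ht₀, hz, hu₀⟩
        have := hasDerivAt_flux hθ hI hΦ h' hmap hz'
        rwa [(hlow hz').2] at this) hx₀ hx
    have hfa := factor_eq hθ hI hΦ h' hmap hm₀ hx
    rw [hfl, hfa] at ha
    have h2 := ((SmoothOn.hasDerivAt_pd2 hΦ.smooth_U hB hm).const_mul θ'.n).const_sub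
      (θ.n * u₀)
    refine h2.exp.congr_deriv ?_
    rw [ha, Real.exp_sub]
    have n1 := newCoeff_ne_zero h' hm
    have n2 := pd2_X_ne_zero hθ hI hΦ h' hmap hm
    have n3 := hθ.g_ne x (hΦ.domain.subset hx)
    have n4 := Real.exp_ne_zero (θ'.n * Φ.U t₀ x u₀)
    field_simp
  have hWW : ∀ p ∈ Φ.box, expShift θ θ' Φ p = a * P p.2.1
      + (expShift θ θ' Φ (t₀, x₀, u₀) - a * P x₀) := by
    rintro ⟨t, x, u⟩ hm
    have h1 := sub_eq_sub_of_hasDerivAt hΦ.domain.openX hΦ.domain.connX hW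
      (G := fun y => a * P y) (fun z hz => (hP z (hΦ.domain.subset hz)).const_mul a) hm.2.1 hx₀
    have h2 : expShift θ θ' Φ (t, x, u) = expShift θ θ' Φ (t₀, x, u₀) := by
      have := n_mul_sub hθ hI hΦ h' hmap hm hu₀
      simp only [expShift]
      rw [← hU (t := t) (s := t₀) ⟨hm.1, hm.2.1, hu₀⟩ ht₀]
      congr 1
      linear_combination this
    rw [h2]
    linear_combination h1
  refine ⟨fun p hp q hq r hr => ?_, fun p hp q hq r hr => ?_, hexp⟩
  · rw [hT p hp, hT q hq, hT r hr]; ring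
  · rw [hWW p hp, hWW q hq, hWW r hr]; ring

/-- Shifting `m` avoids the exceptional values `0` and `n`, shifting `h` avoids `h = 0` at a chosen
point, and `∫ dx/g` stays the same. -/
theorem isSmoothCurve_perturbation (hθ : θ.InClass I) :
    IsSmoothCurve I (fun ε => ⟨θ.f, θ.g, fun x => θ.h x + ε, θ.n, θ.m + ε⟩) where
  inClass _ :=
    ⟨hθ.smooth_f, hθ.smooth_g, hθ.smooth_h.add contDiffOn_const, hθ.f_ne, hθ.g_ne, hθ.n_ne⟩
  smooth_f := hθ.smooth_f.comp contDiff_snd.contDiffOn fun _ hp => hp.2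
  smooth_g := hθ.smooth_g.comp contDiff_snd.contDiffOn fun _ hp => hp.2
  smooth_h := (hθ.smooth_h.comp contDiff_snd.contDiffOn fun _ hp => hp.2).add
    contDiff_fst.contDiffOn
  smooth_n := contDiff_const
  smooth_m := contDiff_const.add contDiff_id

/-- The relations hold for all equations of the class, by continuity. -/
theorem IsGeneralizedExtendedEquiv.affineRelations {τ : TransfRule}
    (hτ : IsGeneralizedExtendedEquiv I τ) (hI : IsOpen I) (hθ : θ.InClass I)
    (hP : ∀ x ∈ I, HasDerivAt P (1 / θ.g x) x) :
    AffineRelations θ (τ.coeffs θ) P (τ.pt θ) := by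
  set c : ℝ → Coeffs := fun ε => ⟨θ.f, θ.g, fun x => θ.h x + ε, θ.n, θ.m + ε⟩ with hc
  have hcs : IsSmoothCurve I c := isSmoothCurve_perturbation hθ
  have hc0 : c 0 = θ := by simp [hc]
  have hpt := hτ.continuous_pt c hcs
  obtain ⟨-, hn, hm⟩ := hτ.continuous_coeffs c hcs
  rw [hc0] at hpt hn hm
  obtain ⟨t₀, ht₀⟩ := (hτ.isPointTransf θ hθ).domain.nonemptyT
  obtain ⟨x₀, hx₀⟩ := (hτ.isPointTransf θ hθ).domain.nonemptyX
  obtain ⟨u₀, hu₀⟩ := (hτ.isPointTransf θ hθ).domain.nonemptyU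
  -- A forbidden value `k = 0`, which occurs exactly when `θ` itself is exceptional in the
  -- corresponding respect, is removed by puncturing; any other is too far from `0`.
  have ne_of : ∀ k : ℝ, ∀ᶠ ε in 𝓝[≠] (0 : ℝ), ε ≠ k := by
    intro k
    by_cases hk : k = 0
    · subst hk; exact self_mem_nhdsWithin
    · exact (isOpen_ne.eventually_mem (Ne.symm hk)).filter_mono nhdsWithin_le_nhds
  have hgen : ∀ᶠ ε in 𝓝[≠] (0 : ℝ), AffineRelations (c ε) (τ.coeffs (c ε)) P (τ.pt (c ε)) := by
    filter_upwards [ne_of (-θ.m), ne_of (θ.n - θ.m), ne_of (-θ.h x₀),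
      (hpt t₀ x₀ u₀ ⟨ht₀, hx₀, hu₀⟩).1.filter_mono nhdsWithin_le_nhds] with ε h1 h2 h3 h4
    have hcl := hcs.inClass ε
    refine affineRelations_of_generic hcl hI (hτ.isPointTransf _ hcl) (hτ.inClass _ hcl)
      (hτ.mapsEquation _ hcl) hP ?_ ?_ ⟨x₀, h4.2.1, ?_⟩
    · intro h; apply h1; simp only [hc] at h; linarith
    · intro h; apply h2; simp only [hc] at h; linarith
    · intro h; apply h3; simp only [hc] at h; linarith
  have lim : ∀ {F : ℝ → ℝ} {a : ℝ}, Tendsto F (𝓝 0) (𝓝 a) →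
      (∀ᶠ ε in 𝓝[≠] (0 : ℝ), F ε = 0) → a = 0 := by
    intro F a h h0
    exact tendsto_nhds_unique (h.mono_left nhdsWithin_le_nhds)
      (tendsto_const_nhds.congr' (h0.mono fun _ h => h.symm))
  have mem : ∀ {p : ℝ × ℝ × ℝ}, p ∈ (τ.pt θ).box → ∀ᶠ ε in 𝓝[≠] (0 : ℝ), p ∈ (τ.pt (c ε)).box :=
    fun {p} hp => (hpt p.1 p.2.1 p.2.2 hp).1.filter_mono nhdsWithin_le_nhds
  have hW : ∀ {p : ℝ × ℝ × ℝ}, p ∈ (τ.pt θ).box →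
      Tendsto (fun ε => expShift (c ε) (τ.coeffs (c ε)) (τ.pt (c ε)) p) (𝓝 0)
        (𝓝 (expShift θ (τ.coeffs θ) (τ.pt θ) p)) := fun {p} hp =>
    (Real.continuous_exp.tendsto _).comp
      (tendsto_const_nhds.sub (hn.mul (hpt p.1 p.2.1 p.2.2 hp).2.2.2))
  refine ⟨fun p hp q hq r hr => ?_, fun p hp q hq r hr => ?_, ?_⟩
  · refine lim ((((hpt _ _ _ hp).2.1.mul_const (q.1 - r.1)).add
      ((hpt _ _ _ hq).2.1.mul_const (r.1 - p.1))).add ((hpt _ _ _ hr).2.1.mul_const (p.1 - q.1))) ?_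
    filter_upwards [hgen, mem hp, mem hq, mem hr] with ε h h1 h2 h3
    exact h.time p h1 q h2 r h3
  · refine lim ((((hW hp).mul_const (P q.2.1 - P r.2.1)).add
      ((hW hq).mul_const (P r.2.1 - P p.2.1))).add ((hW hr).mul_const (P p.2.1 - P q.2.1))) ?_
    filter_upwards [hgen, mem hp, mem hq, mem hr] with ε h h1 h2 h3
    exact h.shift p h1 q h2 r h3
  · have hlim : Tendsto (fun ε => (τ.coeffs (c ε)).n * (θ.m + ε) - θ.n * (τ.coeffs (c ε)).m) (𝓝 0)
        (𝓝 ((τ.coeffs θ).n * (θ.m + 0) - θ.n * (τ.coeffs θ).m)) :=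
      (hn.mul (tendsto_const_nhds.add tendsto_id)).sub (hm.const_mul _)
    have := lim hlim (hgen.mono fun ε h => sub_eq_zero.2 h.exponents)
    rw [add_zero] at this
    exact sub_eq_zero.1 this

/-- No genericity is available here, so `U_t = 0` and the vanishing of the flux derivative are
recovered from the affine relations. The function `Ψ = aP + d` equals `e^{nu - ñU}` and is therefore
positive. The leading relation then gives `f̃`, the constant factor `S` gives `g̃`, and the lower
order relation gives `h̃`. -/
theorem hasForm_of_affineRelations (hθ : θ.InClass I) (hI : IsOpen I) (hΦ : Φ.IsPointTransf I)
    (h' : θ'.InClass Φ.imageX) (hmap : MapsEquation θ Φ θ')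
    (hP : ∀ x ∈ I, HasDerivAt P (1 / θ.g x) x) (hA : AffineRelations θ θ' P Φ) :
    ∃ (δ : Fin 6 → ℝ) (φ : ℝ → ℝ), HasForm δ φ θ Φ θ' := by
  have hB := hΦ.domain.isOpen_box
  have hn := hθ.n_ne
  have hn' := h'.n_ne
  obtain ⟨t₀, ht₀⟩ := hΦ.domain.nonemptyT
  obtain ⟨x₀, hx₀⟩ := hΦ.domain.nonemptyX
  obtain ⟨u₀, hu₀⟩ := hΦ.domain.nonemptyU
  obtain ⟨t₁, ht₁, htne⟩ := exists_ne_mem hΦ.domain.openT ht₀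
  obtain ⟨x₁, hx₁, hxne⟩ := exists_ne_mem hΦ.domain.openX hx₀
  have hm₀ : Φ.Mem t₀ x₀ u₀ := ⟨ht₀, hx₀, hu₀⟩
  have hPinj : InjOn P Φ.domX := injOn_of_hasDerivAt_ne_zero hΦ.domain.connX
    (fun x hx => hP x (hΦ.domain.subset hx))
    (fun x hx => one_div_ne_zero (hθ.g_ne x (hΦ.domain.subset hx)))
  obtain ⟨κ, b, hT⟩ := exists_affine_of_three_point (ι := ℝ × ℝ × ℝ) (P := fun p => p.1) hA.time
    (x := (t₁, x₀, u₀)) (y := (t₀, x₀, u₀)) ⟨ht₁, hx₀, hu₀⟩ hm₀ htne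
  obtain ⟨a, d, hW⟩ := exists_affine_of_three_point (ι := ℝ × ℝ × ℝ) (P := fun p => P p.2.1)
    hA.shift (x := (t₀, x₁, u₀)) (y := (t₀, x₀, u₀)) ⟨ht₀, hx₁, hu₀⟩ hm₀
    (fun e => hxne (hPinj hx₁ hx₀ e))
  have hpos : ∀ x ∈ Φ.domX, 0 < a * P x + d := fun x hx => by
    have := hW (t₀, x, u₀) ⟨ht₀, hx, hu₀⟩
    simp only at this
    rw [← this]; exact Real.exp_pos _
  have hlog : ∀ {t x u : ℝ}, Φ.Mem t x u →
      Real.log (a * P x + d) = θ.n * u - θ'.n * Φ.U t x u := fun {t x u} hm => by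
    have := hW (t, x, u) hm
    simp only at this
    rw [← this, expShift, Real.log_exp]
  have hTt : ∀ x ∈ Φ.domX, pd1 Φ.T t₀ x u₀ = κ := fun x hx => by
    have e : (fun s => Φ.T s x u₀) =ᶠ[𝓝 t₀] fun s => κ * s + b :=
      (hΦ.domain.openT.eventually_mem ht₀).mono fun s hs => hT (s, x, u₀) ⟨hs, hx, hu₀⟩
    rw [pd1, e.deriv_eq]
    simp
  have hUt : ∀ x ∈ Φ.domX, pd1 Φ.U t₀ x u₀ = 0 := fun x hx => by
    have e : (fun s => Φ.U s x u₀) =ᶠ[𝓝 t₀] fun s => Φ.U t₀ x u₀ :=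
      (hΦ.domain.openT.eventually_mem ht₀).mono fun s hs => by
        have h1 := hlog (t := s) (x := x) (u := u₀) ⟨hs, hx, hu₀⟩
        rw [hlog (t := t₀) (x := x) (u := u₀) ⟨ht₀, hx, hu₀⟩] at h1
        exact mul_left_cancel₀ hn' (by linarith)
    rw [pd1, e.deriv_eq, deriv_const]
  obtain ⟨S, hS⟩ : ∃ S, S = newCoeff θ' Φ t₀ x₀ u₀ * Real.exp (θ'.n * Φ.U t₀ x₀ u₀)
    / (θ.g x₀ * pd2 Φ.X t₀ x₀ u₀) := ⟨_, rfl⟩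
  have hS0 : S ≠ 0 := hS ▸ factor_ne_zero hθ hI hΦ h' hmap hm₀
  have hfac : ∀ x ∈ Φ.domX, newCoeff θ' Φ t₀ x u₀ * Real.exp (θ'.n * Φ.U t₀ x u₀)
      = S * (θ.g x * pd2 Φ.X t₀ x u₀) := fun x hx => by
    have hm : Φ.Mem t₀ x u₀ := ⟨ht₀, hx, hu₀⟩
    rw [hS, factor_eq hθ hI hΦ h' hmap hm₀ hx, div_mul_cancel₀ _
      (mul_ne_zero (hθ.g_ne x (hΦ.domain.subset hx)) (pd2_X_ne_zero hθ hI hΦ h' hmap hm))]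
  have hexpW : ∀ x ∈ Φ.domX, Real.exp (θ.n * u₀) = (a * P x + d) * Real.exp (θ'.n * Φ.U t₀ x u₀) :=
    fun x hx => by
      have hm : Φ.Mem t₀ x u₀ := ⟨ht₀, hx, hu₀⟩
      rw [← Real.exp_log (hpos x hx), hlog hm, ← Real.exp_add]; congr 1; ring
  have hflux : ∀ x ∈ Φ.domX, fluxDeriv θ' Φ t₀ x u₀ = 0 := by
    intro x hx
    have h1 := hasDerivAt_flux hθ hI hΦ h' hmap (t := t₀) (x := x) (u := u₀) ⟨ht₀, hx, hu₀⟩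
    have e : (fun y => newCoeff θ' Φ t₀ y u₀ * pd2 Φ.U t₀ y u₀ / pd2 Φ.X t₀ y u₀) =ᶠ[𝓝 x]
        -- The flux is `S g U_x e^{-ñU}`, where `U_x = -a/(ñ g Ψ)` and `e^{-ñU} = Ψ e^{-n u₀}`.
        fun _ => -(S * a / (θ'.n * Real.exp (θ.n * u₀))) := by
      filter_upwards [hΦ.domain.openX.eventually_mem hx] with y hy
      have hm : Φ.Mem t₀ y u₀ := ⟨ht₀, hy, hu₀⟩
      have hg := hθ.g_ne y (hΦ.domain.subset hy)
      have d1 := (((hP y (hΦ.domain.subset hy)).const_mul a).add_const d).log (hpos y hy).ne'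
      have d2 := ((SmoothOn.hasDerivAt_pd2 hΦ.smooth_U hB hm).const_mul θ'.n).const_sub
        (θ.n * u₀)
      have e2 : (fun y => Real.log (a * P y + d)) =ᶠ[𝓝 y]
          fun y => θ.n * u₀ - θ'.n * Φ.U t₀ y u₀ :=
        (hΦ.domain.openX.eventually_mem hy).mono fun z hz => hlog ⟨ht₀, hz, hu₀⟩
      have d3 := (d2.congr_of_eventuallyEq e2).unique d1
      have hXx := pd2_X_ne_zero hθ hI hΦ h' hmap hm
      have hf := hfac y hy
      have hw := hexpW y hy
      have hp := (hpos y hy).ne'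
      have hE := Real.exp_ne_zero (θ'.n * Φ.U t₀ y u₀)
      rw [hw]
      generalize a * P y + d = w at *
      generalize Real.exp (θ'.n * Φ.U t₀ y u₀) = E at *
      rw [neg_eq_iff_eq_neg] at d3
      have hUx : pd2 Φ.U t₀ y u₀ = -(a / (θ'.n * θ.g y * w)) := by
        field_simp at d3 ⊢
        linear_combination d3
      rw [hUx]
      field_simp
      linear_combination -a * hf
    have h2 : HasDerivAt (fun _ : ℝ => -(S * a / (θ'.n * Real.exp (θ.n * u₀)))) 0 x :=
      hasDerivAt_const _ _
    exact h1.unique (h2.congr_of_eventuallyEq e)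
  have hδ3 : θ.n / θ'.n ≠ 0 := div_ne_zero hn hn'
  have hκ : κ ≠ 0 := hTt x₀ hx₀ ▸ (pd1_T_ne_zero hθ hI hΦ h' hmap hm₀).1
  have hpsi : ∀ {t x u : ℝ}, Φ.Mem t x u → psi
      ![S * Real.exp (-(2 * (θ.n * u₀))), κ, b, θ.n / θ'.n, a, d] θ.n P x
      = Φ.U t x u - θ.n / θ'.n * u := fun {t x u} hm => by
    simp only [psi, Matrix.cons_val]
    rw [abs_of_pos (hpos x hm.2.1), hlog hm]
    field_simp
    ring
  -- The value of `δ₀` comes from `g̃ e^{2ñU} = S g X_x` and `e^{ñU} = e^{n u₀}/Ψ`, which give `g̃ =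
  -- S e^{-2n u₀} X_x Ψ² g`.
  refine ⟨![S * Real.exp (-(2 * (θ.n * u₀))), κ, b, θ.n / θ'.n, a, d], fun y => Φ.X t₀ y u₀,
    ?_, ?_, ?_, ?_, ⟨P, ?_, ?_, ?_, ?_⟩, ?_, ?_⟩
  · simp [hS0, hκ, hn, hn', Real.exp_ne_zero]
  · simp only [Matrix.cons_val, ne_eq, Prod.mk.injEq, not_and]
    rintro rfl rfl
    simpa using hpos x₀ hx₀
  · exact hΦ.smooth_X.comp (contDiff_const.prodMk (contDiff_id.prodMk contDiff_const)).contDiffOn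
      fun x hx => ⟨ht₀, hx, hu₀⟩
  · exact fun x hx => pd2_X_ne_zero hθ hI hΦ h' hmap (t := t₀) (u := u₀) ⟨ht₀, hx, hu₀⟩
  · exact fun x hx => hP x (hΦ.domain.subset hx)
  · exact fun x hx => by simpa using (hpos x hx).ne'
  · intro t x u hm
    refine ⟨by simpa using hT (t, x, u) hm, X_eq_X hθ hI hΦ h' hmap hm ⟨ht₀, hm.2.1, hu₀⟩, ?_⟩
    rw [hpsi hm]; simp
  · intro x hx
    have hm : Φ.Mem t₀ x u₀ := ⟨ht₀, hx, hu₀⟩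
    rw [hpsi hm, ← show pd2 Φ.X t₀ x u₀ = deriv (fun y => Φ.X t₀ y u₀) x from rfl]
    simp only [Matrix.cons_val]
    rw [abs_of_pos (hpos x hx)]
    have hXx := pd2_X_ne_zero hθ hI hΦ h' hmap hm
    have hl := leading_relation hθ hI hΦ h' hmap hm
    have hlo := lower_order_relation hθ hI hΦ h' hmap hm
    rw [hUt x hx, hflux x hx, hTt x hx, zero_add, zero_add] at hlo
    rw [hTt x hx] at hl
    have hf := hfac x hx
    have hw := hexpW x hx
    have hp := (hpos x hx).ne'
    have hfx := hθ.f_ne x (hΦ.domain.subset hx)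
    have hgx := hθ.g_ne x (hΦ.domain.subset hx)
    have hE := Real.exp_ne_zero (θ'.n * Φ.U t₀ x u₀)
    have hE2 : Real.exp (-(2 * (θ.n * u₀)))
        = 1 / ((a * P x + d) * Real.exp (θ'.n * Φ.U t₀ x u₀)) ^ 2 := by
      rw [← hw, Real.exp_neg, two_mul, Real.exp_add, sq, one_div]
    have hM : Real.exp (-(θ.m / (θ.n / θ'.n)) * (Φ.U t₀ x u₀ - θ.n / θ'.n * u₀))
        = Real.exp (θ.m * u₀) / Real.exp (θ'.m * Φ.U t₀ x u₀) := by
      rw [← Real.exp_sub]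
      congr 1
      have := hA.exponents
      field_simp
      linear_combination -Φ.U t₀ x u₀ * this
    rw [hE2, hM]
    have hF := Real.exp_ne_zero (θ'.m * Φ.U t₀ x u₀)
    rw [newCoeff] at hf hl
    rw [hw] at hl
    generalize a * P x + d = w at *
    generalize Real.exp (θ'.n * Φ.U t₀ x u₀) = E at *
    generalize Real.exp (θ'.m * Φ.U t₀ x u₀) = E' at *
    generalize Real.exp (θ.m * u₀) = N' at *
    generalize θ'.f (Φ.X t₀ x u₀) = f' at *
    generalize θ'.g (Φ.X t₀ x u₀) = g' at *
    generalize θ'.h (Φ.X t₀ x u₀) = h'' at *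
    generalize pd2 Φ.X t₀ x u₀ = Xx at *
    have hg' : g' = S * (θ.g x * Xx) / E ^ 2 := by field_simp; linear_combination hf
    have hf' : f' = S * κ * θ.f x / (Xx * w * E ^ 2) := by
      rw [hg'] at hl
      field_simp at hl ⊢
      linear_combination hl
    have hh' : h'' = f' * (θ.n / θ'.n * θ.h x / θ.f x * N') / (κ * E') := by
      field_simp at hlo ⊢
      linear_combination -hlo
    refine ⟨?_, ?_, ?_⟩
    · rw [hf']; field_simp
    · rw [hg']; field_simp
    · rw [hh', hf']; field_simp
  · simp only [Matrix.cons_val]; field_simp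
  · have := hA.exponents
    simp only [Matrix.cons_val]
    field_simp
    linear_combination -this

end generic

theorem IsGeneralizedExtendedEquiv.hasForm {I : Set ℝ} (hI : IsOpen I) (hc : I.OrdConnected)
    (hne : I.Nonempty) {τ : TransfRule} (hτ : IsGeneralizedExtendedEquiv I τ) {θ : Coeffs}
    (hθ : θ.InClass I) :
    ∃ (δ : Fin 6 → ℝ) (φ : ℝ → ℝ), HasForm δ φ θ (τ.pt θ) (τ.coeffs θ) := by
  obtain ⟨x₀, hx₀⟩ := hne
  have hP := fun x (hx : x ∈ I) => hasDerivAt_integral hI hc hθ.continuousOn_inv_g hx₀ hx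
  exact hasForm_of_affineRelations hθ hI (hτ.isPointTransf θ hθ) (hτ.inClass θ hθ)
    (hτ.mapsEquation θ hθ) hP (hτ.affineRelations hI hθ hP)

/-! ### Smooth inverse of `φ` and smoothness of `ψ`. -/

section inverse

variable {S : Set ℝ} {φ : ℝ → ℝ}

theorem hasDerivAt_of_contDiffOn (hS : IsOpen S) (hφ : ContDiffOn ℝ ∞ φ S) {x : ℝ} (hx : x ∈ S) :
    HasDerivAt φ (deriv φ x) x :=
  ((hφ.contDiffAt (hS.mem_nhds hx)).differentiableAt (by simp)).hasDerivAt

theorem contDiffOn_deriv (hS : IsOpen S) (hφ : ContDiffOn ℝ ∞ φ S) : ContDiffOn ℝ ∞ (deriv φ) S :=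
  ((contDiffOn_infty_iff_deriv_of_isOpen hS).1 hφ).2

theorem injOn_of_deriv_ne_zero (hS : IsOpen S) (hc : S.OrdConnected) (hφ : ContDiffOn ℝ ∞ φ S)
    (hne : ∀ x ∈ S, deriv φ x ≠ 0) : InjOn φ S :=
  injOn_of_hasDerivAt_ne_zero hc (fun _ hx => hasDerivAt_of_contDiffOn hS hφ hx) hne

theorem invFunOn_apply (hS : IsOpen S) (hc : S.OrdConnected) (hφ : ContDiffOn ℝ ∞ φ S)
    (hne : ∀ x ∈ S, deriv φ x ≠ 0) {x : ℝ} (hx : x ∈ S) : Function.invFunOn φ S (φ x) = x :=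
  (injOn_of_deriv_ne_zero hS hc hφ hne).leftInvOn_invFunOn hx

theorem hasDerivAt_invFunOn (hS : IsOpen S) (hc : S.OrdConnected) (hφ : ContDiffOn ℝ ∞ φ S)
    (hne : ∀ x ∈ S, deriv φ x ≠ 0) {x : ℝ} (hx : x ∈ S) :
    HasDerivAt (Function.invFunOn φ S) (deriv φ x)⁻¹ (φ x) :=
  (HasStrictDerivAt.to_local_left_inverse
    ((hφ.contDiffAt (hS.mem_nhds hx)).hasStrictDerivAt (by simp)) (hne x hx)
    ((hS.eventually_mem hx).mono fun _ hy => invFunOn_apply hS hc hφ hne hy)).hasDerivAt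

theorem contDiffAt_invFunOn (hS : IsOpen S) (hc : S.OrdConnected) (hφ : ContDiffOn ℝ ∞ φ S)
    (hne : ∀ x ∈ S, deriv φ x ≠ 0) {x : ℝ} (hx : x ∈ S) :
    ContDiffAt ℝ ∞ (Function.invFunOn φ S) (φ x) := by
  have hcd := hφ.contDiffAt (hS.mem_nhds hx)
  have hd := (hasDerivAt_of_contDiffOn hS hφ hx).hasFDerivAt_equiv (hne x hx)
  have h1 := hcd.to_localInverse hd (by simp)
  refine h1.congr_of_eventuallyEq ?_
  exact (hcd.hasStrictFDerivAt' hd (by simp)).localInverse_unique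
    ((hS.eventually_mem hx).mono fun _ hy => invFunOn_apply hS hc hφ hne hy)

/-- The new coefficients are prescribed at `φ(x)` by expressions in `x`; composition with the
inverse of `φ` shows that they are smooth in `x̃`. -/
theorem contDiffOn_image (hS : IsOpen S) (hc : S.OrdConnected) (hφ : ContDiffOn ℝ ∞ φ S)
    (hne : ∀ x ∈ S, deriv φ x ≠ 0) {k k' : ℝ → ℝ} (hk : ContDiffOn ℝ ∞ k' S)
    (h : ∀ x ∈ S, k (φ x) = k' x) : ContDiffOn ℝ ∞ k (φ '' S) := by
  have h1 : ContDiffOn ℝ ∞ (fun y => k' (Function.invFunOn φ S y)) (φ '' S) := by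
    refine hk.comp (t := S) ?_ ?_
    · rintro _ ⟨x, hx, rfl⟩
      exact (contDiffAt_invFunOn hS hc hφ hne hx).contDiffWithinAt
    · rintro _ ⟨x, hx, rfl⟩
      rw [invFunOn_apply hS hc hφ hne hx]; exact hx
  refine h1.congr ?_
  rintro _ ⟨x, hx, rfl⟩
  rw [invFunOn_apply hS hc hφ hne hx, h x hx]

end inverse

theorem contDiffOn_antiderivative {S : Set ℝ} (hS : IsOpen S) {P p : ℝ → ℝ}
    (hp : ContDiffOn ℝ ∞ p S) (hP : ∀ x ∈ S, HasDerivAt P (p x) x) : ContDiffOn ℝ ∞ P S :=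
  (contDiffOn_infty_iff_deriv_of_isOpen hS).2
    ⟨fun x hx => (hP x hx).differentiableAt.differentiableWithinAt,
      hp.congr fun x hx => (hP x hx).deriv⟩

theorem hasDerivAt_psi {δ : Fin 6 → ℝ} {n g x : ℝ} {P : ℝ → ℝ} (hP : HasDerivAt P (1 / g) x)
    (hne : δ 4 * P x + δ 5 ≠ 0) :
    HasDerivAt (psi δ n P) (-(δ 3 / n) * (δ 4 * (1 / g) / (δ 4 * P x + δ 5))) x := by
  have h := (((hP.const_mul (δ 4)).add_const (δ 5)).log hne).const_mul (-(δ 3 / n))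
  have e : psi δ n P = fun y => -(δ 3 / n) * Real.log (δ 4 * P y + δ 5) := by
    funext y; rw [psi, Real.log_abs]
  rwa [e]

theorem contDiffOn_psi {δ : Fin 6 → ℝ} {n : ℝ} {P : ℝ → ℝ} {S : Set ℝ}
    (hP : ContDiffOn ℝ ∞ P S) (hne : ∀ x ∈ S, δ 4 * P x + δ 5 ≠ 0) :
    ContDiffOn ℝ ∞ (psi δ n P) S := by
  have e : psi δ n P = fun y => -(δ 3 / n) * Real.log (δ 4 * P y + δ 5) := by
    funext y; rw [psi, Real.log_abs]
  rw [e]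
  exact contDiffOn_const.mul (((contDiffOn_const.mul hP).add contDiffOn_const).log hne)

/-! ### The explicit formulas map equations of the class to equations of the class. -/

section form

variable {I : Set ℝ} {δ : Fin 6 → ℝ} {φ : ℝ → ℝ} {θ θ' : Coeffs} {Φ : PointTransf}

theorem HasForm.ne_zero (h : HasForm δ φ θ Φ θ') : δ 0 ≠ 0 ∧ δ 1 ≠ 0 ∧ δ 3 ≠ 0 := by
  have := h.const_ne
  exact ⟨left_ne_zero_of_mul (left_ne_zero_of_mul this),
    right_ne_zero_of_mul (left_ne_zero_of_mul this), right_ne_zero_of_mul this⟩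

theorem HasForm.imageX_eq (h : HasForm δ φ θ Φ θ') (hΦ : Φ.HasDomainIn I) :
    Φ.imageX = φ '' Φ.domX := by
  obtain ⟨P, -, -, h3, -⟩ := h.formulas
  ext y
  constructor
  · rintro ⟨t, x, u, hm, rfl⟩
    exact ⟨x, hm.2.1, (h3 t x u hm).2.1.symm⟩
  · rintro ⟨x, hx, rfl⟩
    obtain ⟨t, ht⟩ := hΦ.nonemptyT
    obtain ⟨u, hu⟩ := hΦ.nonemptyU
    exact ⟨t, x, u, ⟨ht, hx, hu⟩, (h3 t x u ⟨ht, hx, hu⟩).2.1⟩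

theorem Coeffs.InClass.contDiffOn_inv_g {S : Set ℝ} (hθ : θ.InClass I) (hS : S ⊆ I) :
    ContDiffOn ℝ ∞ (fun x => 1 / θ.g x) S :=
  contDiffOn_const.div (hθ.smooth_g.mono hS) fun x hx => hθ.g_ne x (hS hx)

theorem HasForm.isPointTransf (h : HasForm δ φ θ Φ θ') (hθ : θ.InClass I)
    (hΦ : Φ.HasDomainIn I) : Φ.IsPointTransf I := by
  obtain ⟨h0, h1, h3⟩ := h.ne_zero
  obtain ⟨P, hP, hne, hf, -⟩ := h.formulas
  have hPs : ContDiffOn ℝ ∞ P Φ.domX :=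
    contDiffOn_antiderivative hΦ.openX (hθ.contDiffOn_inv_g hΦ.subset) hP
  have hx2 : ContDiffOn ℝ ∞ (fun p : ℝ × ℝ × ℝ => p.2.1) (Φ.domT ×ˢ Φ.domX ×ˢ Φ.domU) :=
    (contDiff_fst.comp contDiff_snd).contDiffOn
  have hmt : MapsTo (fun p : ℝ × ℝ × ℝ => p.2.1) (Φ.domT ×ˢ Φ.domX ×ˢ Φ.domU) Φ.domX :=
    fun p hp => hp.2.1
  refine ⟨hΦ, ?_, ?_, ?_, ?_⟩
  · exact ((contDiffOn_const.mul contDiff_fst.contDiffOn).add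
      (contDiffOn_const (c := δ 2))).congr fun p hp => (hf p.1 p.2.1 p.2.2 hp).1
  · exact (h.smooth_phi.comp hx2 hmt).congr fun p hp => (hf p.1 p.2.1 p.2.2 hp).2.1
  · exact ((contDiffOn_const.mul (contDiff_snd.comp contDiff_snd).contDiffOn).add
      ((contDiffOn_psi hPs hne).comp hx2 hmt)).congr fun p hp => (hf p.1 p.2.1 p.2.2 hp).2.2
  · intro t x u hm
    have hT1 : pd1 Φ.T t x u = δ 1 := by
      have e : (fun s => Φ.T s x u) =ᶠ[𝓝 t] fun s => δ 1 * s + δ 2 :=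
        (hΦ.openT.eventually_mem hm.1).mono fun s hs => (hf s x u ⟨hs, hm.2⟩).1
      rw [pd1, e.deriv_eq]; simp
    have hT2 : pd2 Φ.T t x u = 0 := by
      have e : (fun y => Φ.T t y u) =ᶠ[𝓝 x] fun _ => δ 1 * t + δ 2 :=
        (hΦ.openX.eventually_mem hm.2.1).mono fun y hy => (hf t y u ⟨hm.1, hy, hm.2.2⟩).1
      rw [pd2, e.deriv_eq, deriv_const]
    have hT3 : pd3 Φ.T t x u = 0 := by
      have e : (fun w => Φ.T t x w) =ᶠ[𝓝 u] fun _ => δ 1 * t + δ 2 :=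
        (hΦ.openU.eventually_mem hm.2.2).mono fun w hw => (hf t x w ⟨hm.1, hm.2.1, hw⟩).1
      rw [pd3, e.deriv_eq, deriv_const]
    have hX2 : pd2 Φ.X t x u = deriv φ x := by
      have e : (fun y => Φ.X t y u) =ᶠ[𝓝 x] φ :=
        (hΦ.openX.eventually_mem hm.2.1).mono fun y hy => (hf t y u ⟨hm.1, hy, hm.2.2⟩).2.1
      rw [pd2, e.deriv_eq]
    have hX3 : pd3 Φ.X t x u = 0 := by
      have e : (fun w => Φ.X t x w) =ᶠ[𝓝 u] fun _ => φ x :=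
        (hΦ.openU.eventually_mem hm.2.2).mono fun w hw => (hf t x w ⟨hm.1, hm.2.1, hw⟩).2.1
      rw [pd3, e.deriv_eq, deriv_const]
    have hU3 : pd3 Φ.U t x u = δ 3 := by
      have e : (fun w => Φ.U t x w) =ᶠ[𝓝 u] fun w => δ 3 * w + psi δ θ.n P x :=
        (hΦ.openU.eventually_mem hm.2.2).mono fun w hw => (hf t x w ⟨hm.1, hm.2.1, hw⟩).2.2
      rw [pd3, e.deriv_eq]; simp
    rw [Φ.det_jacobian, hT1, hT2, hT3, hX2, hX3, hU3]
    simpa using ⟨⟨h1, h.deriv_phi_ne x hm.2.1⟩, h3⟩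

theorem HasForm.inClass (h : HasForm δ φ θ Φ θ') (hθ : θ.InClass I)
    (hΦ : Φ.HasDomainIn I) : θ'.InClass Φ.imageX := by
  obtain ⟨h0, h1, h3⟩ := h.ne_zero
  have him := h.imageX_eq hΦ
  obtain ⟨P, hP, hne, -, hf⟩ := h.formulas
  have hPs : ContDiffOn ℝ ∞ P Φ.domX :=
    contDiffOn_antiderivative hΦ.openX (hθ.contDiffOn_inv_g hΦ.subset) hP
  have hΨ : ContDiffOn ℝ ∞ (fun x => δ 4 * P x + δ 5) Φ.domX :=
    (contDiffOn_const.mul hPs).add contDiffOn_const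
  have hΨa := hΨ.abs hne
  have hd := contDiffOn_deriv hΦ.openX h.smooth_phi
  have himg := fun {k k' : ℝ → ℝ} (hk : ContDiffOn ℝ ∞ k' Φ.domX) (e : ∀ x ∈ Φ.domX, _) =>
    contDiffOn_image (k := k) hΦ.openX hΦ.connX h.smooth_phi h.deriv_phi_ne hk e
  rw [him]
  refine ⟨?_, ?_, ?_, ?_, ?_, ?_⟩
  · exact himg (((contDiffOn_const.div hd h.deriv_phi_ne).mul hΨa).mul
      (hθ.smooth_f.mono hΦ.subset)) fun x hx => (hf x hx).1
  · exact himg (((contDiffOn_const.mul hd).mul (hΨ.pow 2)).mul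
      (hθ.smooth_g.mono hΦ.subset)) fun x hx => (hf x hx).2.1
  · exact himg ((((contDiffOn_const.div hd h.deriv_phi_ne).mul
      (contDiffOn_const.mul (contDiffOn_psi hPs hne)).exp).mul hΨa).mul
      (hθ.smooth_h.mono hΦ.subset)) fun x hx => (hf x hx).2.2
  · rintro _ ⟨x, hx, rfl⟩
    rw [(hf x hx).1]
    exact mul_ne_zero (mul_ne_zero (div_ne_zero (mul_ne_zero h0 h1) (h.deriv_phi_ne x hx))
      (abs_ne_zero.2 (hne x hx))) (hθ.f_ne x (hΦ.subset hx))
  · rintro _ ⟨x, hx, rfl⟩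
    rw [(hf x hx).2.1]
    exact mul_ne_zero (mul_ne_zero (mul_ne_zero h0 (h.deriv_phi_ne x hx))
      (pow_ne_zero 2 (hne x hx))) (hθ.g_ne x (hΦ.subset hx))
  · rw [h.n_eq]; exact div_ne_zero hθ.n_ne h3

/-- With `A = g e^{nv} v_x` the old flux, the new one is `±δ₀δ₃ (Ψ A - (δ₄/n) e^{nv})`. Since `Ψ_x =
δ₄/g`, the term `Ψ_x A = δ₄ e^{nv} v_x` cancels the derivative of the second summand, leaving `δ₀δ₃
|Ψ| A_x`. The whole residual is thus a multiple of the old one. -/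
theorem HasForm.mapsEquation (h : HasForm δ φ θ Φ θ') (hθ : θ.InClass I) (hI : IsOpen I)
    (hΦ : Φ.HasDomainIn I) : MapsEquation θ Φ θ' := by
  obtain ⟨h0, h1, h3⟩ := h.ne_zero
  obtain ⟨P, hP, hne, hf, hco⟩ := h.formulas
  have hn := hθ.n_ne
  intro v hv t x hm _ hres
  have hB := hΦ.isOpen_box
  have hx : x ∈ Φ.domX := hm.2.1
  have hcv := hv.continuous
  have hv1 : ∀ s y, HasDerivAt (fun s => v s y) (Dt v s y) s := fun s y =>
    ((hv.comp (contDiff_id.prodMk contDiff_const)).differentiable (by simp) s).hasDerivAt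
  have hvx : ∀ s, ContDiff ℝ ∞ (fun y => v s y) := fun s =>
    hv.comp (contDiff_const.prodMk contDiff_id)
  have hv2 : ∀ s y, HasDerivAt (fun y => v s y) (Dx v s y) y := fun s y =>
    ((hvx s).differentiable (by simp) y).hasDerivAt
  have hvxx : Differentiable ℝ (fun y => Dx v t y) :=
    ((contDiff_infty_iff_deriv.1 (hvx t)).2).differentiable (by simp)
  have ev1 : ∀ {s y}, Φ.Mem s y (v s y) → ∀ᶠ r in 𝓝 s, Φ.Mem r y (v r y) := fun {s y} hs =>
    (continuous_id.prodMk (continuous_const.prodMk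
      (hcv.comp (continuous_id.prodMk continuous_const)))).continuousAt.eventually_mem
      (hB.mem_nhds hs)
  have ev2 : ∀ {s y}, Φ.Mem s y (v s y) → ∀ᶠ r in 𝓝 y, Φ.Mem s r (v s r) := fun {s y} hs =>
    (continuous_const.prodMk (continuous_id.prodMk
      (hcv.comp (continuous_const.prodMk continuous_id)))).continuousAt.eventually_mem
      (hB.mem_nhds hs)
  have eT1 : ∀ {s y}, Φ.Mem s y (v s y) → Dt (fun s y => Φ.T s y (v s y)) s y = δ 1 := by
    intro s y hs
    have e : (fun r => Φ.T r y (v r y)) =ᶠ[𝓝 s] fun r => δ 1 * r + δ 2 :=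
      (ev1 hs).mono fun r hr => (hf _ _ _ hr).1
    rw [Dt, e.deriv_eq]; simp
  have eT2 : ∀ {s y}, Φ.Mem s y (v s y) → Dx (fun s y => Φ.T s y (v s y)) s y = 0 := by
    intro s y hs
    have e : (fun r => Φ.T s r (v s r)) =ᶠ[𝓝 y] fun r => δ 1 * s + δ 2 :=
      (ev2 hs).mono fun r hr => (hf _ _ _ hr).1
    rw [Dx, e.deriv_eq, deriv_const]
  have eX1 : ∀ {s y}, Φ.Mem s y (v s y) → Dt (fun s y => Φ.X s y (v s y)) s y = 0 := by
    intro s y hs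
    have e : (fun r => Φ.X r y (v r y)) =ᶠ[𝓝 s] fun r => φ y :=
      (ev1 hs).mono fun r hr => (hf _ _ _ hr).2.1
    rw [Dt, e.deriv_eq, deriv_const]
  have eX2 : ∀ {s y}, Φ.Mem s y (v s y) → Dx (fun s y => Φ.X s y (v s y)) s y = deriv φ y := by
    intro s y hs
    have e : (fun r => Φ.X s r (v s r)) =ᶠ[𝓝 y] φ :=
      (ev2 hs).mono fun r hr => (hf _ _ _ hr).2.1
    rw [Dx, e.deriv_eq]
  have eU1 : ∀ {s y}, Φ.Mem s y (v s y) →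
      Dt (fun s y => Φ.U s y (v s y)) s y = δ 3 * Dt v s y := by
    intro s y hs
    have e : (fun r => Φ.U r y (v r y)) =ᶠ[𝓝 s] fun r => δ 3 * v r y + psi δ θ.n P y :=
      (ev1 hs).mono fun r hr => (hf _ _ _ hr).2.2
    rw [Dt, e.deriv_eq]
    exact (((hv1 s y).const_mul (δ 3)).add_const _).deriv
  have eU2 : ∀ {s y}, Φ.Mem s y (v s y) → Dx (fun s y => Φ.U s y (v s y)) s y
      = δ 3 * Dx v s y + -(δ 3 / θ.n) * (δ 4 * (1 / θ.g y) / (δ 4 * P y + δ 5)) := by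
    intro s y hs
    have e : (fun r => Φ.U s r (v s r)) =ᶠ[𝓝 y] fun r => δ 3 * v s r + psi δ θ.n P r :=
      (ev2 hs).mono fun r hr => (hf _ _ _ hr).2.2
    rw [Dx, e.deriv_eq]
    exact (((hv2 s y).const_mul (δ 3)).add
      (hasDerivAt_psi (hP y hs.2.1) (hne y hs.2.1))).deriv
  set That := fun s y => Φ.T s y (v s y) with hThat
  set Xhat := fun s y => Φ.X s y (v s y) with hXhat
  set Uhat := fun s y => Φ.U s y (v s y) with hUhat
  set A : ℝ → ℝ := fun y => θ.g y * Real.exp (θ.n * v t y) * Dx v t y with hA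
  -- `σ` is the locally constant sign of `Ψ`; it replaces the absolute value before differentiation.
  obtain ⟨σ, hσ⟩ : ∃ σ : ℝ, ∀ᶠ y in 𝓝 x, |δ 4 * P y + δ 5| = σ * (δ 4 * P y + δ 5) := by
    have hc : ContinuousAt (fun y => δ 4 * P y + δ 5) x :=
      (continuousAt_const.mul (hP x hx).continuousAt).add continuousAt_const
    rcases lt_or_gt_of_ne (hne x hx) with hlt | hgt
    · exact ⟨-1, (hc.eventually_lt_const hlt).mono fun y hy => by rw [abs_of_neg hy]; ring⟩
    · exact ⟨1, (hc.eventually_const_lt hgt).mono fun y hy => by rw [abs_of_pos hy]; ring⟩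
  have hflux : (fun y => θ'.g (Xhat t y) * Real.exp (θ'.n * Uhat t y) * newDx That Xhat Uhat t y)
      =ᶠ[𝓝 x] fun y => δ 0 * δ 3 * σ * ((δ 4 * P y + δ 5) * A y
        - δ 4 / θ.n * Real.exp (θ.n * v t y)) := by
    filter_upwards [ev2 hm, hσ] with y hy hσy
    have hX : Xhat t y = φ y := (hf _ _ _ hy).2.1
    have hU : Uhat t y = δ 3 * v t y + psi δ θ.n P y := (hf _ _ _ hy).2.2
    have hy' := hne y hy.2.1
    have hE : Real.exp (θ'.n * (δ 3 * v t y + psi δ θ.n P y))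
        = Real.exp (θ.n * v t y) / |δ 4 * P y + δ 5| := by
      have : θ'.n * (δ 3 * v t y + psi δ θ.n P y)
          = θ.n * v t y - Real.log |δ 4 * P y + δ 5| := by
        rw [h.n_eq, psi]; field_simp; ring
      rw [this, Real.exp_sub, Real.exp_log (abs_pos.2 hy')]
    rw [newDx, jacTX, eT1 hy, eT2 hy, eX1 hy, eX2 hy, eU2 hy, hX, hU, hE, (hco y hy.2.1).2.1, hA]
    have hφ := h.deriv_phi_ne y hy.2.1
    have hg := hθ.g_ne y (hΦ.subset hy.2.1)
    have hsq : (δ 4 * P y + δ 5) ^ 2 = |δ 4 * P y + δ 5| ^ 2 := (sq_abs _).symm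
    rw [hsq]
    have habs := abs_ne_zero.2 hy'
    rw [hσy] at habs ⊢
    generalize δ 4 * P y + δ 5 = w at *
    have hσ0 := left_ne_zero_of_mul habs
    field_simp
    ring
  have hAd : HasDerivAt A (deriv A x) x := by
    refine DifferentiableAt.hasDerivAt ?_
    have hg : DifferentiableAt ℝ θ.g x :=
      (hasDerivAt_of_contDiffOn hI hθ.smooth_g (hΦ.subset hx)).differentiableAt
    exact (hg.mul ((hv2 t x).differentiableAt.const_mul θ.n).exp).mul (hvxx x)
  have hD := ((((((hP x hx).const_mul (δ 4)).add_const (δ 5)).fun_mul hAd).fun_sub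
    ((((hv2 t x).const_mul θ.n).exp).const_mul (δ 4 / θ.n))).const_mul (δ 0 * δ 3 * σ)).deriv
  have hDx : Dx (fun s y => θ'.g (Xhat s y) * Real.exp (θ'.n * Uhat s y)
      * newDx That Xhat Uhat s y) t x = δ 0 * δ 3 * |δ 4 * P x + δ 5| * deriv A x := by
    refine (hflux.deriv_eq.trans hD).trans ?_
    rw [hσ.self_of_nhds, hA]
    have hg := hθ.g_ne x (hΦ.subset hx)
    field_simp
    ring
  have hX : Xhat t x = φ x := (hf _ _ _ hm).2.1
  have hU : Uhat t x = δ 3 * v t x + psi δ θ.n P x := (hf _ _ _ hm).2.2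
  have hφ := h.deriv_phi_ne x hx
  have hE : Real.exp (-(θ.m / δ 3) * psi δ θ.n P x)
      * Real.exp (θ'.m * (δ 3 * v t x + psi δ θ.n P x)) = Real.exp (θ.m * v t x) := by
    rw [← Real.exp_add, h.m_eq]; congr 1; field_simp; ring
  have hA' : Dx (fun s y => θ.g y * Real.exp (θ.n * v s y) * Dx v s y) t x = deriv A x := rfl
  rw [Coeffs.residual, hA'] at hres
  rw [Coeffs.newResidual, newDt, newDx, hDx, jacTX, eT1 hm, eT2 hm, eX1 hm, eX2 hm, eU1 hm,
    hX, hU, (hco x hx).1, (hco x hx).2.2]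
  generalize |δ 4 * P x + δ 5| = w at *
  generalize Real.exp (-(θ.m / δ 3) * psi δ θ.n P x) = E1 at *
  generalize Real.exp (θ'.m * (δ 3 * v t x + psi δ θ.n P x)) = E2 at *
  rw [← hE] at hres
  simp only [zero_mul, mul_zero, sub_zero]
  field_simp
  linear_combination δ 0 * w * δ 3 * hres

end form

/-! ### Rules defined on the whole class by the explicit formulas. -/

/-- A continuous function without zeros on an interval has a constant sign there. -/
theorem mul_pos_of_continuousOn_ne_zero {S : Set ℝ} (hc : S.OrdConnected) {k : ℝ → ℝ}
    (hk : ContinuousOn k S) (hne : ∀ x ∈ S, k x ≠ 0) {x y : ℝ} (hx : x ∈ S) (hy : y ∈ S) :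
    0 < k x * k y := by
  by_contra hcon
  have hsub := hc.uIcc_subset hx hy
  have h0 : (0 : ℝ) ∈ uIcc (k x) (k y) := by
    rcases mul_nonpos_iff.1 (not_lt.1 hcon) with ⟨h1, h2⟩ | ⟨h1, h2⟩
    · exact mem_uIcc.2 (Or.inr ⟨h2, h1⟩)
    · exact mem_uIcc.2 (Or.inl ⟨h1, h2⟩)
  obtain ⟨z, hz, e⟩ := intermediate_value_uIcc (hk.mono hsub) h0
  exact hne z (hsub hz) e

/-- The function `Ψ = κ(n) + δ₄ ∫ dx / g`, the integral being taken from `x₀`. -/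
noncomputable def factorFrom (d : ℝ) (x₀ : ℝ) (κ : ℝ → ℝ) (θ : Coeffs) (x : ℝ) : ℝ :=
  κ θ.n + d * ∫ z in x₀..x, 1 / θ.g z

theorem factorFrom_self {d x₀ : ℝ} {κ : ℝ → ℝ} {θ : Coeffs} : factorFrom d x₀ κ θ x₀ = κ θ.n := by
  simp [factorFrom]

/-- The part of `S` on which `Ψ` has the same sign as at `x₀`. -/
def factorDomain (S : Set ℝ) (d x₀ : ℝ) (κ : ℝ → ℝ) (θ : Coeffs) : Set ℝ :=
  {x ∈ S | 0 < factorFrom d x₀ κ θ x * κ θ.n}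

section factor

variable {I S : Set ℝ} {d x₀ : ℝ} {κ : ℝ → ℝ} {θ : Coeffs}

theorem hasDerivAt_factorFrom (hI : IsOpen I) (hc : I.OrdConnected) (hθ : θ.InClass I)
    (hx₀ : x₀ ∈ I) {x : ℝ} (hx : x ∈ I) :
    HasDerivAt (factorFrom d x₀ κ θ) (d * (1 / θ.g x)) x :=
  ((hasDerivAt_integral hI hc hθ.continuousOn_inv_g hx₀ hx).const_mul d).const_add (κ θ.n)

theorem isOpen_factorDomain (hI : IsOpen I) (hc : I.OrdConnected) (hθ : θ.InClass I)
    (hx₀ : x₀ ∈ I) (hS : IsOpen S) (hSI : S ⊆ I) : IsOpen (factorDomain S d x₀ κ θ) := by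
  have hcont : ContinuousOn (fun x => factorFrom d x₀ κ θ x * κ θ.n) S := fun x hx =>
    ((hasDerivAt_factorFrom hI hc hθ hx₀ (hSI hx)).continuousAt.mul
      continuousAt_const).continuousWithinAt
  exact hcont.isOpen_inter_preimage hS isOpen_Ioi

/-- As `1/g` has no zeros, `∫ dx/g` is monotone, so `Ψ` at an intermediate point lies between its
values at the ends and shares their sign. -/
theorem ordConnected_factorDomain (hI : IsOpen I) (hc : I.OrdConnected) (hθ : θ.InClass I)
    (hx₀ : x₀ ∈ I) (hS : S.OrdConnected) (hSI : S ⊆ I) :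
    (factorDomain S d x₀ κ θ).OrdConnected := by
  refine ⟨fun a ha b hb z hz => ⟨hS.out ha.1 hb.1 hz, ?_⟩⟩
  have hsub : Icc a b ⊆ I := (hS.out ha.1 hb.1).trans hSI
  have hd := fun x (hx : x ∈ I) => hasDerivAt_integral hI hc hθ.continuousOn_inv_g hx₀ hx
  have hinj : InjOn (fun x => ∫ z in x₀..x, 1 / θ.g z) (Icc a b) :=
    (injOn_of_hasDerivAt_ne_zero hc hd fun x hx => one_div_ne_zero (hθ.g_ne x hx)).mono hsub
  have hcont : ContinuousOn (fun x => ∫ z in x₀..x, 1 / θ.g z) (Icc a b) := fun x hx =>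
    (hd x (hsub hx)).continuousAt.continuousWithinAt
  have hab : a ≤ b := hz.1.trans hz.2
  have ha2 := ha.2
  have hb2 := hb.2
  simp only [factorFrom] at ha2 hb2 ⊢
  rcases hcont.strictMonoOn_of_injOn_Icc' hab hinj with hm | hm
  · have h1 := hm.monotoneOn (left_mem_Icc.2 hab) hz hz.1
    have h2 := hm.monotoneOn hz (right_mem_Icc.2 hab) hz.2
    rcases le_total 0 (d * κ θ.n) with h | h <;> nlinarith
  · have h1 := hm.antitoneOn (left_mem_Icc.2 hab) hz hz.1
    have h2 := hm.antitoneOn hz (right_mem_Icc.2 hab) hz.2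
    rcases le_total 0 (d * κ θ.n) with h | h <;> nlinarith

theorem tendsto_factorFrom (hc : I.OrdConnected) {c : ℝ → Coeffs} (hcs : IsSmoothCurve I c)
    (hκ : Continuous κ) (hx₀ : x₀ ∈ I) {x : ℝ} (hx : x ∈ I) :
    Tendsto (fun ε => factorFrom d x₀ κ (c ε) x) (𝓝 0) (𝓝 (factorFrom d x₀ κ (c 0) x)) := by
  have hle : x₀ ⊓ x ≤ x₀ ⊔ x := inf_le_sup
  have hsub : uIcc x₀ x ⊆ I := hc.uIcc_subset hx₀ hx
  have hg : ContinuousOn (fun p : ℝ × ℝ => 1 / (c p.1).g p.2) (univ ×ˢ I) :=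
    continuousOn_const.div hcs.smooth_g.continuousOn fun p hp => (hcs.inClass p.1).g_ne p.2 hp.2
  -- Clamping `z` to the segment between `x₀` and `x` leaves the integral unchanged and makes the
  -- integrand continuous on the whole plane, as `g` is controlled only over `I`.
  have hF : Continuous (Function.uncurry fun ε z : ℝ =>
      1 / (c ε).g (projIcc (x₀ ⊓ x) (x₀ ⊔ x) hle z)) := by
    refine hg.comp_continuous (f := fun p : ℝ × ℝ =>
      (p.1, (projIcc (x₀ ⊓ x) (x₀ ⊔ x) hle p.2 : ℝ))) ?_ ?_
    · exact continuous_fst.prodMk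
        (continuous_subtype_val.comp (continuous_projIcc.comp continuous_snd))
    · exact fun p => ⟨mem_univ _, hsub (projIcc (x₀ ⊓ x) (x₀ ⊔ x) hle p.2).2⟩
  have hcont := intervalIntegral.continuous_parametric_intervalIntegral_of_continuous
    (μ := MeasureTheory.volume) (a₀ := x₀) hF (s := fun _ => x) continuous_const
  have e : ∀ ε, ∫ z in x₀..x, 1 / (c ε).g z
      = ∫ z in x₀..x, 1 / (c ε).g (projIcc (x₀ ⊓ x) (x₀ ⊔ x) hle z) := fun ε =>
    intervalIntegral.integral_congr fun z hz => by
      simp only [projIcc_of_mem hle hz]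
  have : Continuous (fun ε => factorFrom d x₀ κ (c ε) x) := by
    simp only [factorFrom, e]
    exact (hκ.comp hcs.smooth_n.continuous).add (continuous_const.mul hcont)
  exact this.tendsto 0

end factor

/-- The transformation rule given by the explicit formulas with `Ψ = κ(n) + δ₄ ∫ dx / g`. -/
noncomputable def explicitRule (Φ₀ : PointTransf) (δ : Fin 6 → ℝ) (φ : ℝ → ℝ) (x₀ : ℝ)
    (κ : ℝ → ℝ) : TransfRule where
  pt η :=
    { domT := Φ₀.domT
      domX := factorDomain Φ₀.domX (δ 4) x₀ κ η
      domU := Φ₀.domU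
      T := fun t _ _ => δ 1 * t + δ 2
      X := fun _ x _ => φ x
      U := fun _ x u => δ 3 * u + -(δ 3 / η.n) * Real.log |factorFrom (δ 4) x₀ κ η x| }
  coeffs η :=
    { f := fun y => (fun x => δ 0 * δ 1 / deriv φ x * |factorFrom (δ 4) x₀ κ η x| * η.f x)
        (Function.invFunOn φ Φ₀.domX y)
      g := fun y => (fun x => δ 0 * deriv φ x * factorFrom (δ 4) x₀ κ η x ^ 2 * η.g x)
        (Function.invFunOn φ Φ₀.domX y)
      h := fun y => (fun x => δ 0 * δ 3 / deriv φ x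
        * Real.exp (-(η.m / δ 3) * (-(δ 3 / η.n) * Real.log |factorFrom (δ 4) x₀ κ η x|))
        * |factorFrom (δ 4) x₀ κ η x| * η.h x) (Function.invFunOn φ Φ₀.domX y)
      n := η.n / δ 3
      m := η.m / δ 3 }

section rule

variable {I : Set ℝ} {Φ₀ : PointTransf} {δ : Fin 6 → ℝ} {φ κ : ℝ → ℝ} {x₀ : ℝ} {η : Coeffs}

theorem mem_factorDomain_self (hx₀ : x₀ ∈ Φ₀.domX) (hκ : κ η.n ≠ 0) :
    x₀ ∈ factorDomain Φ₀.domX (δ 4) x₀ κ η :=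
  ⟨hx₀, by rw [factorFrom_self]; exact mul_self_pos.2 hκ⟩

theorem hasDomainIn_explicitRule (hI : IsOpen I) (hc : I.OrdConnected) (hΦ : Φ₀.HasDomainIn I)
    (hx₀ : x₀ ∈ Φ₀.domX) (hη : η.InClass I) (hκ : κ η.n ≠ 0) :
    ((explicitRule Φ₀ δ φ x₀ κ).pt η).HasDomainIn I where
  openT := hΦ.openT
  openX := isOpen_factorDomain hI hc hη (hΦ.subset hx₀) hΦ.openX hΦ.subset
  openU := hΦ.openU
  connT := hΦ.connT
  connX := ordConnected_factorDomain hI hc hη (hΦ.subset hx₀) hΦ.connX hΦ.subset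
  connU := hΦ.connU
  nonemptyT := hΦ.nonemptyT
  nonemptyX := ⟨x₀, mem_factorDomain_self hx₀ hκ⟩
  nonemptyU := hΦ.nonemptyU
  subset := fun _ hx => hΦ.subset hx.1

theorem factorFrom_ne_zero {S : Set ℝ} {d x : ℝ} (hx : x ∈ factorDomain S d x₀ κ η) :
    factorFrom d x₀ κ η x ≠ 0 :=
  left_ne_zero_of_mul hx.2.ne'

/-- The antiderivative may be shifted by any `P₀` at the cost of `δ₅ = κ(n) - δ₄ P₀`. This freedom
later allows a prescribed `δ₅` to be kept for all equations. -/
theorem hasForm_explicitRule (hI : IsOpen I) (hc : I.OrdConnected) (hΦ : Φ₀.HasDomainIn I)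
    (hδ : δ 0 * δ 1 * δ 3 ≠ 0) (hφ : ContDiffOn ℝ ∞ φ Φ₀.domX)
    (hne : ∀ x ∈ Φ₀.domX, deriv φ x ≠ 0) (hx₀ : x₀ ∈ Φ₀.domX) (hη : η.InClass I)
    (hκ : κ η.n ≠ 0) (P₀ : ℝ) :
    HasForm (Function.update δ 5 (κ η.n - δ 4 * P₀)) φ η ((explicitRule Φ₀ δ φ x₀ κ).pt η)
      ((explicitRule Φ₀ δ φ x₀ κ).coeffs η) := by
  have u0 : Function.update δ 5 (κ η.n - δ 4 * P₀) 0 = δ 0 :=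
    Function.update_of_ne (by decide) _ _
  have u1 : Function.update δ 5 (κ η.n - δ 4 * P₀) 1 = δ 1 :=
    Function.update_of_ne (by decide) _ _
  have u2 : Function.update δ 5 (κ η.n - δ 4 * P₀) 2 = δ 2 :=
    Function.update_of_ne (by decide) _ _
  have u3 : Function.update δ 5 (κ η.n - δ 4 * P₀) 3 = δ 3 :=
    Function.update_of_ne (by decide) _ _
  have u4 : Function.update δ 5 (κ η.n - δ 4 * P₀) 4 = δ 4 :=
    Function.update_of_ne (by decide) _ _
  have u5 : Function.update δ 5 (κ η.n - δ 4 * P₀) 5 = κ η.n - δ 4 * P₀ :=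
    Function.update_self _ _ _
  have hΨ : ∀ x, δ 4 * (P₀ + ∫ z in x₀..x, 1 / η.g z) + (κ η.n - δ 4 * P₀)
      = factorFrom (δ 4) x₀ κ η x := fun x => by rw [factorFrom]; ring
  have hinv := fun {x} (hx : x ∈ Φ₀.domX) => invFunOn_apply hΦ.openX hΦ.connX hφ hne hx
  refine ⟨by rwa [u0, u1, u3], ?_, hφ.mono fun x hx => hx.1, fun x hx => hne x hx.1,
    ⟨fun x => P₀ + ∫ z in x₀..x, 1 / η.g z, ?_, ?_, ?_, ?_⟩, by rw [u3]; rfl, by rw [u3]; rfl⟩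
  · rw [u4, u5]
    intro h
    rw [Prod.mk.injEq] at h
    rw [h.1, zero_mul, sub_zero] at h
    exact hκ h.2
  · exact fun x hx => (hasDerivAt_integral hI hc hη.continuousOn_inv_g (hΦ.subset hx₀)
      (hΦ.subset hx.1)).const_add P₀
  · intro x hx
    rw [u4, u5, hΨ]
    exact factorFrom_ne_zero hx
  · intro t x u _
    refine ⟨by rw [u1, u2]; rfl, rfl, ?_⟩
    rw [psi, u3, u4, u5, hΨ]; rfl
  · intro x hx
    rw [psi, u0, u1, u3, u4, u5, hΨ]
    simp only [explicitRule, hinv hx.1]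
    exact ⟨trivial, trivial, trivial⟩

theorem isGeneralizedExtendedEquiv_explicitRule (hI : IsOpen I) (hc : I.OrdConnected)
    (hΦ : Φ₀.HasDomainIn I) (hδ : δ 0 * δ 1 * δ 3 ≠ 0) (hφ : ContDiffOn ℝ ∞ φ Φ₀.domX)
    (hne : ∀ x ∈ Φ₀.domX, deriv φ x ≠ 0) (hx₀ : x₀ ∈ Φ₀.domX) (hκ : ∀ n, κ n ≠ 0)
    (hκc : Continuous κ) :
    IsGeneralizedExtendedEquiv I (explicitRule Φ₀ δ φ x₀ κ) := by
  have hform := fun (η : Coeffs) (hη : η.InClass I) =>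
    hasForm_explicitRule hI hc hΦ hδ hφ hne hx₀ hη (hκ η.n) 0
  have hdom := fun (η : Coeffs) (hη : η.InClass I) =>
    hasDomainIn_explicitRule (δ := δ) (φ := φ) hI hc hΦ hx₀ hη (hκ η.n)
  have hinv := fun {x} (hx : x ∈ Φ₀.domX) => invFunOn_apply hΦ.openX hΦ.connX hφ hne hx
  have h0 : δ 0 ≠ 0 := left_ne_zero_of_mul (left_ne_zero_of_mul hδ)
  have h1 : δ 1 ≠ 0 := right_ne_zero_of_mul (left_ne_zero_of_mul hδ)
  have h3 : δ 3 ≠ 0 := right_ne_zero_of_mul hδ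
  refine ⟨fun η hη => (hform η hη).isPointTransf hη (hdom η hη),
    fun η hη => (hform η hη).inClass hη (hdom η hη),
    fun η hη => (hform η hη).mapsEquation hη hI (hdom η hη), ?_, ?_, ?_⟩
  · intro η₁ η₂ hη₁ hη₂ him hag
    rw [(hform η₁ hη₁).imageX_eq (hdom η₁ hη₁)] at him hag
    rw [(hform η₂ hη₂).imageX_eq (hdom η₂ hη₂)] at him
    have hD : factorDomain Φ₀.domX (δ 4) x₀ κ η₁ = factorDomain Φ₀.domX (δ 4) x₀ κ η₂ :=
      (injOn_of_deriv_ne_zero hΦ.openX hΦ.connX hφ hne).image_eq_image_iff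
        (fun _ hx => hx.1) (fun _ hx => hx.1) |>.1 him
    obtain ⟨hf, hg, hh, hn, hm⟩ := hag
    have en : η₁.n = η₂.n := (div_left_inj' h3).1 hn
    have em : η₁.m = η₂.m := (div_left_inj' h3).1 hm
    have hg2 : ∀ x ∈ factorDomain Φ₀.domX (δ 4) x₀ κ η₁,
        factorFrom (δ 4) x₀ κ η₁ x ^ 2 * η₁.g x = factorFrom (δ 4) x₀ κ η₂ x ^ 2 * η₂.g x := by
      intro x hx
      have := hg ⟨x, hx, rfl⟩
      simp only [explicitRule, hinv hx.1] at this
      apply mul_left_cancel₀ (mul_ne_zero h0 (hne x hx.1))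
      linear_combination this
    -- The derivative `(1/Ψ)_x = -δ₄/(Ψ² g)` depends only on `Ψ² g`, which `g̃` determines, and
    -- `Ψ(x₀) = κ(n)` is determined by `ñ`. Hence `Ψ` is recovered from the new coefficients.
    have hΨ : ∀ x ∈ factorDomain Φ₀.domX (δ 4) x₀ κ η₁,
        factorFrom (δ 4) x₀ κ η₁ x = factorFrom (δ 4) x₀ κ η₂ x := by
      intro x hx
      have hmem := mem_factorDomain_self (δ := δ) (η := η₁) hx₀ (hκ η₁.n)
      have := sub_eq_sub_of_hasDerivAt (hdom η₁ hη₁).openX (hdom η₁ hη₁).connX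
        (F := fun x => (factorFrom (δ 4) x₀ κ η₁ x)⁻¹)
        (G := fun x => (factorFrom (δ 4) x₀ κ η₂ x)⁻¹)
        (F' := fun x => -(δ 4 * (1 / η₁.g x)) / factorFrom (δ 4) x₀ κ η₁ x ^ 2)
        (fun z hz => (hasDerivAt_factorFrom hI hc hη₁ (hΦ.subset hx₀)
          (hΦ.subset hz.1)).fun_inv (factorFrom_ne_zero hz))
        (fun z hz => by
          have hz2 : z ∈ factorDomain Φ₀.domX (δ 4) x₀ κ η₂ := hD ▸ hz
          refine ((hasDerivAt_factorFrom hI hc hη₂ (hΦ.subset hx₀)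
            (hΦ.subset hz.1)).fun_inv (factorFrom_ne_zero hz2)).congr_deriv ?_
          have a1 := hη₁.g_ne z (hΦ.subset hz.1)
          have a2 := hη₂.g_ne z (hΦ.subset hz.1)
          have a3 := factorFrom_ne_zero hz
          have a4 := factorFrom_ne_zero hz2
          have a5 := hg2 z hz
          field_simp
          linear_combination -δ 4 * a5) hx hmem
      simp only [factorFrom_self, en, sub_self] at this
      exact inv_injective (sub_eq_zero.1 this)
    refine ⟨hD, fun x hx => ?_, fun x hx => ?_, fun x hx => ?_, en, em⟩
    · have := hf ⟨x, hx, rfl⟩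
      simp only [explicitRule, hinv hx.1, hΨ x hx] at this
      refine mul_left_cancel₀ (mul_ne_zero (div_ne_zero (mul_ne_zero h0 h1) (hne x hx.1))
        (abs_ne_zero.2 ?_)) this
      rw [← hΨ x hx]; exact factorFrom_ne_zero hx
    · have := hg2 x hx
      rw [hΨ x hx] at this
      refine mul_left_cancel₀ (pow_ne_zero 2 ?_) this
      rw [← hΨ x hx]; exact factorFrom_ne_zero hx
    · have := hh ⟨x, hx, rfl⟩
      simp only [explicitRule, hinv hx.1, hΨ x hx, en, em] at this
      refine mul_left_cancel₀ (mul_ne_zero (mul_ne_zero (div_ne_zero (mul_ne_zero h0 h3)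
        (hne x hx.1)) (Real.exp_ne_zero _)) (abs_ne_zero.2 ?_)) this
      rw [← hΨ x hx]; exact factorFrom_ne_zero hx
  · intro c hcs t x u hm
    have hx : x ∈ factorDomain Φ₀.domX (δ 4) x₀ κ (c 0) := hm.2.1
    have hΨ := tendsto_factorFrom (d := δ 4) hc hcs hκc (hΦ.subset hx₀) (hΦ.subset hx.1)
    have hn : Tendsto (fun ε => (c ε).n) (𝓝 0) (𝓝 (c 0).n) := hcs.smooth_n.continuous.tendsto 0
    refine ⟨?_, tendsto_const_nhds, tendsto_const_nhds, ?_⟩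
    · filter_upwards [(hΨ.mul ((hκc.tendsto _).comp hn)).eventually_const_lt hx.2] with ε hε
      exact ⟨hm.1, ⟨hx.1, hε⟩, hm.2.2⟩
    · exact tendsto_const_nhds.add ((tendsto_const_nhds.div hn (hcs.inClass 0).n_ne).neg.mul
        (hΨ.abs.log (abs_ne_zero.2 (factorFrom_ne_zero hx))))
  · intro c hcs
    have hn : Tendsto (fun ε => (c ε).n) (𝓝 0) (𝓝 (c 0).n) := hcs.smooth_n.continuous.tendsto 0
    have hm : Tendsto (fun ε => (c ε).m) (𝓝 0) (𝓝 (c 0).m) := hcs.smooth_m.continuous.tendsto 0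
    refine ⟨?_, hn.div_const _, hm.div_const _⟩
    intro y hy
    rw [(hform _ (hcs.inClass 0)).imageX_eq (hdom _ (hcs.inClass 0))] at hy
    obtain ⟨x, hx, rfl⟩ := hy
    have hx' : x ∈ factorDomain Φ₀.domX (δ 4) x₀ κ (c 0) := hx
    have hxI := hΦ.subset hx'.1
    have hΨ := tendsto_factorFrom (d := δ 4) hc hcs hκc (hΦ.subset hx₀) hxI
    have hcomp : ∀ {k : ℝ → ℝ → ℝ}, ContDiffOn ℝ ∞ (fun p : ℝ × ℝ => k p.1 p.2) (univ ×ˢ I) →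
        Tendsto (fun ε => k ε x) (𝓝 0) (𝓝 (k 0 x)) := fun {k} hk =>
      (hk.continuousOn.comp_continuous (continuous_id.prodMk continuous_const)
        fun _ => ⟨mem_univ _, hxI⟩).tendsto 0
    have hfx := hcomp (k := fun ε => (c ε).f) hcs.smooth_f
    have hgx := hcomp (k := fun ε => (c ε).g) hcs.smooth_g
    have hhx := hcomp (k := fun ε => (c ε).h) hcs.smooth_h
    have hlog := hΨ.abs.log (abs_ne_zero.2 (factorFrom_ne_zero hx'))
    refine ⟨?_, ?_, ?_, ?_⟩
    · filter_upwards [(hΨ.mul ((hκc.tendsto _).comp hn)).eventually_const_lt hx'.2] with ε hε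
      rw [(hform _ (hcs.inClass ε)).imageX_eq (hdom _ (hcs.inClass ε))]
      exact ⟨x, ⟨hx'.1, hε⟩, rfl⟩
    · simp only [explicitRule, hinv hx'.1]
      exact (hΨ.abs.const_mul _).mul hfx
    · simp only [explicitRule, hinv hx'.1]
      exact ((hΨ.pow 2).const_mul _).mul hgx
    · simp only [explicitRule, hinv hx'.1]
      exact (((((hm.div_const _).neg.mul ((tendsto_const_nhds.div hn (hcs.inClass 0).n_ne).neg.mul
        hlog)).rexp).const_mul _).mul hΨ.abs).mul hhx

end rule

/-! ### Realisation by rules, the usual group, composition and inversion. -/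

section closure

variable {I : Set ℝ} {δ : Fin 6 → ℝ} {φ : ℝ → ℝ} {θ θ' : Coeffs} {Φ : PointTransf}

theorem HasForm.exists_rule (h : HasForm δ φ θ Φ θ') (hI : IsOpen I) (hc : I.OrdConnected)
    (hθ : θ.InClass I) (hΦ : Φ.HasDomainIn I) :
    ∃ τ : TransfRule, IsGeneralizedExtendedEquiv I τ ∧ τ.Induces θ Φ θ' ∧
      ∀ η : Coeffs, η.InClass I → HasForm δ φ η (τ.pt η) (τ.coeffs η) := by
  obtain ⟨P, hP, hne, hf, hco⟩ := h.formulas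
  obtain ⟨x₀, hx₀⟩ := hΦ.nonemptyX
  -- For every equation `Ψ` starts at `x₀` from the value it has for `θ`; giving all antiderivatives
  -- the value `P x₀` at `x₀` then keeps `δ₅` unchanged.
  obtain ⟨κ, hκ⟩ : ∃ κ : ℝ → ℝ, κ = fun _ => δ 4 * P x₀ + δ 5 := ⟨_, rfl⟩
  have hκ0 : ∀ n, κ n ≠ 0 := fun n => by rw [hκ]; exact hne x₀ hx₀
  have hκc : Continuous κ := by rw [hκ]; exact continuous_const
  have hΨ : ∀ x ∈ Φ.domX, factorFrom (δ 4) x₀ κ θ x = δ 4 * P x + δ 5 := by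
    intro x hx
    have := sub_eq_sub_of_hasDerivAt hΦ.openX hΦ.connX (F' := fun x => δ 4 * (1 / θ.g x))
      (fun z hz => hasDerivAt_factorFrom (d := δ 4) (κ := κ) hI hc hθ (hΦ.subset hx₀)
        (hΦ.subset hz))
      (fun z hz => ((hP z hz).const_mul (δ 4)).add_const (δ 5)) hx hx₀
    rw [factorFrom_self] at this
    rw [hκ] at this ⊢
    linear_combination this
  have hmem : ∀ x ∈ Φ.domX, x ∈ factorDomain Φ.domX (δ 4) x₀ κ θ := by
    intro x hx
    refine ⟨hx, ?_⟩
    rw [hΨ x hx, hκ]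
    exact mul_pos_of_continuousOn_ne_zero hΦ.connX (k := fun x => δ 4 * P x + δ 5)
      (fun z hz => (((hP z hz).const_mul (δ 4)).add_const
        (δ 5)).continuousAt.continuousWithinAt) hne hx hx₀
  have hinv := fun {x} (hx : x ∈ Φ.domX) =>
    invFunOn_apply hΦ.openX hΦ.connX h.smooth_phi h.deriv_phi_ne hx
  refine ⟨explicitRule Φ δ φ x₀ κ, isGeneralizedExtendedEquiv_explicitRule hI hc hΦ h.const_ne
    h.smooth_phi h.deriv_phi_ne hx₀ hκ0 hκc, ⟨?_, ?_⟩, fun η hη => ?_⟩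
  · intro t x u hm
    obtain ⟨e1, e2, e3⟩ := hf t x u hm
    refine ⟨⟨hm.1, hmem x hm.2.1, hm.2.2⟩, e1.symm, e2.symm, ?_⟩
    rw [e3, psi, ← hΨ x hm.2.1]
    rfl
  · rw [h.imageX_eq hΦ]
    refine ⟨?_, ?_, ?_, h.n_eq.symm, h.m_eq.symm⟩ <;> rintro _ ⟨x, hx, rfl⟩
    · simp only [explicitRule, hinv hx, hΨ x hx, (hco x hx).1]
    · simp only [explicitRule, hinv hx, hΨ x hx, (hco x hx).2.1]
    · simp only [explicitRule, hinv hx, hΨ x hx, (hco x hx).2.2, psi]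
  · have := hasForm_explicitRule hI hc hΦ h.const_ne h.smooth_phi h.deriv_phi_ne hx₀ hη
      (hκ0 η.n) (P x₀)
    have e : κ η.n - δ 4 * P x₀ = δ 5 := by rw [hκ]; ring
    rwa [e, Function.update_eq_self] at this

theorem HasForm.exists_usual_rule (h : HasForm δ φ θ Φ θ') (hI : IsOpen I) (hc : I.OrdConnected)
    (hθ : θ.InClass I) (hΦ : Φ.HasDomainIn I) (h4 : δ 4 = 0) :
    ∃ τ : TransfRule, IsUsualEquiv I τ ∧ τ.Induces θ Φ θ' ∧
      ∀ η : Coeffs, η.InClass I →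
        ∃ d : ℝ, HasForm (Function.update δ 5 d) φ η (τ.pt η) (τ.coeffs η) := by
  obtain ⟨P, hP, hne, hf, hco⟩ := h.formulas
  obtain ⟨x₀, hx₀⟩ := hΦ.nonemptyX
  have hn := hθ.n_ne
  have h5 : δ 5 ≠ 0 := by simpa [h4] using hne x₀ hx₀
  -- With `κ(n) = |δ₅|^{n/θ.n}` the shift `-(δ₃/n) ln κ(n)` of `u` is the same for all equations, as
  -- a usual transformation requires. The sign of `δ₅` is immaterial, since only `|Ψ|` and `Ψ²`
  -- enter the formulas.
  obtain ⟨κ, hκ⟩ : ∃ κ : ℝ → ℝ, κ = fun n => Real.exp (n / θ.n * Real.log |δ 5|) := ⟨_, rfl⟩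
  have hκpos : ∀ n, 0 < κ n := fun n => by rw [hκ]; exact Real.exp_pos _
  have hκc : Continuous κ := by rw [hκ]; fun_prop
  have hκθ : κ θ.n = |δ 5| := by
    rw [hκ]; simp only [div_self hn, one_mul]; exact Real.exp_log (abs_pos.2 h5)
  have hΨ : ∀ η x, factorFrom (δ 4) x₀ κ η x = κ η.n := fun η x => by
    rw [factorFrom, h4, zero_mul, add_zero]
  have hdom : ∀ η, factorDomain Φ.domX (δ 4) x₀ κ η = Φ.domX := fun η => by
    ext x
    refine ⟨fun hx => hx.1, fun hx => ⟨hx, ?_⟩⟩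
    rw [hΨ]
    exact mul_pos (hκpos _) (hκpos _)
  have hU : ∀ η : Coeffs, η.InClass I →
      -(δ 3 / η.n) * Real.log |κ η.n| = -(δ 3 / θ.n) * Real.log |δ 5| := fun η hη => by
    have := hη.n_ne
    rw [abs_of_pos (hκpos _), hκ, Real.log_exp]
    field_simp
  have hinv := fun {x} (hx : x ∈ Φ.domX) =>
    invFunOn_apply hΦ.openX hΦ.connX h.smooth_phi h.deriv_phi_ne hx
  have hΨP : ∀ x, δ 4 * P x + δ 5 = δ 5 := fun x => by rw [h4, zero_mul, zero_add]
  refine ⟨explicitRule Φ δ φ x₀ κ, ⟨isGeneralizedExtendedEquiv_explicitRule hI hc hΦ h.const_ne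
    h.smooth_phi h.deriv_phi_ne hx₀ (fun n => (hκpos n).ne') hκc, ?_, ?_⟩, ⟨?_, ?_⟩,
    fun η hη => ⟨_, hasForm_explicitRule hI hc hΦ h.const_ne h.smooth_phi h.deriv_phi_ne hx₀ hη
      (hκpos η.n).ne' 0⟩⟩
  · intro η₁ η₂ hη₁ hη₂ t x u hm
    have hx : x ∈ Φ.domX := hdom η₁ ▸ hm.2.1
    refine ⟨⟨hm.1, ?_, hm.2.2⟩, rfl, rfl, ?_⟩
    · show x ∈ factorDomain Φ.domX (δ 4) x₀ κ η₂
      rwa [hdom]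
    · simp only [explicitRule, hΨ, hU η₁ hη₁, hU η₂ hη₂]
  · refine ⟨fun _ x _ f _ _ n _ => δ 0 * δ 1 / deriv φ x * |κ n| * f,
      fun _ x _ _ g _ n _ => δ 0 * deriv φ x * κ n ^ 2 * g,
      fun _ x _ _ _ h n m => δ 0 * δ 3 / deriv φ x
        * Real.exp (-(m / δ 3) * (-(δ 3 / n) * Real.log |κ n|)) * |κ n| * h,
      fun _ _ _ _ _ _ n _ => n / δ 3, fun _ _ _ _ _ _ _ m => m / δ 3, ?_⟩
    intro η _ t x u hm
    have hx : x ∈ Φ.domX := hdom η ▸ hm.2.1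
    simp only [explicitRule, hinv hx, hΨ, and_self]
  · intro t x u hm
    obtain ⟨e1, e2, e3⟩ := hf t x u hm
    refine ⟨⟨hm.1, ?_, hm.2.2⟩, e1.symm, e2.symm, ?_⟩
    · show x ∈ factorDomain Φ.domX (δ 4) x₀ κ θ
      rw [hdom]
      exact hm.2.1
    · rw [e3, psi, hΨP, ← hU θ hθ]
      simp only [explicitRule, hΨ]
  · rw [h.imageX_eq hΦ]
    refine ⟨?_, ?_, ?_, h.n_eq.symm, h.m_eq.symm⟩ <;> rintro _ ⟨x, hx, rfl⟩
    · simp only [explicitRule, hinv hx, hΨ, (hco x hx).1, hκθ, hΨP, abs_abs]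
    · simp only [explicitRule, hinv hx, hΨ, (hco x hx).2.1, hκθ, hΨP, sq_abs]
    · simp only [explicitRule, hinv hx, hΨ, (hco x hx).2.2, hκθ, hΨP, abs_abs, psi]

/-- The variables change in the same way for the test equations with `g = 1` and `g = e^x`, so the
corresponding `|Ψ|` coincide. One is the modulus of an affine function of `x`, the other of
`e^{-x}`, hence both are constant and so is `ψ`. -/
theorem IsUsualEquiv.hasForm {τ : TransfRule} (hτ : IsUsualEquiv I τ) (hI : IsOpen I)
    (hc : I.OrdConnected) (hne : I.Nonempty) (hθ : θ.InClass I) :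
    ∃ (δ : Fin 6 → ℝ) (φ : ℝ → ℝ), δ 4 = 0 ∧ HasForm δ φ θ (τ.pt θ) (τ.coeffs θ) := by
  have hgen := hτ.toIsGeneralizedExtendedEquiv
  have hA : (⟨fun _ => 1, fun _ => 1, fun _ => 0, 1, 0⟩ : Coeffs).InClass I :=
    ⟨contDiffOn_const, contDiffOn_const, contDiffOn_const, fun _ _ => one_ne_zero,
      fun _ _ => one_ne_zero, one_ne_zero⟩
  have hB : (⟨fun _ => 1, Real.exp, fun _ => 0, 1, 0⟩ : Coeffs).InClass I :=
    ⟨contDiffOn_const, Real.contDiff_exp.contDiffOn, contDiffOn_const, fun _ _ => one_ne_zero,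
      fun _ _ => Real.exp_ne_zero _, one_ne_zero⟩
  obtain ⟨α, φα, hα⟩ := hgen.hasForm hI hc hne hA
  obtain ⟨β, φβ, hβ⟩ := hgen.hasForm hI hc hne hB
  obtain ⟨δ, φ, hδ⟩ := hgen.hasForm hI hc hne hθ
  have rA := hτ.pt_indep θ _ hθ hA
  have rB := hτ.pt_indep θ _ hθ hB
  have hdom := (hgen.isPointTransf θ hθ).domain
  obtain ⟨t₀, ht₀⟩ := hdom.nonemptyT
  obtain ⟨x₀, hx₀⟩ := hdom.nonemptyX
  obtain ⟨u₀, hu₀⟩ := hdom.nonemptyU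
  obtain ⟨x₁, hx₁, hxne⟩ := exists_ne_mem hdom.openX hx₀
  obtain ⟨u₁, hu₁, hune⟩ := exists_ne_mem hdom.openU hu₀
  obtain ⟨-, -, hα3⟩ := hα.ne_zero
  obtain ⟨-, -, hδ3⟩ := hδ.ne_zero
  obtain ⟨Pα, hPα, hneα, hfα, -⟩ := hα.formulas
  obtain ⟨Pβ, hPβ, hneβ, hfβ, -⟩ := hβ.formulas
  obtain ⟨P, hP, hneθ, hf, hco⟩ := hδ.formulas
  have hUα : ∀ x ∈ (τ.pt θ).domX, ∀ u ∈ (τ.pt θ).domU,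
      δ 3 * u + psi δ θ.n P x = α 3 * u + psi α 1 Pα x := fun x hx u hu => by
    have hm : (τ.pt θ).Mem t₀ x u := ⟨ht₀, hx, hu⟩
    obtain ⟨hm', -, -, e⟩ := rA t₀ x u hm
    rw [← (hf _ _ _ hm).2.2, ← (hfα _ _ _ hm').2.2, e]
  have hUβ : ∀ x ∈ (τ.pt θ).domX, ∀ u ∈ (τ.pt θ).domU,
      δ 3 * u + psi δ θ.n P x = β 3 * u + psi β 1 Pβ x := fun x hx u hu => by
    have hm : (τ.pt θ).Mem t₀ x u := ⟨ht₀, hx, hu⟩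
    obtain ⟨hm', -, -, e⟩ := rB t₀ x u hm
    rw [← (hf _ _ _ hm).2.2, ← (hfβ _ _ _ hm').2.2, e]
  have eα : α 3 = δ 3 := by
    apply mul_right_cancel₀ (sub_ne_zero.2 hune)
    linear_combination hUα x₀ hx₀ u₀ hu₀ - hUα x₀ hx₀ u₁ hu₁
  have eβ : β 3 = δ 3 := by
    apply mul_right_cancel₀ (sub_ne_zero.2 hune)
    linear_combination hUβ x₀ hx₀ u₀ hu₀ - hUβ x₀ hx₀ u₁ hu₁
  have mA : ∀ x ∈ (τ.pt θ).domX, x ∈ (τ.pt ⟨fun _ => 1, fun _ => 1, fun _ => 0, 1, 0⟩).domX :=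
    fun x hx => (rA t₀ x u₀ ⟨ht₀, hx, hu₀⟩).1.2.1
  have mB : ∀ x ∈ (τ.pt θ).domX, x ∈ (τ.pt ⟨fun _ => 1, Real.exp, fun _ => 0, 1, 0⟩).domX :=
    fun x hx => (rB t₀ x u₀ ⟨ht₀, hx, hu₀⟩).1.2.1
  have habs : ∀ x ∈ (τ.pt θ).domX, |α 4 * Pα x + α 5| = |β 4 * Pβ x + β 5| := by
    intro x hx
    have h1 := hUα x hx u₀ hu₀
    have h2 := hUβ x hx u₀ hu₀
    simp only [psi, div_one, eα] at h1
    simp only [psi, div_one, eβ] at h2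
    have h3 : Real.log |α 4 * Pα x + α 5| = Real.log |β 4 * Pβ x + β 5| :=
      mul_left_cancel₀ hδ3 (by linear_combination h1 - h2)
    exact Real.log_injOn_pos (abs_pos.2 (hneα x (mA x hx))) (abs_pos.2 (hneβ x (mB x hx))) h3
  -- From `a² = b²` and `a a' = b b'` with `a ≠ 0` it follows that `a'² = b'²`. Squares avoid
  -- tracking the signs of the two factors.
  have hsq : ∀ x ∈ (τ.pt θ).domX, α 4 ^ 2 = (β 4 * (1 / Real.exp x)) ^ 2 := by
    intro x hx
    have e : (fun x => (α 4 * Pα x + α 5) ^ 2) =ᶠ[𝓝 x] fun x => (β 4 * Pβ x + β 5) ^ 2 :=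
      (hdom.openX.eventually_mem hx).mono fun y hy => by
        simp only; rw [← sq_abs, habs y hy, sq_abs]
    have d1 := (((hPα x (mA x hx)).const_mul (α 4)).add_const (α 5)).fun_pow 2
    have d2 := (((hPβ x (mB x hx)).const_mul (β 4)).add_const (β 5)).fun_pow 2
    have e2 := (d2.congr_of_eventuallyEq e).unique d1
    have e3 : (α 4 * Pα x + α 5) ^ 2 = (β 4 * Pβ x + β 5) ^ 2 := e.self_of_nhds
    have hn := pow_ne_zero 2 (hneα x (mA x hx))
    apply mul_left_cancel₀ hn
    simp only [Nat.cast_ofNat, Nat.add_one_sub_one, pow_one, div_one, mul_one] at e2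
    generalize α 4 * Pα x + α 5 = a at *
    generalize β 4 * Pβ x + β 5 = b at *
    linear_combination -(1 / 4) * (2 * b * (β 4 * (1 / Real.exp x)) + 2 * a * α 4) * e2
      - (β 4 * (1 / Real.exp x)) ^ 2 * e3
  have hβ4 : β 4 = 0 := by
    by_contra hb
    have h1 := (hsq x₀ hx₀).symm.trans (hsq x₁ hx₁)
    rw [mul_pow, mul_pow] at h1
    have h2 := mul_left_cancel₀ (pow_ne_zero 2 hb) h1
    have h3 := (sq_eq_sq₀ (by positivity) (by positivity)).1 h2
    rw [one_div, one_div] at h3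
    exact hxne (Real.exp_injective (inv_injective h3)).symm
  have hα4 : α 4 = 0 := by
    have := hsq x₀ hx₀
    rw [hβ4, zero_mul] at this
    simpa using this
  have hθabs : ∀ x ∈ (τ.pt θ).domX, |δ 4 * P x + δ 5| = |δ 4 * P x₀ + δ 5| := by
    intro x hx
    have h1 := hUα x hx u₀ hu₀
    have h2 := hUα x₀ hx₀ u₀ hu₀
    simp only [psi, hα4, zero_mul] at h1 h2
    have hn := hθ.n_ne
    have h3 : Real.log |δ 4 * P x + δ 5| = Real.log |δ 4 * P x₀ + δ 5| :=
      mul_left_cancel₀ (neg_ne_zero.2 (div_ne_zero hδ3 hn)) (by linear_combination h1 - h2)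
    exact Real.log_injOn_pos (abs_pos.2 (hneθ x hx)) (abs_pos.2 (hneθ x₀ hx₀)) h3
  -- For `θ` itself `|Ψ|` is constant, so `δ₄` may be replaced by `0` and `δ₅` by this constant
  -- without changing the formulas.
  have he := abs_ne_zero.2 (hneθ x₀ hx₀)
  have hpsi : ∀ x ∈ (τ.pt θ).domX, psi ![δ 0, δ 1, δ 2, δ 3, 0, |δ 4 * P x₀ + δ 5|] θ.n P x
      = psi δ θ.n P x := fun x hx => by
    simp only [psi, Matrix.cons_val, zero_mul, zero_add, abs_abs, hθabs x hx]
  refine ⟨![δ 0, δ 1, δ 2, δ 3, 0, |δ 4 * P x₀ + δ 5|], φ, rfl,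
    ⟨hδ.const_ne, ?_, hδ.smooth_phi, hδ.deriv_phi_ne, ⟨P, hP, ?_, ?_, ?_⟩, hδ.n_eq, hδ.m_eq⟩⟩
  · simpa using he
  · intro x _; simpa using he
  · intro t x u hm
    rw [hpsi x hm.2.1]
    exact hf t x u hm
  · intro x hx
    rw [hpsi x hx]
    obtain ⟨c1, c2, c3⟩ := hco x hx
    simp only [Matrix.cons_val, zero_mul, zero_add, abs_abs, sq_abs]
    have hs : (δ 4 * P x₀ + δ 5) ^ 2 = (δ 4 * P x + δ 5) ^ 2 := by
      rw [← sq_abs, ← hθabs x hx, sq_abs]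
    rw [← hθabs x hx, hs]
    exact ⟨c1, c2, c3⟩

/-- The factor of the composition is the product `Ψ₁ · (Ψ₂ ∘ φ₁)`, and the point is that this
product is again affine in `∫ dx/g`. -/
theorem HasForm.comp {δ₁ δ₂ : Fin 6 → ℝ} {φ₁ φ₂ : ℝ → ℝ} {θ₁ θ₂ : Coeffs} {Φ₁ Φ₂ : PointTransf}
    (h₁ : HasForm δ₁ φ₁ θ Φ₁ θ₁) (h₂ : HasForm δ₂ φ₂ θ₁ Φ₂ θ₂) (hθ : θ.InClass I)
    (hΦ₁ : Φ₁.HasDomainIn I) (hΦ₂ : Φ₂.HasDomainIn univ) (hΦ : Φ.HasDomainIn I)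
    (hcomp : ∀ t x u, Φ.Mem t x u →
        Φ₁.Mem t x u ∧ Φ₂.Mem (Φ₁.T t x u) (Φ₁.X t x u) (Φ₁.U t x u) ∧
        Φ.T t x u = Φ₂.T (Φ₁.T t x u) (Φ₁.X t x u) (Φ₁.U t x u) ∧
        Φ.X t x u = Φ₂.X (Φ₁.T t x u) (Φ₁.X t x u) (Φ₁.U t x u) ∧
        Φ.U t x u = Φ₂.U (Φ₁.T t x u) (Φ₁.X t x u) (Φ₁.U t x u)) :
    ∃ (δ : Fin 6 → ℝ) (φ : ℝ → ℝ), HasForm δ φ θ Φ θ₂ ∧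
        (δ₁ 4 = 0 → δ₂ 4 = 0 → δ 4 = 0) := by
  obtain ⟨P₁, hP₁, hne₁, hf₁, hco₁⟩ := h₁.formulas
  obtain ⟨P₂, hP₂, hne₂, hf₂, hco₂⟩ := h₂.formulas
  obtain ⟨ha0, ha1, ha3⟩ := h₁.ne_zero
  obtain ⟨hb0, hb1, hb3⟩ := h₂.ne_zero
  have hn := hθ.n_ne
  obtain ⟨t₀, ht₀⟩ := hΦ.nonemptyT
  obtain ⟨x₀, hx₀⟩ := hΦ.nonemptyX
  obtain ⟨u₀, hu₀⟩ := hΦ.nonemptyU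
  have m₁ : ∀ x ∈ Φ.domX, x ∈ Φ₁.domX := fun x hx => (hcomp t₀ x u₀ ⟨ht₀, hx, hu₀⟩).1.2.1
  have m₂ : ∀ x ∈ Φ.domX, φ₁ x ∈ Φ₂.domX := fun x hx => by
    obtain ⟨k1, k2, -⟩ := hcomp t₀ x u₀ ⟨ht₀, hx, hu₀⟩
    rw [← (hf₁ _ _ _ k1).2.1]; exact k2.2.1
  have hφ₁ : ∀ x ∈ Φ.domX, HasDerivAt φ₁ (deriv φ₁ x) x := fun x hx =>
    hasDerivAt_of_contDiffOn hΦ₁.openX h₁.smooth_phi (m₁ x hx)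
  have hφ : ∀ x ∈ Φ.domX, deriv (fun x => φ₂ (φ₁ x)) x = deriv φ₂ (φ₁ x) * deriv φ₁ x :=
    fun x hx => ((hasDerivAt_of_contDiffOn hΦ₂.openX h₂.smooth_phi (m₂ x hx)).comp x
      (hφ₁ x hx)).deriv
  have d₁ : ∀ x ∈ Φ.domX, HasDerivAt (fun x => δ₁ 4 * P₁ x + δ₁ 5) (δ₁ 4 * (1 / θ.g x)) x :=
    fun x hx => ((hP₁ x (m₁ x hx)).const_mul _).add_const _
  have d₂ : ∀ x ∈ Φ.domX, HasDerivAt (fun x => δ₂ 4 * P₂ (φ₁ x) + δ₂ 5)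
      (δ₂ 4 * (1 / (δ₁ 0 * (δ₁ 4 * P₁ x + δ₁ 5) ^ 2 * θ.g x))) x := fun x hx => by
    refine ((((hP₂ _ (m₂ x hx)).comp x (hφ₁ x hx)).const_mul (δ₂ 4)).add_const
      (δ₂ 5)).congr_deriv ?_
    rw [(hco₁ x (m₁ x hx)).2.1]
    have k1 := h₁.deriv_phi_ne x (m₁ x hx)
    have k2 := hne₁ x (m₁ x hx)
    have k3 := hθ.g_ne x (hΦ.subset hx)
    field_simp
  -- This expression is `g` times the derivative of the product of the two factors; its own
  -- derivative vanishes, so `Q` is the new `δ₄`.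
  obtain ⟨Q, hQ⟩ : ∃ Q, ∀ x ∈ Φ.domX, δ₁ 4 * (δ₂ 4 * P₂ (φ₁ x) + δ₂ 5)
      + δ₂ 4 / δ₁ 0 * (δ₁ 4 * P₁ x + δ₁ 5)⁻¹ = Q := by
    refine ⟨_, fun x hx => eq_of_hasDerivAt_zero hΦ.openX hΦ.connX
      (F := fun x => δ₁ 4 * (δ₂ 4 * P₂ (φ₁ x) + δ₂ 5)
        + δ₂ 4 / δ₁ 0 * (δ₁ 4 * P₁ x + δ₁ 5)⁻¹) (fun z hz => ?_) hx hx₀⟩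
    have k2 := hne₁ z (m₁ z hz)
    refine (((d₂ z hz).const_mul (δ₁ 4)).fun_add (((d₁ z hz).fun_inv k2).const_mul
      (δ₂ 4 / δ₁ 0))).congr_deriv ?_
    have k3 := hθ.g_ne z (hΦ.subset hz)
    field_simp
    ring
  have hΨ : ∀ x ∈ Φ.domX, Q * P₁ x
      + ((δ₁ 4 * P₁ x₀ + δ₁ 5) * (δ₂ 4 * P₂ (φ₁ x₀) + δ₂ 5) - Q * P₁ x₀)
      = (δ₁ 4 * P₁ x + δ₁ 5) * (δ₂ 4 * P₂ (φ₁ x) + δ₂ 5) := fun x hx => by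
    have := sub_eq_sub_of_hasDerivAt hΦ.openX hΦ.connX
      (F := fun x => (δ₁ 4 * P₁ x + δ₁ 5) * (δ₂ 4 * P₂ (φ₁ x) + δ₂ 5))
      (G := fun x => Q * P₁ x) (F' := fun x => Q * (1 / θ.g x))
      (fun z hz => ((d₁ z hz).fun_mul (d₂ z hz)).congr_deriv (by
        have k2 := hne₁ z (m₁ z hz)
        have k3 := hθ.g_ne z (hΦ.subset hz)
        rw [← hQ z hz]
        field_simp))
      (fun z hz => (hP₁ z (m₁ z hz)).const_mul Q) hx hx₀
    linear_combination -this
  set c := (δ₁ 4 * P₁ x₀ + δ₁ 5) * (δ₂ 4 * P₂ (φ₁ x₀) + δ₂ 5) - Q * P₁ x₀ with hc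
  have hne : ∀ x ∈ Φ.domX, (δ₁ 4 * P₁ x + δ₁ 5) * (δ₂ 4 * P₂ (φ₁ x) + δ₂ 5) ≠ 0 := fun x hx =>
    mul_ne_zero (hne₁ x (m₁ x hx)) (hne₂ _ (m₂ x hx))
  have hpsi : ∀ x ∈ Φ.domX,
      psi ![δ₁ 0 * δ₂ 0, δ₁ 1 * δ₂ 1, δ₂ 1 * δ₁ 2 + δ₂ 2, δ₁ 3 * δ₂ 3, Q, c] θ.n P₁ x
      = δ₂ 3 * psi δ₁ θ.n P₁ x + psi δ₂ θ₁.n P₂ (φ₁ x) := fun x hx => by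
    simp only [psi, Matrix.cons_val]
    rw [hΨ x hx, h₁.n_eq, abs_mul, Real.log_mul (abs_ne_zero.2 (hne₁ x (m₁ x hx)))
      (abs_ne_zero.2 (hne₂ _ (m₂ x hx)))]
    field_simp
    ring
  refine ⟨![δ₁ 0 * δ₂ 0, δ₁ 1 * δ₂ 1, δ₂ 1 * δ₁ 2 + δ₂ 2, δ₁ 3 * δ₂ 3, Q, c],
    fun x => φ₂ (φ₁ x), ⟨?_, ?_, ?_, ?_, ⟨P₁, fun x hx => hP₁ x (m₁ x hx), ?_, ?_, ?_⟩, ?_, ?_⟩, ?_⟩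
  · simp [ha0, ha1, ha3, hb0, hb1, hb3]
  · intro h
    simp only [Matrix.cons_val, Prod.mk.injEq] at h
    have := hΨ x₀ hx₀
    rw [h.1, h.2] at this
    exact hne x₀ hx₀ (by linear_combination -this)
  · exact h₂.smooth_phi.comp (h₁.smooth_phi.mono m₁) m₂
  · intro x hx
    rw [hφ x hx]
    exact mul_ne_zero (h₂.deriv_phi_ne _ (m₂ x hx)) (h₁.deriv_phi_ne x (m₁ x hx))
  · intro x hx
    simp only [Matrix.cons_val]
    rw [hΨ x hx]
    exact hne x hx
  · intro t x u hm
    obtain ⟨k1, k2, e1, e2, e3⟩ := hcomp t x u hm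
    obtain ⟨a1, a2, a3⟩ := hf₁ _ _ _ k1
    obtain ⟨b1, b2, b3⟩ := hf₂ _ _ _ k2
    rw [e1, e2, e3, b1, b2, b3, a1, a2, a3, hpsi x hm.2.1]
    simp only [Matrix.cons_val]
    exact ⟨by ring, trivial, by ring⟩
  · intro x hx
    obtain ⟨a1, a2, a3⟩ := hco₁ x (m₁ x hx)
    obtain ⟨b1, b2, b3⟩ := hco₂ _ (m₂ x hx)
    have k1 := h₁.deriv_phi_ne x (m₁ x hx)
    have k2 := h₂.deriv_phi_ne _ (m₂ x hx)
    have hE : Real.exp (-(θ.m / (δ₁ 3 * δ₂ 3)) *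
        (δ₂ 3 * psi δ₁ θ.n P₁ x + psi δ₂ θ₁.n P₂ (φ₁ x)))
        = Real.exp (-(θ₁.m / δ₂ 3) * psi δ₂ θ₁.n P₂ (φ₁ x))
          * Real.exp (-(θ.m / δ₁ 3) * psi δ₁ θ.n P₁ x) := by
      rw [← Real.exp_add, h₁.m_eq]
      congr 1
      field_simp
      ring
    rw [b1, b2, b3, a1, a2, a3, hpsi x hx, hφ x hx]
    simp only [Matrix.cons_val]
    rw [hΨ x hx, abs_mul, hE]
    refine ⟨?_, ?_, ?_⟩ <;> field_simp
  · rw [h₂.n_eq, h₁.n_eq, div_div]; rfl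
  · rw [h₂.m_eq, h₁.m_eq, div_div]; rfl
  · intro z1 z2
    have := hQ x₀ hx₀
    simp only [z1, z2, zero_mul, zero_div, add_zero] at this
    exact this.symm

/-- The factor of the inverse is `1/Ψ`, whose derivative in `x̃` is `-δ₀δ₄/g̃`; so it is affine in
`∫ dx̃/g̃` with the new `δ₄` equal to `-δ₀δ₄`. -/
theorem HasForm.symm {Φ' : PointTransf} (h : HasForm δ φ θ Φ θ') (hθ : θ.InClass I)
    (hΦ : Φ.HasDomainIn I) (hΦ' : Φ'.HasDomainIn univ)
    (hinv : ∀ t x u, Φ'.Mem t x u →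
        Φ.Mem (Φ'.T t x u) (Φ'.X t x u) (Φ'.U t x u) ∧
        Φ.T (Φ'.T t x u) (Φ'.X t x u) (Φ'.U t x u) = t ∧
        Φ.X (Φ'.T t x u) (Φ'.X t x u) (Φ'.U t x u) = x ∧
        Φ.U (Φ'.T t x u) (Φ'.X t x u) (Φ'.U t x u) = u) :
    ∃ (δ' : Fin 6 → ℝ) (φ' : ℝ → ℝ), HasForm δ' φ' θ' Φ' θ ∧ (δ 4 = 0 → δ' 4 = 0) := by
  obtain ⟨P, hP, hne, hf, hco⟩ := h.formulas
  obtain ⟨h0, h1, h3⟩ := h.ne_zero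
  have hn := hθ.n_ne
  obtain ⟨t₀, ht₀⟩ := hΦ'.nonemptyT
  obtain ⟨u₀, hu₀⟩ := hΦ'.nonemptyU
  have hX : ∀ t y u, Φ'.Mem t y u → Φ'.X t y u = Function.invFunOn φ Φ.domX y := by
    intro t y u hm
    obtain ⟨k1, -, k2, -⟩ := hinv t y u hm
    rw [(hf _ _ _ k1).2.1] at k2
    rw [← k2, invFunOn_apply hΦ.openX hΦ.connX h.smooth_phi h.deriv_phi_ne k1.2.1, k2]
  have hy : ∀ y ∈ Φ'.domX, ∃ x ∈ Φ.domX, φ x = y := by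
    intro y hy
    obtain ⟨k1, -, k2, -⟩ := hinv t₀ y u₀ ⟨ht₀, hy, hu₀⟩
    exact ⟨_, k1.2.1, (hf _ _ _ k1).2.1.symm.trans k2⟩
  have inv := fun {x} (hx : x ∈ Φ.domX) =>
    invFunOn_apply hΦ.openX hΦ.connX h.smooth_phi h.deriv_phi_ne hx
  have dinv := fun {x} (hx : x ∈ Φ.domX) =>
    hasDerivAt_invFunOn hΦ.openX hΦ.connX h.smooth_phi h.deriv_phi_ne hx
  have hN : δ 4 ^ 2 + δ 5 ^ 2 ≠ 0 := by
    intro e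
    apply h.pair_ne
    have a : δ 4 = 0 := by nlinarith [sq_nonneg (δ 4), sq_nonneg (δ 5)]
    have b : δ 5 = 0 := by nlinarith [sq_nonneg (δ 4), sq_nonneg (δ 5)]
    rw [a, b]
  -- A fractional linear function of `P` with denominator proportional to `Ψ` and determinant of the
  -- numerator pair `δ₄² + δ₅²`. It is an antiderivative of `1/g̃` also for `δ₄ = 0`, where `1/Ψ` is
  -- constant and yields none.
  set Q : ℝ → ℝ := fun y => (δ 5 * P (Function.invFunOn φ Φ.domX y) - δ 4)
    / (δ 0 * (δ 4 ^ 2 + δ 5 ^ 2) * (δ 4 * P (Function.invFunOn φ Φ.domX y) + δ 5)) with hQ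
  have hΨ : ∀ x ∈ Φ.domX, -(δ 4 * δ 0) * Q (φ x) + δ 5 / (δ 4 ^ 2 + δ 5 ^ 2)
      = (δ 4 * P x + δ 5)⁻¹ := fun x hx => by
    simp only [hQ, inv hx]
    have := hne x hx
    field_simp
    ring
  have hpsi : ∀ x ∈ Φ.domX, psi ![1 / δ 0, 1 / δ 1, -(δ 2 / δ 1), 1 / δ 3, -(δ 4 * δ 0),
      δ 5 / (δ 4 ^ 2 + δ 5 ^ 2)] θ'.n Q (φ x) = -(psi δ θ.n P x / δ 3) := fun x hx => by
    simp only [psi, Matrix.cons_val]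
    rw [hΨ x hx, h.n_eq, abs_inv, Real.log_inv]
    field_simp
  refine ⟨![1 / δ 0, 1 / δ 1, -(δ 2 / δ 1), 1 / δ 3, -(δ 4 * δ 0), δ 5 / (δ 4 ^ 2 + δ 5 ^ 2)],
    Function.invFunOn φ Φ.domX, ⟨?_, ?_, ?_, ?_, ⟨Q, ?_, ?_, ?_, ?_⟩, ?_, ?_⟩, ?_⟩
  · simp [h0, h1, h3]
  · intro e
    simp only [Matrix.cons_val, Prod.mk.injEq] at e
    have e4 : δ 4 = 0 := by simpa [h0] using e.1
    have e5 : δ 5 = 0 := by simpa [hN] using e.2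
    exact h.pair_ne (by rw [e4, e5])
  · intro y hy'
    obtain ⟨x, hx, rfl⟩ := hy y hy'
    exact (contDiffAt_invFunOn hΦ.openX hΦ.connX h.smooth_phi h.deriv_phi_ne
      hx).contDiffWithinAt
  · intro y hy'
    obtain ⟨x, hx, rfl⟩ := hy y hy'
    rw [(dinv hx).deriv]
    exact inv_ne_zero (h.deriv_phi_ne x hx)
  · intro y hy'
    obtain ⟨x, hx, rfl⟩ := hy y hy'
    have hPx : HasDerivAt (fun y => P (Function.invFunOn φ Φ.domX y))
        (1 / θ.g x * (deriv φ x)⁻¹) (φ x) :=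
      HasDerivAt.comp (φ x) (by rw [inv hx]; exact hP x hx) (dinv hx)
    have k1 := hne x hx
    have k2 := h.deriv_phi_ne x hx
    have k3 := hθ.g_ne x (hΦ.subset hx)
    refine (((hPx.const_mul (δ 5)).sub_const (δ 4)).fun_div (((hPx.const_mul (δ 4)).add_const
      (δ 5)).const_mul (δ 0 * (δ 4 ^ 2 + δ 5 ^ 2))) ?_).congr_deriv ?_
    · rw [inv hx]
      exact mul_ne_zero (mul_ne_zero h0 hN) k1
    · rw [inv hx, (hco x hx).2.1]
      field_simp
      ring
  · intro y hy'
    obtain ⟨x, hx, rfl⟩ := hy y hy'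
    simp only [Matrix.cons_val]
    rw [hΨ x hx]
    exact inv_ne_zero (hne x hx)
  · intro t y u hm
    obtain ⟨k1, e1, e2, e3⟩ := hinv t y u hm
    obtain ⟨x, hx, rfl⟩ := hy y hm.2.1
    obtain ⟨a1, a2, a3⟩ := hf _ _ _ k1
    rw [a1] at e1
    rw [a3, hX _ _ _ hm, inv hx] at e3
    rw [hpsi x hx]
    simp only [Matrix.cons_val]
    refine ⟨?_, hX _ _ _ hm, ?_⟩
    · field_simp
      linear_combination e1
    · field_simp
      linear_combination e3
  · intro y hy'
    obtain ⟨x, hx, rfl⟩ := hy y hy'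
    obtain ⟨a1, a2, a3⟩ := hco x hx
    have k1 := hne x hx
    have k2 := h.deriv_phi_ne x hx
    have k4 := abs_ne_zero.2 k1
    have hE : Real.exp (-(θ'.m / (1 / δ 3)) * -(psi δ θ.n P x / δ 3))
        * Real.exp (-(θ.m / δ 3) * psi δ θ.n P x) = 1 := by
      rw [← Real.exp_add, h.m_eq, Real.exp_eq_one_iff]
      field_simp
      ring
    rw [hpsi x hx, inv hx, a1, a2, a3, (dinv hx).deriv]
    simp only [Matrix.cons_val]
    rw [hΨ x hx, abs_inv]
    refine ⟨?_, ?_, ?_⟩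
    · field_simp
    · field_simp
    · generalize Real.exp (-(θ'.m / (1 / δ 3)) * -(psi δ θ.n P x / δ 3)) = E1 at *
      generalize Real.exp (-(θ.m / δ 3) * psi δ θ.n P x) = E2 at *
      field_simp
      linear_combination -θ.h x * hE
  · rw [h.n_eq]; simp only [Matrix.cons_val]; field_simp
  · rw [h.m_eq]; simp only [Matrix.cons_val]; field_simp
  · intro e
    simp [e]

end closure

theorem theorem1 (I : Set ℝ) (hI_open : IsOpen I) (hI_conn : I.OrdConnected)
    (hI_ne : I.Nonempty) :
    -- every generalized extended equivalence transformation has the stated form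
    (∀ τ : TransfRule, IsGeneralizedExtendedEquiv I τ →
      ∀ θ : Coeffs, θ.InClass I →
        ∃ (δ : Fin 6 → ℝ) (φ : ℝ → ℝ), HasForm δ φ θ (τ.pt θ) (τ.coeffs θ)) ∧
    -- every transformation of the stated form belongs to the generalized extended equivalence
    -- group, with the same constants and the same function for all equations of the class
    (∀ (δ : Fin 6 → ℝ) (φ : ℝ → ℝ) (θ : Coeffs) (Φ : PointTransf) (θ' : Coeffs),
      θ.InClass I → Φ.HasDomainIn I → HasForm δ φ θ Φ θ' →
        ∃ τ : TransfRule, IsGeneralizedExtendedEquiv I τ ∧ τ.Induces θ Φ θ' ∧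
          ∀ η : Coeffs, η.InClass I → HasForm δ φ η (τ.pt η) (τ.coeffs η)) ∧
    -- every usual equivalence transformation has the stated form with `δ₄ = 0`
    (∀ τ : TransfRule, IsUsualEquiv I τ →
      ∀ θ : Coeffs, θ.InClass I →
        ∃ (δ : Fin 6 → ℝ) (φ : ℝ → ℝ), δ 4 = 0 ∧ HasForm δ φ θ (τ.pt θ) (τ.coeffs θ)) ∧
    -- every transformation of the stated form with `δ₄ = 0` belongs to the usual equivalence group
    (∀ (δ : Fin 6 → ℝ) (φ : ℝ → ℝ) (θ : Coeffs) (Φ : PointTransf) (θ' : Coeffs),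
      θ.InClass I → Φ.HasDomainIn I → HasForm δ φ θ Φ θ' → δ 4 = 0 →
        ∃ τ : TransfRule, IsUsualEquiv I τ ∧ τ.Induces θ Φ θ' ∧
          ∀ η : Coeffs, η.InClass I →
            ∃ d : ℝ, HasForm (Function.update δ 5 d) φ η (τ.pt η) (τ.coeffs η)) ∧
    -- the transformations of the stated form, and those with `δ₄ = 0`, are closed under composition
    (∀ (δ₁ δ₂ : Fin 6 → ℝ) (φ₁ φ₂ : ℝ → ℝ) (θ θ₁ θ₂ : Coeffs) (Φ₁ Φ₂ Φ : PointTransf),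
      θ.InClass I → Φ₁.HasDomainIn I → Φ₂.HasDomainIn univ → Φ.HasDomainIn I →
      HasForm δ₁ φ₁ θ Φ₁ θ₁ → HasForm δ₂ φ₂ θ₁ Φ₂ θ₂ →
      (∀ t x u, Φ.Mem t x u →
        Φ₁.Mem t x u ∧ Φ₂.Mem (Φ₁.T t x u) (Φ₁.X t x u) (Φ₁.U t x u) ∧
        Φ.T t x u = Φ₂.T (Φ₁.T t x u) (Φ₁.X t x u) (Φ₁.U t x u) ∧
        Φ.X t x u = Φ₂.X (Φ₁.T t x u) (Φ₁.X t x u) (Φ₁.U t x u) ∧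
        Φ.U t x u = Φ₂.U (Φ₁.T t x u) (Φ₁.X t x u) (Φ₁.U t x u)) →
      ∃ (δ : Fin 6 → ℝ) (φ : ℝ → ℝ), HasForm δ φ θ Φ θ₂ ∧
        (δ₁ 4 = 0 → δ₂ 4 = 0 → δ 4 = 0)) ∧
    -- and under inversion
    (∀ (δ : Fin 6 → ℝ) (φ : ℝ → ℝ) (θ θ' : Coeffs) (Φ Φ' : PointTransf),
      θ.InClass I → Φ.HasDomainIn I → Φ'.HasDomainIn univ → HasForm δ φ θ Φ θ' →
      (∀ t x u, Φ'.Mem t x u →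
        Φ.Mem (Φ'.T t x u) (Φ'.X t x u) (Φ'.U t x u) ∧
        Φ.T (Φ'.T t x u) (Φ'.X t x u) (Φ'.U t x u) = t ∧
        Φ.X (Φ'.T t x u) (Φ'.X t x u) (Φ'.U t x u) = x ∧
        Φ.U (Φ'.T t x u) (Φ'.X t x u) (Φ'.U t x u) = u) →
      ∃ (δ' : Fin 6 → ℝ) (φ' : ℝ → ℝ), HasForm δ' φ' θ' Φ' θ ∧
        (δ 4 = 0 → δ' 4 = 0)) := by
  refine ⟨fun τ hτ θ hθ => hτ.hasForm hI_open hI_conn hI_ne hθ,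
    fun δ φ θ Φ θ' hθ hΦ h => h.exists_rule hI_open hI_conn hθ hΦ,
    fun τ hτ θ hθ => IsUsualEquiv.hasForm hτ hI_open hI_conn hI_ne hθ,
    fun δ φ θ Φ θ' hθ hΦ h h4 => h.exists_usual_rule hI_open hI_conn hθ hΦ h4,
    fun δ₁ δ₂ φ₁ φ₂ θ θ₁ θ₂ Φ₁ Φ₂ Φ hθ hΦ₁ hΦ₂ hΦ h₁ h₂ hc => h₁.comp h₂ hθ hΦ₁ hΦ₂ hΦ hc,
    fun δ φ θ θ' Φ Φ' hθ hΦ hΦ' h hinv => h.symm hθ hΦ hΦ' hinv⟩
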